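/- **Setting.** Let $X$ be an oriented smooth manifold of dimension $n+1$ ($n\ge 0$) and let $\rho:Y\to X$ be a smooth fibre bundle with $k$-dimensional fibre. Let $\mathcal L: J^1Y\to\bigwedge^{n+1}X$ be a smooth first-order Lagrangian density, in adapted coordinates $\mathcal L = L(x^\mu,y^a,y^a_\mu)\,d^{n+1}x$. The Poincaré–Cartan form and the multisymplectic form on $J^1Y$ are $$\Theta_L=\Big(L-\frac{\partial L}{\partial y^a_\mu}y^a_\mu\Big)d^{n+1}x+\frac{\partial L}{\partial y^a_\mu}\,dy^a\wedge d^nx_\mu,\qquad \Omega_L=-\mathbf d\Theta_L,\qquad d^nx_\mu=\mathbf i_{\partial/\partial x^\mu}d^{n+1}x .$$ Let $U\subset X$ be open with smooth boundary $\partial U$. A *solution* on $U$ is a section $\phi$ of $\rho$ over $\overline U$, smooth up to the boundary, with $\frac{d}{dx^\mu}\big(\frac{\partial L}{\partial y^a_\mu}(j^1\phi)\big)-\frac{\partial L}{\partial y^a}(j^1\phi)=0$ on $U$. A *first variation* of a solution $\phi$ is a vector field $V=\frac{d}{d\epsilon}\phi_\epsilon|_{\epsilon=0}$ along $\phi$,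 where $\phi_\epsilon$ is a curve of solutions with $\phi_0=\phi$, smooth in $(\epsilon,x)$ up to the boundary; such a $V$ is vertical, and $j^1V$ is its prolongation, $V^a\partial/\partial y^a+\partial_\mu V^a\,\partial/\partial y^a_\mu$. The *boundary Lagrangian* is $L_{\partial U}(\varphi)=\int_U L(j^1\phi)\,d^{n+1}x$, where $\phi$ is a solution with $\phi|_{\partial U}=\varphi$. It is defined at those boundary data $\varphi$ that are the boundary values of some solution and for which all solutions with these boundary values have the same action (in particular whenever the solution is unique). **(1)** Suppose that $\overline U$ is compact. * If $\phi$ is a solution and $L_{\partial U}$ is defined at $\varphi=\phi|_{\partial U}$, then $L_{\partial U}(\varphi)=\int_U (j^1\phi)^*\Theta_L$. * If $\phi_\epsilon$ is a smooth curve of solutions, with first variation $V$ of $\phi=\phi_0$, such that $L_{\partial U}$ is defined at all $\varphi_\epsilon=\phi_\epsilon|_{\partial U}$, and if $\varphi=\varphi_0$, $\delta\varphi=\frac{d}{d\epsilon}\varphi_\epsilon|_{\epsilon=0}$, then $$\mathbf dL_{\partial U}(\varphi)\cdot\delta\varphi=\frac{d}{d\epsilon}\Big|_{\epsilon=0}L_{\partial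 U}(\varphi_\epsilon)=\int_{\partial U}(j^1\phi)^*(\mathbf i_{j^1V}\Theta_L).$$ * If $\phi_{s,t}$ is a smooth two-parameter family of solutions such that $L_{\partial U}$ is defined at all $\varphi_{s,t}=\phi_{s,t}|_{\partial U}$, if $\phi=\phi_{0,0}$, $V=\partial_s\phi_{s,t}|_{s=t=0}$, $W=\partial_t\phi_{s,t}|_{s=t=0}$, and $\varphi,\delta\varphi,\delta\varphi'$ are the restrictions of $\phi,V,W$ to $\partial U$, then $$\mathbf d^2L_{\partial U}(\varphi)\cdot(\delta\varphi,\delta\varphi')=\int_{\partial U}(j^1\phi)^*(\mathbf i_{j^1W}\mathbf i_{j^1V}\Omega_L),$$ where the left side is $\partial_s\big|_{0}\big(\mathbf dL_{\partial U}(\varphi_{s,0})\cdot\partial_t\varphi_{s,t}|_{t=0}\big)-\partial_t\big|_{0}\big(\mathbf dL_{\partial U}(\varphi_{0,t})\cdot\partial_s\varphi_{s,t}|_{s=0}\big)$. **(2) (Multisymplectic form formula.)** Let $\phi$ be a solution on $U$ and let $V,W$ be first variations of $\phi$. If $\overline U$ is compact, or, more generally, if $V$ or $W$ vanishes on $\overline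 U\setminus K$ for some compact $K$, then $$\int_{\partial U}(j^1\phi)^*\big(\mathbf i_{j^1W}\mathbf i_{j^1V}\Omega_L\big)=0 .$$ **(3) (Crnković–Witten form.)** In the situation of (2), let $\partial U=\Sigma_+-\Sigma_-$, that is, $\partial U$ is the union of two disjoint closed oriented hypersurfaces $\Sigma_\pm$, where $\Sigma_+$ has the boundary orientation and $\Sigma_-$ the opposite one (for instance two spacelike hypersurfaces of a Lorentzian metric that bound $U$). Then $$\int_{\Sigma_-}(j^1\phi)^*\big(\mathbf i_{j^1W}\mathbf i_{j^1V}\Omega_L\big)=\int_{\Sigma_+}(j^1\phi)^*\big(\mathbf i_{j^1W}\mathbf i_{j^1V}\Omega_L\big).$$ -/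

import Mathlib

open Set Topology MeasureTheory Manifold
open scoped ContDiff

noncomputable section

namespace FieldTheory

/-! ### Manifolds, orientations, differential forms and their integrals -/

/-- The coordinate space `ℝᵐ`. -/
abbrev Coord (m : ℕ) : Type := Fin m → ℝ

/-- The model of `ℝᵐ` over itself. -/
abbrev mdl (m : ℕ) : ModelWithCorners ℝ (Coord m) (Coord m) := 𝓘(ℝ, Coord m)

/-- The model for the total space of a bundle: `m` base coordinates, `k` fibre coordinates. -/
abbrev mdlTot (m k : ℕ) : ModelWithCorners ℝ (Coord m × Coord k) (Coord m × Coord k) :=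
  𝓘(ℝ, Coord m × Coord k)

section Forms

variable {m : ℕ} {X : Type*} [TopologicalSpace X] [ChartedSpace (Coord m) X]

/-- An orientation of `X`, given by an atlas of smooth charts whose coordinate changes have
positive Jacobian determinant. -/
structure OrientedAtlas (m : ℕ) (X : Type*) [TopologicalSpace X] [ChartedSpace (Coord m) X] where
  charts : Set (OpenPartialHomeomorph X (Coord m))
  smooth : ∀ e ∈ charts, e ∈ IsManifold.maximalAtlas (mdl m) ∞ X
  cover : ∀ x : X, ∃ e ∈ charts, x ∈ e.source
  det_pos : ∀ e ∈ charts, ∀ e' ∈ charts, ∀ x ∈ e.source ∩ e'.source,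
    0 < (fderiv ℝ (e' ∘ e.symm) (e x)).det

/-- A smooth chart that is positively oriented. -/
def OrientedAtlas.IsPositive (𝒪 : OrientedAtlas m X) (e : OpenPartialHomeomorph X (Coord m)) :
    Prop :=
  e ∈ IsManifold.maximalAtlas (mdl m) ∞ X ∧
    ∀ e' ∈ 𝒪.charts, ∀ x ∈ e'.source ∩ e.source, 0 < (fderiv ℝ (e ∘ e'.symm) (e' x)).det

/-- Differential forms of degree `p` on `X` (no regularity is imposed). -/
abbrev DForm (m : ℕ) (X : Type*) [TopologicalSpace X] [ChartedSpace (Coord m) X] (p : ℕ) :=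
  ∀ x : X, TangentSpace (mdl m) x [⋀^Fin p]→L[ℝ] ℝ

/-- The form `α` written in the chart `e`, i.e. its pullback along `e⁻¹`. -/
def DForm.inChart {p : ℕ} (α : DForm m X p) (e : OpenPartialHomeomorph X (Coord m))
    (u : Coord m) : Coord m [⋀^Fin p]→L[ℝ] ℝ :=
  (α (e.symm u)).compContinuousLinearMap (mfderiv (mdl m) (mdl m) e.symm u)

/-- Positively oriented charts around all points of `X`, with a subordinate smooth partition of
unity. -/
structure TopPartition (𝒪 : OrientedAtlas m X) where
  chart : X → OpenPartialHomeomorph X (Coord m)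
  positive : ∀ p, 𝒪.IsPositive (chart p)
  mem_source : ∀ p, p ∈ (chart p).source
  weight : SmoothPartitionOfUnity X (mdl m) X univ
  subordinate : ∀ p, tsupport (weight p) ⊆ (chart p).source

/-- The contribution of one chart to `∫_U η`, as a function on coordinate space. -/
def TopPartition.piece {𝒪 : OrientedAtlas m X} (A : TopPartition 𝒪) (η : DForm m X m) (p : X)
    (u : Coord m) : ℝ :=
  A.weight p ((A.chart p).symm u) * η.inChart (A.chart p) u (fun μ => Pi.single μ 1)

/-- The part of coordinate space over which that contribution is integrated. -/
def TopPartition.region {𝒪 : OrientedAtlas m X} (A : TopPartition 𝒪) (U : Set X) (p : X) :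
    Set (Coord m) :=
  (A.chart p).target ∩ (A.chart p).symm ⁻¹' U

/-- `∫_U η = c` for a form `η` of top degree: the integral computed from charts and a partition
of unity converges to `c`, whatever charts and partition are used. -/
def HasTopIntegral (𝒪 : OrientedAtlas m X) (U : Set X) (η : DForm m X m) (c : ℝ) : Prop :=
  Nonempty (TopPartition 𝒪) ∧ ∀ A : TopPartition 𝒪,
    (∀ p, IntegrableOn (A.piece η p) (A.region U p)) ∧
    (Function.support fun p => ∫ u in A.region U p, A.piece η p u).Finite ∧
    ∑ᶠ p, ∫ u in A.region U p, A.piece η p u = c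

end Forms

section Hypersurfaces

variable {n : ℕ} {X : Type*} [TopologicalSpace X] [ChartedSpace (Coord (n + 1)) X]

/-- `e` is a positively oriented chart of `X` adapted to the hypersurface `S`: `S` is `x⁰ = 0`, and
the set `B` is the side `x⁰ < 0` (if `s = 1`) or the side `x⁰ > 0` (if `s = -1`). -/
def IsSliceChart (𝒪 : OrientedAtlas (n + 1) X) (S B : Set X)
    (e : OpenPartialHomeomorph X (Coord (n + 1))) (s : ℝ) : Prop :=
  𝒪.IsPositive e ∧ (s = 1 ∨ s = -1) ∧
    ∀ q ∈ e.source, (q ∈ S ↔ e q 0 = 0) ∧ (q ∈ B ↔ s * e q 0 < 0)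

/-- The set `U` has smooth boundary: near each of its boundary points, suitable smooth coordinates
turn it into a half space. -/
def HasSmoothBoundary (𝒪 : OrientedAtlas (n + 1) X) (U : Set X) : Prop :=
  ∀ p ∈ frontier U, ∃ e s, p ∈ e.source ∧ IsSliceChart 𝒪 (frontier U) U e s

/-- Charts adapted to the hypersurface `S` with side `B` around all points of `S`, with a
subordinate smooth partition of unity along `S`. -/
structure SlicePartition (𝒪 : OrientedAtlas (n + 1) X) (S B : Set X) where
  chart : S → OpenPartialHomeomorph X (Coord (n + 1))
  sgn : S → ℝ
  slice : ∀ p, IsSliceChart 𝒪 S B (chart p) (sgn p)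
  mem_source : ∀ p : S, (p : X) ∈ (chart p).source
  weight : SmoothPartitionOfUnity S (mdl (n + 1)) X S
  subordinate : ∀ p, tsupport (weight p) ⊆ (chart p).source

/-- The coordinates `y ∈ ℝⁿ` on the slice `x⁰ = 0` of an adapted chart. -/
def SlicePartition.region {𝒪 : OrientedAtlas (n + 1) X} {S B : Set X} (A : SlicePartition 𝒪 S B)
    (p : S) : Set (Coord n) :=
  {y | (Fin.cons 0 y : Coord (n + 1)) ∈ (A.chart p).target}

/-- The contribution of one adapted chart to `∫_S α`, as a function on the slice. The sign makes
`S` oriented as the boundary of `B` (outward normal first). -/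
def SlicePartition.piece {𝒪 : OrientedAtlas (n + 1) X} {S B : Set X} (A : SlicePartition 𝒪 S B)
    (α : DForm (n + 1) X n) (p : S) (y : Coord n) : ℝ :=
  A.sgn p * (A.weight p ((A.chart p).symm (Fin.cons 0 y)) *
    α.inChart (A.chart p) (Fin.cons 0 y) (fun j => Pi.single j.succ 1))

/-- `∫_S α = c`, where the hypersurface `S` of `X` carries the orientation as (part of) the boundary
of `B`, i.e. the one given by the normals that point out of `B`. Only the germ of `B` along `S`
matters. As for `HasTopIntegral`, the value must not depend on charts and partition. -/
def HasHypersurfaceIntegral (𝒪 : OrientedAtlas (n + 1) X) (S B : Set X) (α : DForm (n + 1) X n)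
    (c : ℝ) : Prop :=
  Nonempty (SlicePartition 𝒪 S B) ∧ ∀ A : SlicePartition 𝒪 S B,
    (∀ p, IntegrableOn (A.piece α p) (A.region p)) ∧
    (Function.support fun p => ∫ y in A.region p, A.piece α p y).Finite ∧
    ∑ᶠ p, ∫ y in A.region p, A.piece α p y = c

/-- `∫_{∂U} α = c`, with the boundary orientation. -/
def HasBoundaryIntegral (𝒪 : OrientedAtlas (n + 1) X) (U : Set X) (α : DForm (n + 1) X n)
    (c : ℝ) : Prop :=
  HasHypersurfaceIntegral 𝒪 (frontier U) U α c

end Hypersurfaces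

/-! ### Fibre bundles, jets, Lagrangian densities -/

section Bundles

variable {m k : ℕ}
  {X : Type*} [TopologicalSpace X] [ChartedSpace (Coord m) X]
  {Y : Type*} [TopologicalSpace Y] [ChartedSpace (Coord m × Coord k) Y]

/-- `ρ : Y → X` is a smooth fibre bundle with typical fibre `F`. -/
def IsSmoothFiberBundle (m k : ℕ) {X : Type*} [TopologicalSpace X] [ChartedSpace (Coord m) X]
    {Y : Type*} [TopologicalSpace Y] [ChartedSpace (Coord m × Coord k) Y]
    (F : Type*) [TopologicalSpace F] [ChartedSpace (Coord k) F] (ρ : Y → X) : Prop :=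
  ∀ x : X, ∃ e : Bundle.Trivialization F ρ, x ∈ e.baseSet ∧
    ContMDiffOn (mdlTot m k) ((mdl m).prod (mdl k)) ∞ e e.source ∧
    ContMDiffOn ((mdl m).prod (mdl k)) (mdlTot m k) ∞ e.toOpenPartialHomeomorph.symm e.target

/-- Coordinates `(x^μ, y^a)` on `Y` adapted to the projection `ρ`. -/
structure AdaptedChart (m k : ℕ) {X : Type*} [TopologicalSpace X] [ChartedSpace (Coord m) X]
    {Y : Type*} [TopologicalSpace Y] [ChartedSpace (Coord m × Coord k) Y] (ρ : Y → X) where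
  base : OpenPartialHomeomorph X (Coord m)
  tot : OpenPartialHomeomorph Y (Coord m × Coord k)
  base_smooth : base ∈ IsManifold.maximalAtlas (mdl m) ∞ X
  tot_smooth : tot ∈ IsManifold.maximalAtlas (mdlTot m k) ∞ Y
  adapted : ∀ y ∈ tot.source, ρ y ∈ base.source ∧ (tot y).1 = base (ρ y)

/-- The first jet bundle `J¹Y`: a point is a `y ∈ Y` with the derivative at `ρ y` of a local section
through `y`, i.e. a linear right inverse of `T_y ρ`. -/
structure Jet (m k : ℕ) {X : Type*} [TopologicalSpace X] [ChartedSpace (Coord m) X]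
    {Y : Type*} [TopologicalSpace Y] [ChartedSpace (Coord m × Coord k) Y] (ρ : Y → X) where
  pt : Y
  lin : TangentSpace (mdl m) (ρ pt) →L[ℝ] TangentSpace (mdlTot m k) pt
  isSection : ∀ ξ, mfderiv (mdlTot m k) (mdl m) ρ pt (lin ξ) = ξ

/-- Lagrangian densities `J¹Y → ⋀^m X`, `m = dim X`, over the identity of `X` (smoothness is
`LagrangianDensity.IsSmooth`). -/
abbrev LagrangianDensity (m k : ℕ) {X : Type*} [TopologicalSpace X] [ChartedSpace (Coord m) X]
    {Y : Type*} [TopologicalSpace Y] [ChartedSpace (Coord m × Coord k) Y] (ρ : Y → X) :=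
  ∀ γ : Jet m k ρ, TangentSpace (mdl m) (ρ γ.pt) [⋀^Fin m]→L[ℝ] ℝ

/-- The coordinate space of `J¹Y`, with points `(x^μ, y^a, y^a_μ)`; the multi-velocities `y^a_μ`
are the entries of the linear map. -/
abbrev JetCoord (m k : ℕ) : Type := Coord m × Coord k × (Coord m →L[ℝ] Coord k)

variable {ρ : Y → X}

/-- The linear map `T_{ρ y} X → T_y Y` of the jet with coordinates `j` (`y` the point with
coordinates `(j.1, j.2.1)`). -/
def AdaptedChart.jetLin (c : AdaptedChart m k ρ) (j : JetCoord m k) :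
    TangentSpace (mdl m) (ρ (c.tot.symm (j.1, j.2.1))) →L[ℝ]
      TangentSpace (mdlTot m k) (c.tot.symm (j.1, j.2.1)) :=
  ((mfderiv (mdlTot m k) (mdlTot m k) c.tot.symm (j.1, j.2.1) :
      (Coord m × Coord k) →L[ℝ] TangentSpace (mdlTot m k) (c.tot.symm (j.1, j.2.1))).comp
    ((ContinuousLinearMap.id ℝ (Coord m)).prod j.2.2)).comp
    (mfderiv (mdl m) (mdl m) c.base (ρ (c.tot.symm (j.1, j.2.1))) :
      TangentSpace (mdl m) (ρ (c.tot.symm (j.1, j.2.1))) →L[ℝ] Coord m)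

open Classical in
/-- The Lagrangian function `L(x^μ, y^a, y^a_μ)` in adapted coordinates, defined by
`𝓛 = L dx⁰ ∧ ⋯ ∧ dxⁿ`. (The condition in the `if` holds at all points of the coordinate domain.) -/
def AdaptedChart.lagrangian (c : AdaptedChart m k ρ) (𝓛 : LagrangianDensity m k ρ)
    (j : JetCoord m k) : ℝ :=
  if h : ∀ ξ, mfderiv (mdlTot m k) (mdl m) ρ (c.tot.symm (j.1, j.2.1)) (c.jetLin j ξ) = ξ then
    𝓛 ⟨c.tot.symm (j.1, j.2.1), c.jetLin j, h⟩
      (fun μ => (mfderiv (mdl m) (mdl m) c.base.symm j.1 : Coord m →L[ℝ] Coord m) (Pi.single μ 1))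
  else 0

/-- The density is smooth: its Lagrangian functions in adapted coordinates are. -/
def LagrangianDensity.IsSmooth (𝓛 : LagrangianDensity m k ρ) : Prop :=
  ∀ c : AdaptedChart m k ρ,
    ContDiffOn ℝ ∞ (c.lagrangian 𝓛) {j | (j.1, j.2.1) ∈ c.tot.target}

/-! ### The Poincaré–Cartan form and the multisymplectic form -/

/-- The standard volume form on `ℝᵖ`. -/
def stdVol (p : ℕ) : Coord p [⋀^Fin p]→L[ℝ] ℝ :=
  { (Matrix.detRowAlternating : Coord p [⋀^Fin p]→ₗ[ℝ] ℝ) with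
    cont := by
      change Continuous fun v : Fin p → Coord p => Matrix.det (fun i j => v i j)
      exact Continuous.matrix_det continuous_id }

/-- The exterior product `ℓ₀ ∧ ⋯ ∧ ℓ_{p-1}` of linear forms. -/
def wedge {E : Type*} [NormedAddCommGroup E] [NormedSpace ℝ E] {p : ℕ} (l : Fin p → (E →L[ℝ] ℝ)) :
    E [⋀^Fin p]→L[ℝ] ℝ :=
  (stdVol p).compContinuousLinearMap (ContinuousLinearMap.pi l)

/-- `dx^μ` on the coordinate space of `J¹Y`. -/
def dx (m k : ℕ) (μ : Fin m) : JetCoord m k →L[ℝ] ℝ :=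
  (ContinuousLinearMap.proj μ).comp (ContinuousLinearMap.fst ℝ _ _)

/-- `dy^a` on the coordinate space of `J¹Y`. -/
def dy (m k : ℕ) (a : Fin k) : JetCoord m k →L[ℝ] ℝ :=
  (ContinuousLinearMap.proj a).comp
    ((ContinuousLinearMap.fst ℝ _ _).comp (ContinuousLinearMap.snd ℝ _ _))

/-- The coordinate vector `∂/∂y^a`. -/
def ddy (m k : ℕ) (a : Fin k) : JetCoord m k := (0, Pi.single a 1, 0)

/-- The coordinate vector `∂/∂y^a_μ`. -/
def ddv (m k : ℕ) (a : Fin k) (μ : Fin m) : JetCoord m k :=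
  (0, 0, (ContinuousLinearMap.proj (R := ℝ) (φ := fun _ : Fin m => ℝ) μ).smulRight
    (Pi.single a 1 : Coord k))

/-- The momentum `p_a^μ = ∂L/∂y^a_μ` in adapted coordinates. -/
def AdaptedChart.momentum (c : AdaptedChart m k ρ) (𝓛 : LagrangianDensity m k ρ) (a : Fin k)
    (μ : Fin m) (j : JetCoord m k) : ℝ :=
  fderiv ℝ (c.lagrangian 𝓛) j (ddv m k a μ)

/-- The Poincaré–Cartan form in adapted coordinates,
`Θ_L = (L - ∂L/∂y^a_μ y^a_μ) d^{n+1}x + ∂L/∂y^a_μ dy^a ∧ dⁿx_μ`. Here `dy^a ∧ dⁿx_μ` is written as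
`dx⁰ ∧ ⋯ ∧ dxⁿ` with the factor `dx^μ` replaced by `dy^a`. -/
def AdaptedChart.poincareCartan (c : AdaptedChart m k ρ) (𝓛 : LagrangianDensity m k ρ)
    (j : JetCoord m k) : JetCoord m k [⋀^Fin m]→L[ℝ] ℝ :=
  (c.lagrangian 𝓛 j - ∑ a, ∑ μ, c.momentum 𝓛 a μ j * j.2.2 (Pi.single μ 1) a) • wedge (dx m k) +
    ∑ a, ∑ μ, c.momentum 𝓛 a μ j • wedge (Function.update (dx m k) μ (dy m k a))

/-- The multisymplectic form `Ω_L = -dΘ_L` in adapted coordinates. -/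
def AdaptedChart.multisymplectic (c : AdaptedChart m k ρ) (𝓛 : LagrangianDensity m k ρ)
    (j : JetCoord m k) : JetCoord m k [⋀^Fin (m + 1)]→L[ℝ] ℝ :=
  -extDeriv (c.poincareCartan 𝓛) j

/-! ### Fields on the closure of `U`, solutions, first variations -/

/-- `φ` is a field on `U`, smooth up to the boundary: a smooth section of `ρ` over the closure of `U`
(its values elsewhere are irrelevant). -/
def IsField (U : Set X) (ρ : Y → X) (φ : X → Y) : Prop :=
  ContMDiffOn (mdl m) (mdlTot m k) ∞ φ (closure U) ∧ ∀ x ∈ closure U, ρ (φ x) = x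

/-- The part of the closure of `U` in the coordinate domain of the base. -/
def AdaptedChart.dom (c : AdaptedChart m k ρ) (U : Set X) : Set (Coord m) :=
  c.base.target ∩ c.base.symm ⁻¹' closure U

/-- The components `φ^a(x)` of a field. -/
def AdaptedChart.field (c : AdaptedChart m k ρ) (φ : X → Y) (u : Coord m) : Coord k :=
  (c.tot (φ (c.base.symm u))).2

/-- The prolongation `j¹φ` in coordinates, `x ↦ (x^μ, φ^a, ∂φ^a/∂x^μ)` (one-sided derivatives at
boundary points of `U`). -/
def AdaptedChart.jet (c : AdaptedChart m k ρ) (U : Set X) (φ : X → Y) (u : Coord m) :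
    JetCoord m k :=
  (u, c.field φ u, fderivWithin ℝ (c.field φ) (c.dom U) u)

/-- `φ` is a solution on `U` of the Euler–Lagrange equations
`d/dx^μ (∂L/∂y^a_μ (j¹φ)) - ∂L/∂y^a (j¹φ) = 0`, smooth up to the boundary. -/
def IsSolution (𝓛 : LagrangianDensity m k ρ) (U : Set X) (φ : X → Y) : Prop :=
  IsField (m := m) (k := k) U ρ φ ∧
  ∀ c : AdaptedChart m k ρ, ∀ x ∈ U, φ x ∈ c.tot.source → ∀ a : Fin k,
    ∑ μ, fderivWithin ℝ (fun u => c.momentum 𝓛 a μ (c.jet U φ u)) (c.dom U) (c.base x)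
        (Pi.single μ 1) -
      fderiv ℝ (c.lagrangian 𝓛) (c.jet U φ (c.base x)) (ddy m k a) = 0

/-- Vector fields along `φ` with values in `TY`. -/
abbrev FieldVariation (m k : ℕ) {X : Type*} {Y : Type*} [TopologicalSpace Y]
    [ChartedSpace (Coord m × Coord k) Y] (φ : X → Y) :=
  ∀ x : X, TangentSpace (mdlTot m k) (φ x)

/-- The velocity `dφ_ε/dε |_{ε = 0}` of a curve of fields, a vector field along `φ_0`. -/
def velocity (m k : ℕ) {X : Type*} {Y : Type*} [TopologicalSpace Y]
    [ChartedSpace (Coord m × Coord k) Y] (Φ : ℝ → X → Y) :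
    FieldVariation m k (Φ 0) :=
  fun x => (mfderiv 𝓘(ℝ, ℝ) (mdlTot m k) (fun ε => Φ ε x) 0 :
    ℝ →L[ℝ] TangentSpace (mdlTot m k) (Φ 0 x)) 1

/-- A curve `φ_ε`, `|ε| < δ`, of solutions on `U`, smooth in all variables up to the boundary. -/
def IsSolutionCurve (𝓛 : LagrangianDensity m k ρ) (U : Set X) (δ : ℝ) (Φ : ℝ → X → Y) : Prop :=
  0 < δ ∧
  ContMDiffOn (𝓘(ℝ, ℝ).prod (mdl m)) (mdlTot m k) ∞ (fun q : ℝ × X => Φ q.1 q.2)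
    (Ioo (-δ) δ ×ˢ closure U) ∧
  ∀ ε ∈ Ioo (-δ) δ, IsSolution 𝓛 U (Φ ε)

/-- A two-parameter family `φ_{s,t}`, `|s|, |t| < δ`, of solutions on `U`, smooth in all variables up
to the boundary. -/
def IsSolutionSurface (𝓛 : LagrangianDensity m k ρ) (U : Set X) (δ : ℝ) (Ψ : ℝ → ℝ → X → Y) :
    Prop :=
  0 < δ ∧
  ContMDiffOn ((𝓘(ℝ, ℝ).prod 𝓘(ℝ, ℝ)).prod (mdl m)) (mdlTot m k) ∞
    (fun q : (ℝ × ℝ) × X => Ψ q.1.1 q.1.2 q.2) ((Ioo (-δ) δ ×ˢ Ioo (-δ) δ) ×ˢ closure U) ∧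
  ∀ s ∈ Ioo (-δ) δ, ∀ t ∈ Ioo (-δ) δ, IsSolution 𝓛 U (Ψ s t)

/-- `V` is a first variation of the solution `φ`: it is the velocity at `φ` of a smooth curve of
solutions. -/
def IsFirstVariation (𝓛 : LagrangianDensity m k ρ) (U : Set X) (φ : X → Y)
    (V : FieldVariation m k φ) : Prop :=
  ∃ (δ : ℝ) (Φ : ℝ → X → Y), IsSolutionCurve 𝓛 U δ Φ ∧
    ∀ x ∈ closure U, Φ 0 x = φ x ∧ V x = velocity m k Φ x

/-- The components `V^a(x)` of a variation of `φ`. -/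
def AdaptedChart.variation (c : AdaptedChart m k ρ) (φ : X → Y) (V : FieldVariation m k φ)
    (u : Coord m) : Coord k :=
  ((mfderiv (mdlTot m k) (mdlTot m k) c.tot (φ (c.base.symm u)) :
    TangentSpace (mdlTot m k) (φ (c.base.symm u)) →L[ℝ] Coord m × Coord k) (V (c.base.symm u))).2

/-- The prolongation `j¹V` along `j¹φ` of a vertical variation `V` of `φ`, in coordinates:
`V^a ∂/∂y^a + ∂V^a/∂x^μ ∂/∂y^a_μ`. -/
def AdaptedChart.prolong (c : AdaptedChart m k ρ) (U : Set X) (φ : X → Y)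
    (V : FieldVariation m k φ) (u : Coord m) : JetCoord m k :=
  (0, c.variation φ V u, fderivWithin ℝ (c.variation φ V) (c.dom U) u)

/-- The derivative of `j¹φ` in coordinates. -/
def AdaptedChart.dJet (c : AdaptedChart m k ρ) (U : Set X) (φ : X → Y) (u : Coord m) :
    Coord m →L[ℝ] JetCoord m k :=
  fderivWithin ℝ (c.jet U φ) (c.dom U) u

/-- A form on `X` given in adapted coordinates along `φ`. At `x` any adapted chart around `φ x` may be
used: the forms below do not depend on it. -/
def formAlong {p : ℕ} (φ : X → Y)
    (loc : AdaptedChart m k ρ → Coord m → Coord m [⋀^Fin p]→L[ℝ] ℝ) : DForm m X p :=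
  open Classical in fun x =>
    if h : ∃ c : AdaptedChart m k ρ, φ x ∈ c.tot.source then
      (loc h.choose (h.choose.base x)).compContinuousLinearMap
        (mfderiv (mdl m) (mdl m) h.choose.base x : TangentSpace (mdl m) x →L[ℝ] Coord m)
    else 0

/-- `(j¹φ)^* Θ_L`. -/
def pullbackTheta (𝓛 : LagrangianDensity m k ρ) (U : Set X) (φ : X → Y) : DForm m X m :=
  formAlong φ fun c u =>
    (c.poincareCartan 𝓛 (c.jet U φ u)).compContinuousLinearMap (c.dJet U φ u)

open Classical in
/-- The form `𝓛(j¹φ) = L(j¹φ) d^{n+1}x` on `X` (the condition in the `if` holds on the closure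
of `U`). -/
def lagrangianForm (𝓛 : LagrangianDensity m k ρ) (U : Set X) (φ : X → Y) : DForm m X m := fun x =>
  let A : TangentSpace (mdl m) (ρ (φ x)) →L[ℝ] TangentSpace (mdlTot m k) (φ x) :=
    mfderivWithin (mdl m) (mdlTot m k) φ (closure U) x
  if h : ∀ ξ, mfderiv (mdlTot m k) (mdl m) ρ (φ x) (A ξ) = ξ then 𝓛 ⟨φ x, A, h⟩ else 0

/-! ### The boundary Lagrangian -/

/-- `c` is the value of the boundary Lagrangian at the boundary data `ϕ`: there are solutions on `U`
with boundary data `ϕ`, and the action `∫_U L(j¹φ) d^{n+1}x` of each of them is `c`. -/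
def IsBoundaryLagrangian (𝒪 : OrientedAtlas m X) (𝓛 : LagrangianDensity m k ρ) (U : Set X)
    (ϕ : frontier U → Y) (c : ℝ) : Prop :=
  (∃ φ, IsSolution 𝓛 U φ ∧ (frontier U).domRestrict φ = ϕ) ∧
  ∀ φ, IsSolution 𝓛 U φ → (frontier U).domRestrict φ = ϕ →
    HasTopIntegral 𝒪 U (lagrangianForm 𝓛 U φ) c

/-- The boundary data at which the boundary Lagrangian is defined. These comprise the boundary data
with exactly one solution. -/
def InDomain (𝒪 : OrientedAtlas m X) (𝓛 : LagrangianDensity m k ρ) (U : Set X)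
    (ϕ : frontier U → Y) : Prop :=
  ∃ c, IsBoundaryLagrangian 𝒪 𝓛 U ϕ c

open Classical in
/-- The boundary Lagrangian `L_{∂U}`, a functional on the space of boundary data (`0` outside its
domain). -/
def boundaryLagrangian (𝒪 : OrientedAtlas m X) (𝓛 : LagrangianDensity m k ρ) (U : Set X)
    (ϕ : frontier U → Y) : ℝ :=
  if h : InDomain 𝒪 𝓛 U ϕ then h.choose else 0

end Bundles

/-! ### The boundary forms -/

section BoundaryForms

variable {n k : ℕ}
  {X : Type*} [TopologicalSpace X] [ChartedSpace (Coord (n + 1)) X]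
  {Y : Type*} [TopologicalSpace Y] [ChartedSpace (Coord (n + 1) × Coord k) Y] {ρ : Y → X}

/-- `(j¹φ)^* (i_{j¹V} Θ_L)`. -/
def thetaForm (𝓛 : LagrangianDensity (n + 1) k ρ) (U : Set X) (φ : X → Y)
    (V : FieldVariation (n + 1) k φ) : DForm (n + 1) X n :=
  formAlong φ fun c u =>
    ((c.poincareCartan 𝓛 (c.jet U φ u)).curryLeft (c.prolong U φ V u)).compContinuousLinearMap
      (c.dJet U φ u)

/-- `(j¹φ)^* (i_{j¹W} i_{j¹V} Ω_L)`. -/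
def omegaForm (𝓛 : LagrangianDensity (n + 1) k ρ) (U : Set X) (φ : X → Y)
    (V W : FieldVariation (n + 1) k φ) : DForm (n + 1) X n :=
  formAlong φ fun c u =>
    (((c.multisymplectic 𝓛 (c.jet U φ u)).curryLeft (c.prolong U φ V u)).curryLeft
      (c.prolong U φ W u)).compContinuousLinearMap (c.dJet U φ u)

end BoundaryForms

end FieldTheory

end

open Set Topology MeasureTheory Manifold
open scoped ContDiff

noncomputable section

namespace FieldTheory

/-! ### Calculus in coordinate spaces -/

/-! In adapted coordinates the theorem is a computation of divergences. A vertical vector contracted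
with `Θ_L` leaves only the momentum terms, so `(j¹φ)^*(i_{j¹V} Θ_L)` is the flux of the vector field
with components `∂L/∂y^a_μ V^a` (`thetaFlux`). Likewise `(j¹φ)^*(i_{j¹W} i_{j¹V} Ω_L)` is the flux
of `D²L(j¹W, V^a ∂/∂y^a_μ) - D²L(j¹V, W^a ∂/∂y^a_μ)` (`omegaFlux`); see `poincareCartan_cons` and
`multisymplectic_cons_cons`.

One Leibniz computation, `sum_fderivWithin_flux`, serves both: if a covector field `Λ` along `j¹φ`
satisfies equations of Euler–Lagrange type, the flux `Λ(∂/∂y^a_μ) V^a` has divergence `Λ(j¹V)`. For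
`Λ = dL` this is the derivative of `L(j¹φ_ε)` in `ε`, which is the first variation formula. For `Λ =
D²L(j¹W, ·)` the required equations are the Euler–Lagrange equations linearised along a curve of
solutions (`sum_fderivWithin_prolong`). The divergence of `omegaFlux` is then `D²L(j¹W, j¹V) -
D²L(j¹V, j¹W)`, which vanishes because second derivatives are symmetric. So the multisymplectic
current is closed, and Stokes' theorem gives the form formula.

The remaining claims follow. Along a holonomic section the contact part of `Θ_L` pulls back to zero,
so `(j¹φ)^*Θ_L` is the Lagrangian density. In the second derivative formula both sides are zero: the
left side antisymmetrises the mixed derivatives of a smooth function of `(s, t)`, and the right side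
vanishes by the form formula. Equality of the Crnković–Witten forms is the form formula with the
boundary charts sorted by the component they meet; on `S₋` the orientation is reversed.

Three matters turn the computation into statements on `X`. First, the forms must not depend on the
adapted chart. The Lagrangian is the coefficient of a density, so `lagrangian_jetTrans` and its
first two derivatives show that the fluxes transform as vector densities, and `fluxForm_comp` turns
this into equality of forms. Second, integrals must not depend on charts and partitions; for a form
supported in one chart this is the change of variables formula (`hasSum_of_supported`), and
`IsPrimitive.stokes` reduces to that case by cutoffs and the divergence theorem on a half space.
Third, all derivatives are one-sided at the boundary. They are determined by
`uniqueDiffOn_preimage_closure`, and they commute because every point of the coordinate domain is a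
limit of interior points (`subset_closure_interior_preimage`). -/

theorem integrableOn_of_continuousOn_of_compact {E : Type*} [NormedAddCommGroup E]
    [MeasurableSpace E] [BorelSpace E] {μ : Measure E} [IsFiniteMeasureOnCompacts μ]
    {h : E → ℝ} {D R K : Set E} (hR : MeasurableSet R) (hK : IsCompact K)
    (hKD : K ⊆ D) (hh : ContinuousOn h D) (h0 : ∀ u ∈ R, u ∉ K → h u = 0) :
    IntegrableOn h R μ := by
  have h1 : IntegrableOn h K μ := (hh.mono hKD).integrableOn_compact hK
  have h2 : IntegrableOn h (R ∩ K) μ := h1.mono_set inter_subset_right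
  refine h2.of_forall_sdiff_eq_zero hR ?_
  intro u hu
  exact h0 u hu.1 fun h => hu.2 ⟨hu.1, h⟩

/-- The region `R` may be unbounded, and nothing is known near its edge outside `D`. Domination
comes from `K` alone: `F'` is bounded on the product of a closed interval with `K` and vanishes on
the rest of `R`. -/
theorem hasDerivAt_setIntegral_of_continuousOn {E : Type*} [NormedAddCommGroup E]
    [MeasurableSpace E] [BorelSpace E] {μ : Measure E} [IsFiniteMeasureOnCompacts μ]
    {F F' : ℝ → E → ℝ} {D R K : Set E} {P : Set ℝ} {t₀ : ℝ} (hP : P ∈ 𝓝 t₀)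
    (hR : MeasurableSet R) (hK : IsCompact K) (hKD : K ⊆ D)
    (hF : ContinuousOn (fun q : ℝ × E => F q.1 q.2) (P ×ˢ D))
    (hF' : ContinuousOn (fun q : ℝ × E => F' q.1 q.2) (P ×ˢ D))
    (hd : ∀ t ∈ P, ∀ u ∈ R, HasDerivAt (fun t => F t u) (F' t u) t)
    (h0 : ∀ t ∈ P, ∀ u ∈ R, u ∉ K → F t u = 0) (h0' : ∀ t ∈ P, ∀ u ∈ R, u ∉ K → F' t u = 0) :
    HasDerivAt (fun t => ∫ u in R, F t u ∂μ) (∫ u in R, F' t₀ u ∂μ) t₀ := by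
  obtain ⟨r, hr, hrP⟩ := Metric.nhds_basis_closedBall.mem_iff.1 hP
  have hcF : ∀ t ∈ P, ContinuousOn (F t) D := fun t ht =>
    hF.comp (f := fun u => (t, u)) (by fun_prop) fun u hu => ⟨ht, hu⟩
  have hcF' : ∀ t ∈ P, ContinuousOn (F' t) D := fun t ht =>
    hF'.comp (f := fun u => (t, u)) (by fun_prop) fun u hu => ⟨ht, hu⟩
  have hI : ∀ t ∈ P, IntegrableOn (F t) R μ := fun t ht =>
    integrableOn_of_continuousOn_of_compact hR hK hKD (hcF t ht) (h0 t ht)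
  have hI' : ∀ t ∈ P, IntegrableOn (F' t) R μ := fun t ht =>
    integrableOn_of_continuousOn_of_compact hR hK hKD (hcF' t ht) (h0' t ht)
  have ht₀ : t₀ ∈ P := mem_of_mem_nhds hP
  obtain ⟨C, hC⟩ := ((isCompact_closedBall t₀ r).prod hK).exists_bound_of_continuousOn
    (hF'.mono (prod_mono hrP hKD))
  refine (hasDerivAt_integral_of_dominated_loc_of_deriv_le (F := F) (F' := F')
    (bound := K.indicator fun _ => C) (Metric.closedBall_mem_nhds t₀ hr)
    (Filter.eventually_of_mem hP fun t ht => (hI t ht).aestronglyMeasurable) (hI t₀ ht₀)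
    (hI' t₀ ht₀).aestronglyMeasurable ?_ ?_ ?_).2
  · refine (ae_restrict_mem hR).mono fun u hu t ht => ?_
    by_cases huK : u ∈ K
    · rw [indicator_of_mem huK]
      exact hC (t, u) ⟨ht, huK⟩
    · rw [indicator_of_notMem huK, h0' t (hrP ht) u hu huK, norm_zero]
  · refine Integrable.integrableOn ?_
    exact (integrable_indicator_iff hK.measurableSet).2
      (integrableOn_const hK.measure_lt_top.ne)
  · exact (ae_restrict_mem hR).mono fun u hu t ht => hd t (hrP ht) u hu

/-- A large cube contains the support `C`. Its intersection with the half space is a box with one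
face on `x⁰ = 0`; on the other faces the field is zero, so the divergence theorem leaves a single
term, and `s` is the sign of the outward normal. Differentiability is needed only in the open half
space. -/
theorem integral_div_halfSpace {n : ℕ} {s : ℝ} (hs : s = 1 ∨ s = -1)
    {Z : Fin (n + 1) → Coord (n + 1) → ℝ}
    {Z' : Fin (n + 1) → Coord (n + 1) → Coord (n + 1) →L[ℝ] ℝ} {g : Coord (n + 1) → ℝ}
    {C : Set (Coord (n + 1))} (hC : IsCompact C)
    (hZ0 : ∀ i u, u ∉ C → Z i u = 0)
    (hcont : ∀ i, ContinuousOn (Z i) {u | s * u 0 ≤ 0})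
    (hd : ∀ u, s * u 0 < 0 → ∀ i, HasFDerivAt (Z i) (Z' i u) u)
    (hg : IntegrableOn g {u | s * u 0 < 0})
    (hgZ : ∀ u, s * u 0 < 0 → g u = ∑ i, Z' i u (Pi.single i 1))
    (hg0 : ∀ u, u ∉ C → g u = 0) :
    ∫ u in {u | s * u 0 < 0}, g u = s * ∫ y : Coord n, Z 0 (Fin.cons 0 y) := by
  obtain ⟨R, hR0, hR⟩ := hC.isBounded.exists_pos_norm_lt
  have hbd : ∀ u, (∃ i, R ≤ |u i|) → u ∉ C := by
    rintro u ⟨i, hi⟩ hu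
    exact absurd ((norm_le_pi_norm u i).trans_lt (hR u hu)) (not_lt.2 hi)
  -- The coordinate `x⁰` runs over `[-R, 0]` for `s = 1` and over `[0, R]` for `s = -1`; all others
  -- run over `[-R, R]`.
  set a : Coord (n + 1) := fun i => if i = 0 ∧ s = -1 then 0 else -R with ha
  set b : Coord (n + 1) := fun i => if i = 0 ∧ s = 1 then 0 else R with hb
  have hs1 : (1 : ℝ) ≠ -1 := by norm_num
  have ha' : ∀ i : Fin n, a i.succ = -R := fun i => by simp [ha, Fin.succ_ne_zero]
  have hb' : ∀ i : Fin n, b i.succ = R := fun i => by simp [hb, Fin.succ_ne_zero]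
  have hle : a ≤ b := by
    intro i
    refine Fin.cases ?_ (fun j => ?_) i
    · rcases hs with rfl | rfl <;> simp [ha, hb, hs1, hs1.symm, hR0.le]
    · rw [ha', hb']; linarith
  have hhalf : ∀ u ∈ Icc a b, s * u 0 ≤ 0 := by
    intro u hu
    have h1 := hu.1 0
    have h2 := hu.2 0
    rcases hs with rfl | rfl <;> simp [ha, hb, hs1, hs1.symm] at h1 h2 ⊢ <;> linarith
  have hopen : ∀ u ∈ pi univ fun i => Ioo (a i) (b i), s * u 0 < 0 := by
    intro u hu
    have h1 := (hu 0 (mem_univ _)).1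
    have h2 := (hu 0 (mem_univ _)).2
    rcases hs with rfl | rfl <;> simp [ha, hb, hs1, hs1.symm] at h1 h2 ⊢ <;> linarith
  have hC' : ∀ u, s * u 0 < 0 → u ∉ (pi univ fun i => Ioo (a i) (b i)) → u ∉ C := by
    intro u hu hnot huC
    refine hnot fun i _ => ?_
    have hi : |u i| < R := by
      by_contra hcon
      exact hbd u ⟨i, not_lt.1 hcon⟩ huC
    rw [abs_lt] at hi
    revert hi
    refine Fin.cases ?_ (fun j => ?_) i
    · intro hi
      rcases hs with rfl | rfl <;> simp [ha, hb, hs1, hs1.symm] at hu ⊢ <;>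
        constructor <;> linarith [hi.1, hi.2]
    · intro hi
      change u j.succ ∈ Ioo (a j.succ) (b j.succ)
      rw [ha', hb']
      exact hi
  have hmeasH : MeasurableSet {u : Coord (n + 1) | s * u 0 < 0} :=
    (isOpen_lt (by fun_prop) continuous_const).measurableSet
  have hae : (pi univ fun i => Ioo (a i) (b i)) =ᵐ[volume] Icc a b := Measure.univ_pi_Ioo_ae_eq_Icc
  have hmeasI : MeasurableSet (pi univ fun i => Ioo (a i) (b i)) :=
    MeasurableSet.univ_pi fun i => measurableSet_Ioo
  have hgI : IntegrableOn g (pi univ fun i => Ioo (a i) (b i)) := hg.mono_set hopen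
  have hdivI : IntegrableOn (fun u => ∑ i, Z' i u (Pi.single i 1)) (Icc a b) :=
    ((integrableOn_congr_fun (fun u hu => hgZ u (hopen u hu)) hmeasI).1 hgI).congr_set_ae hae.symm
  have key := integral_divergence_of_hasFDerivAt_off_countable' a b hle Z Z' ∅ countable_empty
    (fun i => (hcont i).mono hhalf) (fun u hu i => hd u (hopen u hu.1) i) hdivI
  have e1 : ∫ u in {u | s * u 0 < 0}, g u = ∫ u in Icc a b, ∑ i, Z' i u (Pi.single i 1) := by
    rw [← setIntegral_congr_set hae, setIntegral_congr_fun hmeasI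
      (fun u hu => (hgZ u (hopen u hu)).symm)]
    exact (setIntegral_eq_of_subset_of_forall_sdiff_eq_zero hmeasH hopen
      fun u hu => hg0 u (hC' u hu.1 hu.2))
  rw [e1, key, Fin.sum_univ_succ]
  -- A face `x^i = ±R` with `i ≠ 0` lies outside `C`.
  have hrest : ∀ i : Fin n,
      ((∫ x in Icc (a ∘ i.succ.succAbove) (b ∘ i.succ.succAbove),
        Z i.succ (i.succ.insertNth (b i.succ) x)) -
      ∫ x in Icc (a ∘ i.succ.succAbove) (b ∘ i.succ.succAbove),
        Z i.succ (i.succ.insertNth (a i.succ) x)) = 0 := by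
    intro i
    have h1 : ∀ x, Z i.succ (i.succ.insertNth (b i.succ) x) = 0 := fun x =>
      hZ0 _ _ (hbd _ ⟨i.succ, by simp [hb', abs_of_pos hR0]⟩)
    have h2 : ∀ x, Z i.succ (i.succ.insertNth (a i.succ) x) = 0 := fun x =>
      hZ0 _ _ (hbd _ ⟨i.succ, by simp [ha', abs_of_pos hR0]⟩)
    simp [h1, h2]
  have hface : ∫ x in Icc (a ∘ (0 : Fin (n + 1)).succAbove) (b ∘ (0 : Fin (n + 1)).succAbove),
      Z 0 (Fin.cons 0 x) = ∫ y : Coord n, Z 0 (Fin.cons 0 y) := by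
    refine setIntegral_eq_integral_of_forall_compl_eq_zero fun x hx => hZ0 _ _ (hbd _ ?_)
    by_contra hcon
    push Not at hcon
    refine hx ⟨fun j => ?_, fun j => ?_⟩
    · have := (abs_lt.1 (hcon j.succ)).1
      simp [ha'] at this ⊢
      linarith
    · have := (abs_lt.1 (hcon j.succ)).2
      simp [hb'] at this ⊢
      linarith
  rw [Finset.sum_congr rfl fun i _ => hrest i, Finset.sum_const_zero, add_zero]
  rcases hs with rfl | rfl
  · have h1 : a 0 = -R := by simp [ha, hs1]
    have h2 : b 0 = 0 := by simp [hb]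
    have h3 : ∀ x : Coord n, Z 0 ((0 : Fin (n + 1)).insertNth (a 0) x) = 0 := fun x =>
      hZ0 _ _ (hbd _ ⟨0, by simp [h1, abs_of_pos hR0]⟩)
    simp only [h3, h2, integral_zero, sub_zero, one_mul]
    rw [← hface]
    simp
  · have h1 : b 0 = R := by simp [hb, hs1.symm]
    have h2 : a 0 = 0 := by simp [ha]
    have h3 : ∀ x : Coord n, Z 0 ((0 : Fin (n + 1)).insertNth (b 0) x) = 0 := fun x =>
      hZ0 _ _ (hbd _ ⟨0, by simp [h1, abs_of_pos hR0]⟩)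
    simp only [h3, h2, integral_zero, zero_sub]
    rw [← hface]
    simp

/-- The two half spaces `±x⁰ < 0` have opposite boundary terms, and the hyperplane between them is a
null set. -/
theorem integral_div_eq_zero {n : ℕ} {Z : Fin (n + 1) → Coord (n + 1) → ℝ}
    {Z' : Fin (n + 1) → Coord (n + 1) → Coord (n + 1) →L[ℝ] ℝ} {g : Coord (n + 1) → ℝ}
    {C : Set (Coord (n + 1))} (hC : IsCompact C) (hZ0 : ∀ i u, u ∉ C → Z i u = 0)
    (hd : ∀ u i, HasFDerivAt (Z i) (Z' i u) u) (hg : Integrable g)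
    (hgZ : ∀ u, g u = ∑ i, Z' i u (Pi.single i 1)) (hg0 : ∀ u, u ∉ C → g u = 0) :
    ∫ u, g u = 0 := by
  have hc : ∀ i, Continuous (Z i) := fun i =>
    continuous_iff_continuousAt.2 fun u => (hd u i).continuousAt
  have h1 := integral_div_halfSpace (s := 1) (Or.inl rfl) hC hZ0 (fun i => (hc i).continuousOn)
    (fun u _ i => hd u i) hg.integrableOn (fun u _ => hgZ u) hg0
  have h2 := integral_div_halfSpace (s := -1) (Or.inr rfl) hC hZ0 (fun i => (hc i).continuousOn)
    (fun u _ i => hd u i) hg.integrableOn (fun u _ => hgZ u) hg0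
  simp only [one_mul, neg_mul, Left.neg_neg_iff] at h1 h2
  have hm : MeasurableSet {u : Coord (n + 1) | u 0 < 0} :=
    (isOpen_lt (by fun_prop) continuous_const).measurableSet
  have hae : {u : Coord (n + 1) | 0 < u 0} =ᵐ[volume] {u : Coord (n + 1) | u 0 < 0}ᶜ := by
    have h0 : volume {u : Coord (n + 1) | u 0 = 0} = 0 := by
      rw [volume_pi]
      exact Measure.pi_hyperplane _ 0 0
    refine Filter.EventuallyEq.symm ?_
    filter_upwards [compl_mem_ae_iff.2 h0] with u hu
    have hu' : u 0 ≠ 0 := hu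
    exact propext ⟨fun h => lt_of_le_of_ne (not_lt.1 h) hu'.symm, fun h => not_lt.2 (le_of_lt h)⟩
  have h3 : ∫ u in {u : Coord (n + 1) | 0 < u 0}, g u = ∫ u in {u : Coord (n + 1) | u 0 < 0}ᶜ, g u :=
    setIntegral_congr_set hae
  have h4 : (∫ u in {u : Coord (n + 1) | u 0 < 0}, g u) + ∫ u in {u : Coord (n + 1) | u 0 < 0}ᶜ, g u
      = ∫ u, g u := by
    refine integral_add_compl ?_ hg
    exact hm
  rw [← h4, h1, ← h3, h2, add_neg_cancel]

/-! ### Partial derivatives of families over an open parameter set, up to the boundary -/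

section Slices

variable {G E F : Type*} [NormedAddCommGroup G] [NormedSpace ℝ G] [NormedAddCommGroup E]
  [NormedSpace ℝ E] [NormedAddCommGroup F] [NormedSpace ℝ F]
  {P : Set G} {D : Set E} {f : G × E → F} {q : G} {x : E}

theorem hasFDerivAt_slice_left (hP : IsOpen P) (hq : q ∈ P) (hx : x ∈ D)
    (hf : DifferentiableWithinAt ℝ f (P ×ˢ D) (q, x)) :
    HasFDerivAt (fun p => f (p, x))
      ((fderivWithin ℝ f (P ×ˢ D) (q, x)).comp (ContinuousLinearMap.inl ℝ G E)) q := by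
  have h1 : HasFDerivWithinAt (fun p : G => (p, x)) (ContinuousLinearMap.inl ℝ G E) P q :=
    (hasFDerivAt_prodMk_left q x).hasFDerivWithinAt
  have h3 : MapsTo (fun p : G => (p, x)) P (P ×ˢ D) := fun p hp => mk_mem_prod hp hx
  have h2 := HasFDerivWithinAt.comp q hf.hasFDerivWithinAt h1 h3
  exact h2.hasFDerivAt (hP.mem_nhds hq)

theorem hasFDerivWithinAt_slice_right (hq : q ∈ P)
    (hf : DifferentiableWithinAt ℝ f (P ×ˢ D) (q, x)) :
    HasFDerivWithinAt (fun u => f (q, u))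
      ((fderivWithin ℝ f (P ×ˢ D) (q, x)).comp (ContinuousLinearMap.inr ℝ G E)) D x := by
  have h1 : HasFDerivWithinAt (fun u : E => (q, u)) (ContinuousLinearMap.inr ℝ G E) D x :=
    (hasFDerivAt_prodMk_right q x).hasFDerivWithinAt
  have h2 : MapsTo (fun u : E => (q, u)) D (P ×ˢ D) := fun u hu => mk_mem_prod hq hu
  exact HasFDerivWithinAt.comp x hf.hasFDerivWithinAt h1 h2

theorem ContDiffWithinAt.fderivWithin_self {s : Set E} {f : E → F} {x : E}
    (hf : ContDiffWithinAt ℝ ∞ f s x) (hs : UniqueDiffOn ℝ s) (hx : x ∈ s) :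
    ContDiffWithinAt ℝ ∞ (_root_.fderivWithin ℝ f s) s x :=
  hf.fderivWithin_right hs (by simp) hx

theorem eventually_differentiableWithinAt {s : Set E} {f : E → F} {x : E}
    (hf : ContDiffWithinAt ℝ ∞ f s x) :
    ∀ᶠ y in 𝓝[s] x, DifferentiableWithinAt ℝ f s y := by
  have h1 : ContDiffWithinAt ℝ 1 f s x := hf.of_le (by simp)
  have h2 := h1.eventually (by simp)
  exact (h2.filter_mono (nhdsWithin_mono x (subset_insert x s))).mono fun y hy =>
    hy.differentiableWithinAt (by simp)

/-- The derivatives in the parameter and in the variable commute. -/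
theorem hasFDerivAt_fderivWithin_slice (hP : IsOpen P) (hD : UniqueDiffOn ℝ D) (hq : q ∈ P)
    (hx : x ∈ D) (hxi : x ∈ closure (interior D))
    (hf : ContDiffWithinAt ℝ ∞ f (P ×ˢ D) (q, x)) (v : G) :
    HasDerivAt (fun τ : ℝ => fderivWithin ℝ (fun u => f (q + τ • v, u)) D x)
      (fderivWithin ℝ (fun u => fderivWithin ℝ f (P ×ˢ D) (q, u) (v, 0)) D x) 0 := by
  set S := P ×ˢ D
  have hS : UniqueDiffOn ℝ S := hP.uniqueDiffOn.prod hD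
  have hqx : (q, x) ∈ S := ⟨hq, hx⟩
  have hg : ContDiffWithinAt ℝ ∞ (fderivWithin ℝ f S) S (q, x) :=
    ContDiffWithinAt.fderivWithin_self hf hS hqx
  have hgd : DifferentiableWithinAt ℝ (fderivWithin ℝ f S) S (q, x) :=
    hg.differentiableWithinAt (by simp)
  set B := fderivWithin ℝ (fderivWithin ℝ f S) S (q, x)
  -- Second derivatives within `S` are symmetric at limits of interior points of `S`; this is the
  -- only use of `hxi`.
  have hsymm : ∀ a b, B a b = B b a := by
    have hint : (q, x) ∈ closure (interior S) := by
      rw [interior_prod_eq, closure_prod_eq, hP.interior_eq]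
      exact ⟨subset_closure hq, hxi⟩
    have := hf.isSymmSndFDerivWithinAt (n := ∞) (by
      simp only [minSmoothness_of_isRCLikeNormedField]
      exact ENat.LEInfty.out) hS hint hqx
    exact this
  have hline : HasDerivAt (fun τ : ℝ => q + τ • v) v 0 := by
    have := ((hasDerivAt_id (0 : ℝ)).smul_const v).const_add q
    simpa using this
  have hl0 : q + (0 : ℝ) • v = q := by simp
  -- the left side
  have h1 : ∀ᶠ τ in 𝓝 (0 : ℝ), fderivWithin ℝ (fun u => f (q + τ • v, u)) D x =
      (fderivWithin ℝ f S (q + τ • v, x)).comp (ContinuousLinearMap.inr ℝ G E) := by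
    have hev := eventually_differentiableWithinAt hf
    have ht : Filter.Tendsto (fun τ : ℝ => (q + τ • v, x)) (𝓝 0) (𝓝[S] (q, x)) := by
      refine tendsto_nhdsWithin_iff.2 ⟨?_, ?_⟩
      · have : ContinuousAt (fun τ : ℝ => (q + τ • v, x)) 0 := by fun_prop
        simpa [ContinuousAt] using this
      · have : ContinuousAt (fun τ : ℝ => q + τ • v) 0 := by fun_prop
        filter_upwards [this.preimage_mem_nhds (hP.mem_nhds (by simpa using hq))] with τ hτ
        exact ⟨hτ, hx⟩
    filter_upwards [ht.eventually hev, ht.eventually self_mem_nhdsWithin] with τ hτ hτS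
    exact (hasFDerivWithinAt_slice_right hτS.1 hτ).fderivWithin (hD x hx)
  have h2 : HasDerivAt (fun τ : ℝ => fderivWithin ℝ f S (q + τ • v, x)) (B (v, 0)) 0 := by
    have h3 := hasFDerivAt_slice_left hP hq hx hgd
    have h4 := HasFDerivAt.comp_hasDerivAt_of_eq (0 : ℝ) h3 hline hl0.symm
    exact h4
  have h5 : HasDerivAt (fun τ : ℝ =>
      (fderivWithin ℝ f S (q + τ • v, x)).comp (ContinuousLinearMap.inr ℝ G E))
      ((B (v, 0)).comp (ContinuousLinearMap.inr ℝ G E)) 0 := by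
    have := ((ContinuousLinearMap.compL ℝ E (G × E) F).flip
      (ContinuousLinearMap.inr ℝ G E)).hasFDerivAt.comp_hasDerivAt (0 : ℝ) h2
    exact this
  -- The right side is the same second derivative `B` with its arguments exchanged.
  have h6 : fderivWithin ℝ (fun u => fderivWithin ℝ f S (q, u) (v, 0)) D x =
      (B (v, 0)).comp (ContinuousLinearMap.inr ℝ G E) := by
    have h7 := hasFDerivWithinAt_slice_right hq hgd
    have h8 := (h7.clm_apply (hasFDerivWithinAt_const ((v, 0) : G × E) x D)).fderivWithin (hD x hx)
    rw [h8]
    ext w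
    simpa using hsymm (0, w) (v, 0)
  rw [h6]
  exact h5.congr_of_eventuallyEq h1

end Slices

/-! ### Alternating forms of top degree -/

section Alternating

variable {m n : ℕ}

/-- The standard basis of the coordinate space. -/
def stdFrame (m : ℕ) : Fin m → Coord m := fun μ => Pi.single μ 1

theorem stdVol_apply (v : Fin m → Coord m) : stdVol m v = Matrix.det (Matrix.of v) := rfl

theorem stdVol_stdFrame : stdVol m (stdFrame m) = 1 := by
  rw [stdVol_apply]
  have : Matrix.of (stdFrame m) = 1 := by
    ext i j
    simp [stdFrame, Matrix.one_apply, Pi.single_apply, eq_comm]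
  rw [this, Matrix.det_one]

/-- Alternating maps are compared on injective families of basis vectors. In top degree these are
the permutations of the frame, and both sides change by the same sign. -/
theorem alternating_eq_smul_stdVol (f : Coord m [⋀^Fin m]→L[ℝ] ℝ) :
    f = f (stdFrame m) • stdVol m := by
  have h : f.toAlternatingMap = (f (stdFrame m) • stdVol m).toAlternatingMap := by
    refine Module.Basis.ext_alternating (Pi.basisFun ℝ (Fin m)) fun v hv => ?_
    obtain ⟨σ, rfl⟩ : ∃ σ : Equiv.Perm (Fin m), v = σ :=
      ⟨Equiv.ofBijective v (Finite.injective_iff_bijective.1 hv), rfl⟩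
    have e : (fun i => (Pi.basisFun ℝ (Fin m)) (σ i)) = stdFrame m ∘ σ := by
      ext i j
      simp [stdFrame]
    rw [e, AlternatingMap.map_perm, AlternatingMap.map_perm]
    congr 1
    change f (stdFrame m) = f (stdFrame m) * stdVol m (stdFrame m)
    rw [stdVol_stdFrame, mul_one]
  ext v
  exact congrArg (fun g : Coord m [⋀^Fin m]→ₗ[ℝ] ℝ => g v) h

theorem alternating_apply (f : Coord m [⋀^Fin m]→L[ℝ] ℝ) (v : Fin m → Coord m) :
    f v = f (stdFrame m) * stdVol m v := by
  conv_lhs => rw [alternating_eq_smul_stdVol f]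
  rfl

theorem stdVol_comp_stdFrame (A : Coord m →L[ℝ] Coord m) :
    stdVol m (fun i => A (stdFrame m i)) = A.det := by
  rw [stdVol_apply, ContinuousLinearMap.det, ← LinearMap.det_toMatrix', ← Matrix.det_transpose]
  congr 1

theorem alternating_comp_stdFrame (f : Coord m [⋀^Fin m]→L[ℝ] ℝ) (A : Coord m →L[ℝ] Coord m) :
    f (fun i => A (stdFrame m i)) = A.det * f (stdFrame m) := by
  rw [alternating_apply, stdVol_comp_stdFrame, mul_comm]

theorem alternating_comp (f : Coord m [⋀^Fin m]→L[ℝ] ℝ) (A : Coord m →L[ℝ] Coord m)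
    (v : Fin m → Coord m) : f (fun i => A (v i)) = A.det * f v := by
  have h := alternating_apply (f.compContinuousLinearMap A) v
  have h2 : f.compContinuousLinearMap A (stdFrame m) = A.det * f (stdFrame m) :=
    alternating_comp_stdFrame f A
  rw [h2, mul_assoc, ← alternating_apply] at h
  exact h

/-- The frame `∂_0, …, ∂_n` without its `μ`-th member. -/
def omitFrame (μ : Fin (n + 1)) : Fin n → Coord (n + 1) := fun j => stdFrame (n + 1) (μ.succAbove j)

/-- In the expansion along the row `Z`, every minor other than the one at `μ` retains the column
`μ`, which is zero because no vector of the omitted frame has a component along `μ`. -/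
theorem stdVol_cons_omitFrame (Z : Coord (n + 1)) (μ : Fin (n + 1)) :
    stdVol (n + 1) (Fin.cons Z (omitFrame μ)) = (-1) ^ (μ : ℕ) * Z μ := by
  rw [stdVol_apply, Matrix.det_succ_row_zero, Finset.sum_eq_single μ]
  · have : (Matrix.of (Fin.cons Z (omitFrame μ) : Fin (n + 1) → Coord (n + 1))).submatrix Fin.succ
        μ.succAbove = 1 := by
      ext i j
      simp [omitFrame, stdFrame, Matrix.one_apply, Pi.single_apply, eq_comm]
    rw [this, Matrix.det_one, mul_one]
    rfl
  · intro j _ hj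
    obtain ⟨c, hc⟩ := Fin.exists_succAbove_eq hj.symm
    rw [Matrix.det_eq_zero_of_column_eq_zero c, mul_zero]
    intro i
    simp [omitFrame, stdFrame, hc, (Fin.succAbove_ne μ i).symm]
  · simp

/-- The contraction of the vector `Z` with the standard volume form. -/
def fluxForm (Z : Coord (n + 1)) : Coord (n + 1) [⋀^Fin n]→L[ℝ] ℝ := (stdVol (n + 1)).curryLeft Z

theorem fluxForm_omitFrame (Z : Coord (n + 1)) (μ : Fin (n + 1)) :
    fluxForm Z (omitFrame μ) = (-1) ^ (μ : ℕ) * Z μ := stdVol_cons_omitFrame Z μ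

/-- The hypothesis `h` is the transformation law of a vector density: the factor by which `A`
changes the volume form cancels the one in `h`. Chart independence of the boundary forms thereby
becomes a law for their fluxes. -/
theorem fluxForm_comp (A : Coord (n + 1) →L[ℝ] Coord (n + 1)) (Z Z' : Coord (n + 1))
    (hA : A.det ≠ 0) (h : A.det • Z' = A Z) :
    (fluxForm Z').compContinuousLinearMap A = fluxForm Z := by
  ext v
  have h1 := alternating_comp (stdVol (n + 1)) A (Fin.cons Z v)
  have h2 : (fun i => A ((Fin.cons Z v : Fin (n + 1) → Coord (n + 1)) i)) =
      Fin.cons (A Z) fun i => A (v i) := by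
    ext i : 1
    refine Fin.cases ?_ (fun j => ?_) i <;> rfl
  rw [h2, ← h] at h1
  have h3 : stdVol (n + 1) (Fin.cons (A.det • Z') fun i => A (v i)) =
      A.det * stdVol (n + 1) (Fin.cons Z' fun i => A (v i)) :=
    MultilinearMap.cons_smul (stdVol (n + 1)).toMultilinearMap (fun i => A (v i)) A.det Z'
  rw [h3] at h1
  exact mul_left_cancel₀ hA h1

/-- An endomorphism of `ℝⁿ⁺¹` that preserves the hyperplane `x⁰ = 0`. -/
theorem det_eq_mul_det_of_preserves (A : Coord (n + 1) →L[ℝ] Coord (n + 1))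
    (B : Coord n →L[ℝ] Coord n) (h0 : ∀ w : Coord n, A (Fin.cons 0 w) 0 = 0)
    (hB : ∀ (w : Coord n) j, A (Fin.cons 0 w) (Fin.succ j) = B w j) :
    A.det = A (stdFrame (n + 1) 0) 0 * B.det := by
  rw [← stdVol_comp_stdFrame A, ← stdVol_comp_stdFrame B, stdVol_apply, stdVol_apply,
    Matrix.det_succ_column_zero, Finset.sum_eq_single 0]
  · have hs : ∀ j : Fin n, stdFrame (n + 1) j.succ = Fin.cons 0 (stdFrame n j) := by
      intro j
      ext i
      refine Fin.cases ?_ (fun i => ?_) i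
      · simp [stdFrame, (Fin.succ_ne_zero j).symm]
      · simp [stdFrame, Pi.single_apply]
    have : (Matrix.of fun i => A (stdFrame (n + 1) i)).submatrix (Fin.succAbove 0) Fin.succ =
        Matrix.of fun i => B (stdFrame n i) := by
      ext i j
      simp only [Matrix.submatrix_apply, Matrix.of_apply, Fin.zero_succAbove]
      rw [hs, hB]
    rw [this]
    simp
  · intro i _ hi
    obtain ⟨j, rfl⟩ := Fin.exists_succ_eq.2 hi
    have hs : stdFrame (n + 1) j.succ = Fin.cons 0 (stdFrame n j) := by
      ext i
      refine Fin.cases ?_ (fun i => ?_) i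
      · simp [stdFrame, (Fin.succ_ne_zero j).symm]
      · simp [stdFrame, Pi.single_apply]
    simp only [Matrix.of_apply]
    rw [hs, h0]
    simp
  · simp

end Alternating

/-! ### Charts and the change of charts -/

theorem eventually_mem_overlap {m : ℕ} {X : Type*} [TopologicalSpace X]
    {e e' : OpenPartialHomeomorph X (Coord m)} {u : Coord m} (hu : u ∈ e.target) (hu' : e.symm u ∈ e'.source) :
    ∀ᶠ v in 𝓝 u, v ∈ e.target ∧ e.symm v ∈ e'.source :=
  Filter.Eventually.and (e.open_target.mem_nhds hu)
    ((e.continuousAt_symm hu).preimage_mem_nhds (e'.open_source.mem_nhds hu'))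

section Charts

variable {m : ℕ} {X : Type*} [TopologicalSpace X] [ChartedSpace (Coord m) X]
  {e e' : OpenPartialHomeomorph X (Coord m)} {u : Coord m} {x : X}

/-- The derivative of a coordinate change. -/
def transD (e e' : OpenPartialHomeomorph X (Coord m)) (u : Coord m) : Coord m →L[ℝ] Coord m :=
  fderiv ℝ (e' ∘ e.symm) u

theorem det_clm_comp (A B : Coord m →L[ℝ] Coord m) : (A.comp B).det = A.det * B.det :=
  LinearMap.det_comp (A : Coord m →ₗ[ℝ] Coord m) (B : Coord m →ₗ[ℝ] Coord m)

theorem contMDiffAt_chart (he : e ∈ IsManifold.maximalAtlas (mdl m) ∞ X) (hx : x ∈ e.source) :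
    ContMDiffAt (mdl m) (mdl m) ∞ e x :=
  contMDiffAt_of_mem_maximalAtlas he hx

theorem contMDiffAt_chart_symm (he : e ∈ IsManifold.maximalAtlas (mdl m) ∞ X)
    (hu : u ∈ e.target) : ContMDiffAt (mdl m) (mdl m) ∞ e.symm u :=
  contMDiffAt_symm_of_mem_maximalAtlas he hu

theorem contDiffAt_transition (he : e ∈ IsManifold.maximalAtlas (mdl m) ∞ X)
    (he' : e' ∈ IsManifold.maximalAtlas (mdl m) ∞ X) (hu : u ∈ e.target)
    (hu' : e.symm u ∈ e'.source) : ContDiffAt ℝ ∞ (e' ∘ e.symm) u :=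
  ((contMDiffAt_chart he' hu').comp u (contMDiffAt_chart_symm he hu)).contDiffAt

theorem hasFDerivAt_transition (he : e ∈ IsManifold.maximalAtlas (mdl m) ∞ X)
    (he' : e' ∈ IsManifold.maximalAtlas (mdl m) ∞ X) (hu : u ∈ e.target)
    (hu' : e.symm u ∈ e'.source) : HasFDerivAt (e' ∘ e.symm) (transD e e' u) u :=
  ((contDiffAt_transition he he' hu hu').differentiableAt (by simp)).hasFDerivAt

/-- Cocycle rule for three charts. -/
theorem transD_comp {e'' : OpenPartialHomeomorph X (Coord m)}
    (he : e ∈ IsManifold.maximalAtlas (mdl m) ∞ X)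
    (he' : e' ∈ IsManifold.maximalAtlas (mdl m) ∞ X)
    (he'' : e'' ∈ IsManifold.maximalAtlas (mdl m) ∞ X) (hu : u ∈ e.target)
    (hu' : e.symm u ∈ e'.source) (hu'' : e.symm u ∈ e''.source) :
    transD e e'' u = (transD e' e'' (e' (e.symm u))).comp (transD e e' u) := by
  have h1 := hasFDerivAt_transition he he' hu hu'
  have h2 : HasFDerivAt (e'' ∘ e'.symm) (transD e' e'' (e' (e.symm u))) (e' (e.symm u)) :=
    hasFDerivAt_transition he' he'' (e'.map_source hu') (by rwa [e'.left_inv hu'])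
  refine HasFDerivAt.unique (hasFDerivAt_transition he he'' hu hu'')
    ((h2.comp u h1).congr_of_eventuallyEq ?_)
  filter_upwards [eventually_mem_overlap hu hu'] with v hv
  simp [e'.left_inv hv.2]

theorem transD_self (he : e ∈ IsManifold.maximalAtlas (mdl m) ∞ X) (hu : u ∈ e.target) :
    transD e e u = ContinuousLinearMap.id ℝ (Coord m) := by
  refine HasFDerivAt.unique (hasFDerivAt_transition he he hu (e.map_target hu))
    ((hasFDerivAt_id u).congr_of_eventuallyEq ?_)
  filter_upwards [e.open_target.mem_nhds hu] with v hv
  simp [e.right_inv hv]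

theorem transD_comp_inverse (he : e ∈ IsManifold.maximalAtlas (mdl m) ∞ X)
    (he' : e' ∈ IsManifold.maximalAtlas (mdl m) ∞ X) (hu : u ∈ e.target)
    (hu' : e.symm u ∈ e'.source) :
    (transD e' e (e' (e.symm u))).comp (transD e e' u) = ContinuousLinearMap.id ℝ (Coord m) := by
  rw [← transD_comp he he' he hu hu' (e.map_target hu), transD_self he hu]

/-- The derivative of the inverse of a chart, as an endomorphism of the coordinate space. -/
def symmD (e : OpenPartialHomeomorph X (Coord m)) (u : Coord m) : Coord m →L[ℝ] Coord m :=
  mfderiv (mdl m) (mdl m) e.symm u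

/-- The derivative of a chart, as an endomorphism of the coordinate space. -/
def chartD (e : OpenPartialHomeomorph X (Coord m)) (x : X) : Coord m →L[ℝ] Coord m :=
  mfderiv (mdl m) (mdl m) e x

theorem symmD_eq_comp (he : e ∈ IsManifold.maximalAtlas (mdl m) ∞ X)
    (he' : e' ∈ IsManifold.maximalAtlas (mdl m) ∞ X) (hu : u ∈ e.target)
    (hu' : e.symm u ∈ e'.source) :
    symmD e u = (symmD e' (e' (e.symm u))).comp (transD e e' u) := by
  have h1 : MDifferentiableAt (mdl m) (mdl m) e'.symm ((e' ∘ e.symm) u) :=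
    (contMDiffAt_chart_symm he' (e'.map_source hu')).mdifferentiableAt (by simp)
  have h2 : MDifferentiableAt (mdl m) (mdl m) (e' ∘ e.symm) u :=
    (contDiffAt_transition he he' hu hu').contMDiffAt.mdifferentiableAt (by simp)
  have h3 := mfderiv_comp u h1 h2
  rw [mfderiv_eq_fderiv] at h3
  have h4 : mfderiv (mdl m) (mdl m) e.symm u =
      mfderiv (mdl m) (mdl m) (e'.symm ∘ (e' ∘ e.symm)) u := by
    refine Filter.EventuallyEq.mfderiv_eq ?_
    filter_upwards [eventually_mem_overlap hu hu'] with v hv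
    simp [e'.left_inv hv.2]
  exact h4.trans h3

theorem transD_eq_comp (he : e ∈ IsManifold.maximalAtlas (mdl m) ∞ X)
    (he' : e' ∈ IsManifold.maximalAtlas (mdl m) ∞ X) (hu : u ∈ e.target)
    (hu' : e.symm u ∈ e'.source) : transD e e' u = (chartD e' (e.symm u)).comp (symmD e u) := by
  have h1 : MDifferentiableAt (mdl m) (mdl m) e' (e.symm u) :=
    (contMDiffAt_chart he' hu').mdifferentiableAt (by simp)
  have h2 : MDifferentiableAt (mdl m) (mdl m) e.symm u :=
    (contMDiffAt_chart_symm he hu).mdifferentiableAt (by simp)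
  have h3 := mfderiv_comp u h1 h2
  rw [mfderiv_eq_fderiv] at h3
  exact h3

theorem chartD_comp_symmD (he : e ∈ IsManifold.maximalAtlas (mdl m) ∞ X) (hu : u ∈ e.target) :
    (chartD e (e.symm u)).comp (symmD e u) = ContinuousLinearMap.id ℝ (Coord m) := by
  rw [← transD_eq_comp he he hu (e.map_target hu), transD_self he hu]

/-- For endomorphisms of a finite-dimensional space a one-sided inverse is two-sided. -/
theorem symmD_comp_chartD (he : e ∈ IsManifold.maximalAtlas (mdl m) ∞ X) (hx : x ∈ e.source) :
    (symmD e (e x)).comp (chartD e x) = ContinuousLinearMap.id ℝ (Coord m) := by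
  have h1 := chartD_comp_symmD he (e.map_source hx)
  rw [e.left_inv hx] at h1
  have h2 : (chartD e x : Coord m →ₗ[ℝ] Coord m) ∘ₗ (symmD e (e x) : Coord m →ₗ[ℝ] Coord m) =
      LinearMap.id :=
    LinearMap.ext fun v => congrArg (fun A : Coord m →L[ℝ] Coord m => A v) h1
  have h3 := (LinearMap.comp_eq_id_comm ℝ (Coord m)).1 h2
  exact ContinuousLinearMap.ext fun v => congrArg (fun A : Coord m →ₗ[ℝ] Coord m => A v) h3

theorem chartD_eq_comp (he : e ∈ IsManifold.maximalAtlas (mdl m) ∞ X)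
    (he' : e' ∈ IsManifold.maximalAtlas (mdl m) ∞ X) (hx : x ∈ e.source) (hx' : x ∈ e'.source) :
    chartD e' x = (transD e e' (e x)).comp (chartD e x) := by
  rw [transD_eq_comp he he' (e.map_source hx) (by rwa [e.left_inv hx]), e.left_inv hx,
    ContinuousLinearMap.comp_assoc, symmD_comp_chartD he hx, ContinuousLinearMap.comp_id]

theorem DForm.inChart_eq {p : ℕ} (α : DForm m X p) (e : OpenPartialHomeomorph X (Coord m))
    (u : Coord m) : α.inChart e u =
      (α (e.symm u) : Coord m [⋀^Fin p]→L[ℝ] ℝ).compContinuousLinearMap (symmD e u) := rfl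

theorem DForm.inChart_change {p : ℕ} (α : DForm m X p)
    (he : e ∈ IsManifold.maximalAtlas (mdl m) ∞ X)
    (he' : e' ∈ IsManifold.maximalAtlas (mdl m) ∞ X) (hu : u ∈ e.target)
    (hu' : e.symm u ∈ e'.source) :
    α.inChart e u = (α.inChart e' (e' (e.symm u))).compContinuousLinearMap (transD e e' u) := by
  rw [DForm.inChart_eq, DForm.inChart_eq, symmD_eq_comp he he' hu hu', e'.left_inv hu']
  rfl

/-- A top form in a chart, as a multiple of the standard volume form. -/
theorem DForm.inChart_change_top (η : DForm m X m)
    (he : e ∈ IsManifold.maximalAtlas (mdl m) ∞ X)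
    (he' : e' ∈ IsManifold.maximalAtlas (mdl m) ∞ X) (hu : u ∈ e.target)
    (hu' : e.symm u ∈ e'.source) :
    η.inChart e u (stdFrame m) =
      (transD e e' u).det * η.inChart e' (e' (e.symm u)) (stdFrame m) := by
  rw [η.inChart_change he he' hu hu']
  exact alternating_comp_stdFrame (η.inChart e' (e' (e.symm u))) (transD e e' u)

theorem det_transD_ne_zero (he : e ∈ IsManifold.maximalAtlas (mdl m) ∞ X)
    (he' : e' ∈ IsManifold.maximalAtlas (mdl m) ∞ X) (hu : u ∈ e.target)
    (hu' : e.symm u ∈ e'.source) : (transD e e' u).det ≠ 0 := by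
  have h := congrArg ContinuousLinearMap.det (transD_comp_inverse he he' hu hu')
  rw [det_clm_comp] at h
  intro h0
  rw [h0, mul_zero] at h
  simp [ContinuousLinearMap.det] at h

variable {𝒪 : OrientedAtlas m X}

theorem OrientedAtlas.isPositive_of_mem (he : e ∈ 𝒪.charts) : 𝒪.IsPositive e :=
  ⟨𝒪.smooth e he, fun e' he' x hx => 𝒪.det_pos e' he' e he x hx⟩

/-- Positivity compares a chart with members of the atlas only. A third chart `e₀` of the atlas and
the cocycle rule compare `e` with `e'`. -/
theorem OrientedAtlas.IsPositive.det_transD_pos (he : 𝒪.IsPositive e) (he' : 𝒪.IsPositive e')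
    (hu : u ∈ e.target) (hu' : e.symm u ∈ e'.source) : 0 < (transD e e' u).det := by
  obtain ⟨e₀, he₀, hx⟩ := 𝒪.cover (e.symm u)
  have h1 := he.2 e₀ he₀ (e.symm u) ⟨hx, e.map_target hu⟩
  have h2 := he'.2 e₀ he₀ (e.symm u) ⟨hx, hu'⟩
  have hv := e₀.map_source hx
  have h3 := transD_comp (u := e₀ (e.symm u)) (𝒪.smooth e₀ he₀) he.1 he'.1 hv
    (by rw [e₀.left_inv hx]; exact e.map_target hu) (by rwa [e₀.left_inv hx])
  rw [e₀.left_inv hx, e.right_inv hu] at h3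
  have h4 := congrArg ContinuousLinearMap.det h3
  rw [det_clm_comp] at h4
  change 0 < (transD e₀ e (e₀ (e.symm u))).det at h1
  change 0 < (transD e₀ e' (e₀ (e.symm u))).det at h2
  rw [h4] at h2
  exact (pos_iff_pos_of_mul_pos h2).2 h1

theorem OrientedAtlas.IsPositive.restr (he : 𝒪.IsPositive e) {s : Set X} (hs : IsOpen s) :
    𝒪.IsPositive (e.restr s) := by
  refine ⟨restr_mem_maximalAtlas _ he.1 hs, fun e' he' x hx => ?_⟩
  exact he.2 e' he' x ⟨hx.1, (e.restr_source s ▸ hx.2 : x ∈ e.source ∩ interior s).1⟩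

end Charts

/-! ### Integrals computed from charts and partitions of unity -/

/-- By local finiteness only finitely many weights meet the compact set `K` that carries `h`. The
sum over the partition is therefore finite and may be exchanged with the integral. Both kinds of
integrals below use this. -/
theorem finsum_integral_partition {ι X E : Type*} [TopologicalSpace X] [NormedAddCommGroup E]
    [MeasurableSpace E] [BorelSpace E] [SecondCountableTopology E] {ν : Measure E} {w : ι → X → ℝ}
    (hw0 : ∀ i x, 0 ≤ w i x) (hw1 : ∀ i x, w i x ≤ 1)
    (hlf : LocallyFinite fun i => Function.support (w i)) {K : Set X} (hK : IsCompact K)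
    {D : Set E} (hD : MeasurableSet D) {g : E → X} {h : E → ℝ} (hh : IntegrableOn h D ν)
    (h0 : ∀ u ∈ D, g u ∉ K → h u = 0) (h1 : ∀ u ∈ D, ∑ᶠ i, w i (g u) = 1)
    (hc : ∀ i, ContinuousOn (fun u => w i (g u)) D) :
    (∀ i, IntegrableOn (fun u => w i (g u) * h u) D ν) ∧
    (Function.support fun i => ∫ u in D, w i (g u) * h u ∂ν).Finite ∧
    ∑ᶠ i, ∫ u in D, w i (g u) * h u ∂ν = ∫ u in D, h u ∂ν := by
  have hint : ∀ i, IntegrableOn (fun u => w i (g u) * h u) D ν := fun i =>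
    Integrable.bdd_mul (c := 1) hh ((hc i).aestronglyMeasurable hD)
      (Filter.Eventually.of_forall fun u => by
        rw [Real.norm_eq_abs, abs_of_nonneg (hw0 _ _)]; exact hw1 _ _)
  have hfin := hlf.finite_nonempty_inter_compact hK
  have hsub : (Function.support fun i => ∫ u in D, w i (g u) * h u ∂ν) ⊆
      {i | (Function.support (w i) ∩ K).Nonempty} := by
    intro i hi
    by_contra hcon
    refine hi (setIntegral_eq_zero_of_forall_eq_zero fun u hu => ?_)
    by_cases hu' : g u ∈ K
    · have : w i (g u) = 0 := by
        by_contra hne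
        exact hcon ⟨g u, hne, hu'⟩
      rw [this, zero_mul]
    · rw [h0 u hu hu', mul_zero]
  refine ⟨hint, hfin.subset hsub, ?_⟩
  rw [finsum_eq_sum_of_support_subset (s := hfin.toFinset) _ (by simpa using hsub),
    ← integral_finsetSum _ fun i _ => hint i]
  refine setIntegral_congr_fun hD fun u hu => ?_
  by_cases hu' : g u ∈ K
  · have h2 := h1 u hu
    rw [finsum_eq_sum_of_support_subset (s := hfin.toFinset)] at h2
    · simp only [← Finset.sum_mul, h2, one_mul]
    · intro i hi
      simpa using ⟨g u, hi, hu'⟩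
  · simp [h0 u hu hu']

/-! ### Integrals of forms of top degree -/

section Top

variable {m : ℕ} {X : Type*} [TopologicalSpace X] [ChartedSpace (Coord m) X]
  {𝒪 : OrientedAtlas m X} {U : Set X}

/-- The integral of `η` over `U`, computed with `A`, exists and is `c`. -/
def TopPartition.HasSum (A : TopPartition 𝒪) (U : Set X) (η : DForm m X m) (c : ℝ) : Prop :=
  (∀ p, IntegrableOn (A.piece η p) (A.region U p)) ∧
    (Function.support fun p => ∫ u in A.region U p, A.piece η p u).Finite ∧
    ∑ᶠ p, ∫ u in A.region U p, A.piece η p u = c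

theorem TopPartition.isOpen_region (A : TopPartition 𝒪) (hU : IsOpen U) (p : X) :
    IsOpen (A.region U p) :=
  (A.chart p).isOpen_inter_preimage_symm hU

theorem TopPartition.HasSum.congr {A : TopPartition 𝒪} (hU : IsOpen U) {η η' : DForm m X m} {c : ℝ}
    (h : A.HasSum U η c) (hη : ∀ x ∈ U, η x = η' x) : A.HasSum U η' c := by
  have h1 : ∀ p, EqOn (A.piece η p) (A.piece η' p) (A.region U p) := by
    intro p u hu
    simp only [TopPartition.piece, DForm.inChart_eq, hη _ hu.2]
  have h2 : ∀ p, ∫ u in A.region U p, A.piece η p u = ∫ u in A.region U p, A.piece η' p u :=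
    fun p => setIntegral_congr_fun (A.isOpen_region hU p).measurableSet (h1 p)
  refine ⟨fun p => ((h.1 p).congr_fun (h1 p) (A.isOpen_region hU p).measurableSet), ?_, ?_⟩
  · simp only [← h2]; exact h.2.1
  · simp only [← h2]; exact h.2.2

theorem TopPartition.HasSum.zero (A : TopPartition 𝒪) : A.HasSum U 0 0 := by
  have h : ∀ p u, A.piece 0 p u = 0 := by
    intro p u
    simp only [TopPartition.piece, DForm.inChart_eq]
    exact mul_zero _
  refine ⟨fun p => ?_, ?_, ?_⟩
  · have : A.piece 0 p = fun _ => 0 := funext (h p)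
    rw [this]
    exact integrableOn_zero
  · simp [h]
  · simp [h]

theorem TopPartition.HasSum.add {A : TopPartition 𝒪} {η η' : DForm m X m} {c c' : ℝ}
    (h : A.HasSum U η c) (h' : A.HasSum U η' c') : A.HasSum U (η + η') (c + c') := by
  have h1 : ∀ p, A.piece (η + η') p = A.piece η p + A.piece η' p := by
    intro p
    ext u
    simp only [TopPartition.piece, DForm.inChart_eq, Pi.add_apply]
    exact mul_add _ _ _
  have h2 : (fun p => ∫ u in A.region U p, A.piece (η + η') p u) = fun p =>
      (∫ u in A.region U p, A.piece η p u) + ∫ u in A.region U p, A.piece η' p u := by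
    ext p
    rw [h1]
    exact integral_add (h.1 p) (h'.1 p)
  refine ⟨fun p => ?_, ?_, ?_⟩
  · rw [h1]
    exact (h.1 p).add (h'.1 p)
  · rw [h2]
    exact (h.2.1.union h'.2.1).subset (Function.support_add _ _)
  · rw [h2, finsum_add_distrib h.2.1 h'.2.1, h.2.2, h'.2.2]

theorem TopPartition.HasSum.sum {A : TopPartition 𝒪} {ι : Type*} (s : Finset ι)
    {η : ι → DForm m X m} {c : ι → ℝ} (h : ∀ i ∈ s, A.HasSum U (η i) (c i)) :
    A.HasSum U (∑ i ∈ s, η i) (∑ i ∈ s, c i) := by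
  classical
  induction s using Finset.induction_on with
  | empty => simpa using TopPartition.HasSum.zero A
  | insert i s hi ih =>
    rw [Finset.sum_insert hi, Finset.sum_insert hi]
    exact (h i (Finset.mem_insert_self i s)).add
      (ih fun j hj => h j (Finset.mem_insert_of_mem hj))

/-- The integral of a form with compact support in one chart is computed in this chart. -/
theorem TopPartition.hasSum_of_supported (A : TopPartition 𝒪) (hU : IsOpen U) {η : DForm m X m}
    {e : OpenPartialHomeomorph X (Coord m)} (he : 𝒪.IsPositive e) {K : Set X} (hK : IsCompact K)
    (hKe : K ⊆ e.source) (h0 : ∀ x ∈ U, x ∉ K → η x = 0)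
    (hint : IntegrableOn (fun u => η.inChart e u (stdFrame m)) (e.target ∩ e.symm ⁻¹' U)) :
    A.HasSum U η (∫ u in e.target ∩ e.symm ⁻¹' U, η.inChart e u (stdFrame m)) := by
  have hDo : IsOpen (e.target ∩ e.symm ⁻¹' U) := e.isOpen_inter_preimage_symm hU
  have hin0 : ∀ (e' : OpenPartialHomeomorph X (Coord m)) v, e'.symm v ∈ U → e'.symm v ∉ K →
      η.inChart e' v (stdFrame m) = 0 := by
    intro e' v hv hvK
    rw [DForm.inChart_eq, h0 _ hv hvK]
    rfl
  -- The partition of `A` is first applied inside the single chart `e`; each summand is then carried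
  -- to the corresponding chart of `A`.
  obtain ⟨s1, s2, s3⟩ := finsum_integral_partition (w := fun p x => A.weight p x)
    (fun p x => A.weight.nonneg p x) (fun p x => A.weight.le_one p x) A.weight.locallyFinite hK
    hDo.measurableSet hint (g := e.symm) (fun u hu hu' => hin0 e u hu.2 hu')
    (fun u _ => A.weight.sum_eq_one (mem_univ _))
    (fun p => (A.weight p).contMDiff.continuous.comp_continuousOn
      (e.continuousOn_symm.mono inter_subset_left))
  -- Change of variables on the overlap `W`. Outside the overlap both integrands vanish: in the
  -- chart of `A` because `η` lives on `K ⊆ e.source`, in `e` because the weight is subordinate to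
  -- the chart of `A`. The Jacobian needs no absolute value as both charts are positive.
  have key : ∀ p, IntegrableOn (A.piece η p) (A.region U p) ∧
      ∫ u in A.region U p, A.piece η p u =
        ∫ u in e.target ∩ e.symm ⁻¹' U, A.weight p (e.symm u) * η.inChart e u (stdFrame m) := by
    intro p
    set e' := A.chart p
    have he' : 𝒪.IsPositive e' := A.positive p
    set W := (e.target ∩ e.symm ⁻¹' U) ∩ (e.target ∩ e.symm ⁻¹' e'.source) with hW
    have hWo : IsOpen W := hDo.inter (e.isOpen_inter_preimage_symm e'.open_source)
    set τ : Coord m → Coord m := e' ∘ e.symm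
    have hτ : ∀ u ∈ W, HasFDerivWithinAt τ (transD e e' u) W u := fun u hu =>
      (hasFDerivAt_transition he.1 he'.1 hu.1.1 hu.2.2).hasFDerivWithinAt
    have hτi : InjOn τ W := by
      intro u hu v hv huv
      have h1 := e'.injOn hu.2.2 hv.2.2 huv
      exact e.symm.injOn hu.1.1 hv.1.1 h1
    have himg : ∀ v, v ∈ τ '' W ↔ v ∈ A.region U p ∧ e'.symm v ∈ e.source := by
      intro v
      constructor
      · rintro ⟨u, hu, rfl⟩
        have h1 : e'.symm (τ u) = e.symm u := e'.left_inv hu.2.2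
        refine ⟨⟨e'.map_source hu.2.2, ?_⟩, ?_⟩
        · change e'.symm (τ u) ∈ U
          rw [h1]
          exact hu.1.2
        · rw [h1]
          exact e.map_target hu.1.1
      · rintro ⟨⟨h1, h2⟩, h3⟩
        refine ⟨e (e'.symm v), ⟨⟨e.map_source h3, ?_⟩, e.map_source h3, ?_⟩, ?_⟩
        · change e.symm (e (e'.symm v)) ∈ U
          rwa [e.left_inv h3]
        · change e.symm (e (e'.symm v)) ∈ e'.source
          rw [e.left_inv h3]
          exact e'.map_target h1
        · change e' (e.symm (e (e'.symm v))) = v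
          rw [e.left_inv h3, e'.right_inv h1]
    have hsub : τ '' W ⊆ A.region U p := fun v hv => ((himg v).1 hv).1
    have hz : ∀ v ∈ A.region U p \ τ '' W, A.piece η p v = 0 := by
      rintro v ⟨hv, hv'⟩
      have h1 : e'.symm v ∉ K := fun h => hv' ((himg v).2 ⟨hv, hKe h⟩)
      exact mul_eq_zero_of_right _ (hin0 e' v hv.2 h1)
    have hpull : ∀ u ∈ W, |(transD e e' u).det| • A.piece η p (τ u) =
        A.weight p (e.symm u) * η.inChart e u (stdFrame m) := by
      intro u hu
      rw [abs_of_pos (he.det_transD_pos he' hu.1.1 hu.2.2), smul_eq_mul,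
        η.inChart_change_top he.1 he'.1 hu.1.1 hu.2.2]
      simp only [TopPartition.piece]
      change _ * (A.weight p (e'.symm (τ u)) * η.inChart e' (τ u) (stdFrame m)) = _
      have h1 : e'.symm (τ u) = e.symm u := e'.left_inv hu.2.2
      rw [h1]
      simp only [τ, Function.comp]
      ring
    have hzW : ∀ u ∈ (e.target ∩ e.symm ⁻¹' U) \ W,
        A.weight p (e.symm u) * η.inChart e u (stdFrame m) = 0 := by
      rintro u ⟨hu, hu'⟩
      refine mul_eq_zero_of_left ?_ _
      by_contra hne
      exact hu' ⟨hu, hu.1, A.subordinate p (subset_tsupport _ hne)⟩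
    have hmeas : MeasurableSet (τ '' W) := measurable_image_of_fderivWithin hWo.measurableSet hτ hτi
    constructor
    · refine IntegrableOn.of_forall_sdiff_eq_zero ?_ (A.isOpen_region hU p).measurableSet hz
      rw [integrableOn_image_iff_integrableOn_abs_det_fderiv_smul volume hWo.measurableSet hτ hτi]
      exact ((s1 p).mono_set inter_subset_left).congr_fun (fun u hu => (hpull u hu).symm)
        hWo.measurableSet
    · rw [setIntegral_eq_of_subset_of_forall_sdiff_eq_zero (A.isOpen_region hU p).measurableSet
          hsub hz,
        integral_image_eq_integral_abs_det_fderiv_smul volume hWo.measurableSet hτ hτi,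
        setIntegral_congr_fun hWo.measurableSet hpull,
        setIntegral_eq_of_subset_of_forall_sdiff_eq_zero hDo.measurableSet inter_subset_left hzW]
  refine ⟨fun p => (key p).1, ?_, ?_⟩
  · simp only [fun p => (key p).2]
    exact s2
  · simp only [fun p => (key p).2]
    exact s3

end Top

/-! ### Coordinates on the slice of an adapted chart -/

section SliceCoordinates

variable {n : ℕ} {X : Type*} [TopologicalSpace X]

/-- The slice `x⁰ = 0` of the target of a chart. -/
def sliceDom (e : OpenPartialHomeomorph X (Coord (n + 1))) : Set (Coord n) :=
  {y | (Fin.cons 0 y : Coord (n + 1)) ∈ e.target}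

/-- The inclusion of the slice `x⁰ = 0`. -/
def sliceIncl (n : ℕ) : Coord n →L[ℝ] Coord (n + 1) :=
  ContinuousLinearMap.pi (Fin.cons 0 fun j => ContinuousLinearMap.proj j)

theorem sliceIncl_apply (y : Coord n) : sliceIncl n y = Fin.cons 0 y := by
  ext i
  refine Fin.cases ?_ (fun j => ?_) i <;> simp [sliceIncl]

/-- The projection that forgets the coordinate `x⁰`. -/
def sliceProj (n : ℕ) : Coord (n + 1) →L[ℝ] Coord n :=
  ContinuousLinearMap.pi fun j => ContinuousLinearMap.proj j.succ

theorem sliceIncl_sliceProj {u : Coord (n + 1)} (hu : u 0 = 0) :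
    (Fin.cons 0 (sliceProj n u) : Coord (n + 1)) = u := by
  ext i
  refine Fin.cases ?_ (fun j => ?_) i
  · simp [hu]
  · simp [sliceProj]

theorem sliceProj_cons (a : ℝ) (y : Coord n) : sliceProj n (Fin.cons a y) = y := by
  ext j
  simp [sliceProj]

theorem isOpen_sliceDom (e : OpenPartialHomeomorph X (Coord (n + 1))) : IsOpen (sliceDom e) := by
  have : sliceDom e = sliceIncl n ⁻¹' e.target := by
    ext y
    simp [sliceDom, sliceIncl_apply]
  rw [this]
  exact e.open_target.preimage (sliceIncl n).continuous

end SliceCoordinates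

/-! ### Integrals over hypersurfaces -/

section Slice

variable {n : ℕ} {X : Type*} [TopologicalSpace X] [ChartedSpace (Coord (n + 1)) X]
  {𝒪 : OrientedAtlas (n + 1) X} {S B : Set X}

/-- The integral of `α` over the hypersurface `S`, computed with `A`, exists and is `c`. -/
def SlicePartition.HasSum (A : SlicePartition 𝒪 S B) (α : DForm (n + 1) X n) (c : ℝ) : Prop :=
  (∀ p, IntegrableOn (A.piece α p) (A.region p)) ∧
    (Function.support fun p => ∫ y in A.region p, A.piece α p y).Finite ∧
    ∑ᶠ p, ∫ y in A.region p, A.piece α p y = c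

theorem continuous_cons_zero : Continuous fun y : Coord n => (Fin.cons 0 y : Coord (n + 1)) := by
  have : (fun y : Coord n => (Fin.cons 0 y : Coord (n + 1))) = sliceIncl n :=
    funext fun y => (sliceIncl_apply y).symm
  rw [this]
  exact (sliceIncl n).continuous

theorem omitFrame_zero (j : Fin n) : omitFrame 0 j = sliceIncl n (stdFrame n j) := by
  ext i
  rw [sliceIncl_apply]
  refine Fin.cases ?_ (fun i => ?_) i
  · simp [omitFrame, stdFrame, (Fin.succ_ne_zero j).symm]
  · simp [omitFrame, stdFrame, Pi.single_apply]

theorem omitFrame_zero_eq : (fun j : Fin n => (Pi.single j.succ 1 : Coord (n + 1))) = omitFrame 0 := by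
  ext j : 1
  simp [omitFrame, stdFrame]

/-- The component of `α` along the slice `x⁰ = 0` of a chart. -/
def DForm.sliceComp (α : DForm (n + 1) X n) (e : OpenPartialHomeomorph X (Coord (n + 1)))
    (y : Coord n) : ℝ := α.inChart e (Fin.cons 0 y) (omitFrame 0)

theorem SlicePartition.piece_eq (A : SlicePartition 𝒪 S B) (α : DForm (n + 1) X n) (p : S)
    (y : Coord n) : A.piece α p y =
      A.sgn p * (A.weight p ((A.chart p).symm (Fin.cons 0 y)) * α.sliceComp (A.chart p) y) := by
  simp only [SlicePartition.piece, omitFrame_zero_eq]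
  rfl

theorem IsSliceChart.symm_mem {e : OpenPartialHomeomorph X (Coord (n + 1))} {s : ℝ}
    (he : IsSliceChart 𝒪 S B e s) {y : Coord n} (hy : y ∈ sliceDom e) :
    e.symm (Fin.cons 0 y) ∈ S := by
  have h := (he.2.2 _ (e.map_target hy)).1
  rw [e.right_inv hy] at h
  exact h.2 rfl

/-- The difference quotients from the left are nonnegative. This determines the sign of the
transverse derivative between two adapted charts, where only the image of the side `B` is known. -/
theorem hasDerivAt_nonneg_of_sign {f : ℝ → ℝ} {a : ℝ} (hf : HasDerivAt f a 0) (h0 : f 0 = 0)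
    (h : ∀ᶠ t in 𝓝 (0 : ℝ), t < 0 → f t ≤ 0) : 0 ≤ a := by
  have h1 := (hasDerivAt_iff_tendsto_slope.1 hf).mono_left
    (nhdsWithin_mono 0 (fun t (ht : t ∈ Iio 0) => ne_of_lt ht))
  refine ge_of_tendsto h1 ?_
  filter_upwards [nhdsWithin_le_nhds h, self_mem_nhdsWithin] with t ht ht0
  have ht0 : t < 0 := ht0
  rw [slope_def_field, h0, sub_zero, sub_zero]
  exact div_nonneg_of_nonpos (ht ht0) ht0.le

/-- The transition between two adapted charts: the derivative along the slice, its determinant and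
the orientation. -/
theorem IsSliceChart.transition {e e' : OpenPartialHomeomorph X (Coord (n + 1))} {s s' : ℝ}
    (he : IsSliceChart 𝒪 S B e s) (he' : IsSliceChart 𝒪 S B e' s') {y : Coord n}
    (hy : y ∈ sliceDom e) (hy' : e.symm (Fin.cons 0 y) ∈ e'.source) :
    ((sliceProj n).comp ((transD e e' (Fin.cons 0 y)).comp (sliceIncl n))).det ≠ 0 ∧
    |((sliceProj n).comp ((transD e e' (Fin.cons 0 y)).comp (sliceIncl n))).det| * s' =
      s * ((sliceProj n).comp ((transD e e' (Fin.cons 0 y)).comp (sliceIncl n))).det ∧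
    ∀ w : Coord n, transD e e' (Fin.cons 0 y) (sliceIncl n w) =
      sliceIncl n (((sliceProj n).comp ((transD e e' (Fin.cons 0 y)).comp (sliceIncl n))) w) := by
  set u : Coord (n + 1) := Fin.cons 0 y with hu
  set A := transD e e' u with hA
  set C := (sliceProj n).comp (A.comp (sliceIncl n)) with hC
  have hτ : HasFDerivAt (e' ∘ e.symm) A u := hasFDerivAt_transition he.1.1 he'.1.1 hy hy'
  have hev := eventually_mem_overlap (e := e) (e' := e') hy hy'
  -- Both charts describe the same `S` and the same side `B`, so the transition preserves the slice
  -- and the sides, up to the signs `s` and `s'`.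
  have hτ0 : ∀ v, v ∈ e.target ∧ e.symm v ∈ e'.source →
      (v 0 = 0 ↔ (e' (e.symm v)) 0 = 0) ∧ (s * v 0 < 0 ↔ s' * (e' (e.symm v)) 0 < 0) := by
    rintro v ⟨hv, hv'⟩
    have h1 := he.2.2 _ (e.map_target hv)
    have h2 := he'.2.2 _ hv'
    rw [e.right_inv hv] at h1
    exact ⟨h1.1.symm.trans h2.1, h1.2.symm.trans h2.2⟩
  have hproj : HasFDerivAt (fun v => (e' (e.symm v)) 0)
      ((ContinuousLinearMap.proj (R := ℝ) (φ := fun _ : Fin (n + 1) => ℝ) 0).comp A) u :=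
    (ContinuousLinearMap.proj (R := ℝ) (φ := fun _ : Fin (n + 1) => ℝ) 0).hasFDerivAt.comp u hτ
  have hfu : (e' (e.symm u)) 0 = 0 := (hτ0 u ⟨hy, hy'⟩).1.1 rfl
  -- The transverse coordinate is constantly zero along the slice, so `A` is block triangular and
  -- its determinant is the transverse derivative times `C.det`.
  have hrow : ∀ w : Coord n, A (Fin.cons 0 w) 0 = 0 := by
    intro w
    have hline : HasDerivAt (fun t : ℝ => u + t • (Fin.cons 0 w : Coord (n + 1)))
        (Fin.cons 0 w : Coord (n + 1)) 0 := by
      simpa using ((hasDerivAt_id (0 : ℝ)).smul_const (Fin.cons 0 w : Coord (n + 1))).const_add u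
    have h1 := HasFDerivAt.comp_hasDerivAt_of_eq (0 : ℝ) hproj hline (by simp)
    have h2 : HasDerivAt (fun _ : ℝ => (0 : ℝ)) 0 0 := hasDerivAt_const _ _
    refine HasDerivAt.unique h1 (h2.congr_of_eventuallyEq ?_)
    have hc : Filter.Tendsto (fun t : ℝ => u + t • (Fin.cons 0 w : Coord (n + 1))) (𝓝 0) (𝓝 u) := by
      simpa only [zero_smul, add_zero] using hline.continuousAt.tendsto
    filter_upwards [hc.eventually hev] with t ht
    refine (hτ0 _ ht).1.1 ?_
    simp [hu]
  have hdet : A.det = A (stdFrame (n + 1) 0) 0 * C.det := by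
    refine det_eq_mul_det_of_preserves A C hrow fun w j => ?_
    simp [hC, sliceIncl_apply, sliceProj]
  have hpos : 0 < A.det := he.1.det_transD_pos he'.1 hy hy'
  have hsgn : 0 ≤ s * s' * A (stdFrame (n + 1) 0) 0 := by
    have hline : HasDerivAt (fun t : ℝ => u + (s * t) • stdFrame (n + 1) 0)
        (s • stdFrame (n + 1) 0) 0 := by
      simpa using (((hasDerivAt_id (0 : ℝ)).const_mul s).smul_const
        (stdFrame (n + 1) 0)).const_add u
    have h1 := HasFDerivAt.comp_hasDerivAt_of_eq (0 : ℝ) hproj hline (by simp)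
    have h2 := h1.const_mul s'
    have h3 : s' * ((ContinuousLinearMap.proj (R := ℝ) (φ := fun _ : Fin (n + 1) => ℝ) 0).comp A)
        (s • stdFrame (n + 1) 0) = s * s' * A (stdFrame (n + 1) 0) 0 := by
      simp
      ring
    rw [h3] at h2
    refine hasDerivAt_nonneg_of_sign h2 (by simp [hfu]) ?_
    have hc : Filter.Tendsto (fun t : ℝ => u + (s * t) • stdFrame (n + 1) 0) (𝓝 0) (𝓝 u) := by
      simpa only [mul_zero, zero_smul, add_zero] using hline.continuousAt.tendsto
    filter_upwards [hc.eventually hev] with t ht ht0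
    refine ((hτ0 _ ht).2.1 ?_).le
    have hs2 : s * s = 1 := by rcases he.2.1 with rfl | rfl <;> norm_num
    simp only [hu, stdFrame, Pi.add_apply, Fin.cons_zero, Pi.smul_apply, Pi.single_eq_same,
      smul_eq_mul, zero_add, mul_one]
    rw [← mul_assoc, hs2, one_mul]
    exact ht0
  have hCne : C.det ≠ 0 := by
    intro h
    rw [hdet, h, mul_zero] at hpos
    exact lt_irrefl _ hpos
  refine ⟨hCne, ?_, ?_⟩
  · set a := A (stdFrame (n + 1) 0) 0
    have hane : a ≠ 0 := by
      intro h
      rw [hdet, h, zero_mul] at hpos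
      exact lt_irrefl _ hpos
    rw [hdet] at hpos
    -- The transverse derivative has the sign `s * s'` and `A.det` is positive, so `C.det` has the
    -- sign `s * s'` as well. Cases with the wrong transverse sign are contradictory.
    rcases he.2.1 with rfl | rfl <;> rcases he'.2.1 with rfl | rfl <;>
    rcases hane.lt_or_gt with ha | ha
    all_goals first
      | (exfalso; linarith)
      | (have hc : 0 < C.det := by nlinarith
         rw [abs_of_pos hc]; ring)
      | (have hc : C.det < 0 := by nlinarith
         rw [abs_of_neg hc]; ring)
  · intro w
    rw [sliceIncl_apply, sliceIncl_apply]
    have h1 : C w = sliceProj n (A (Fin.cons 0 w)) := by simp [hC, sliceIncl_apply]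
    rw [h1, sliceIncl_sliceProj (hrow w)]

theorem SlicePartition.HasSum.congr {A : SlicePartition 𝒪 S B} {α α' : DForm (n + 1) X n} {c : ℝ}
    (h : A.HasSum α c) (hα : ∀ x ∈ S, α x = α' x) : A.HasSum α' c := by
  have h1 : ∀ p, EqOn (A.piece α p) (A.piece α' p) (A.region p) := by
    intro p y hy
    simp only [SlicePartition.piece, DForm.inChart_eq, hα _ ((A.slice p).symm_mem hy)]
  have h2 : ∀ p, ∫ u in A.region p, A.piece α p u = ∫ u in A.region p, A.piece α' p u :=
    fun p => setIntegral_congr_fun (isOpen_sliceDom (A.chart p)).measurableSet (h1 p)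
  refine ⟨fun p => ((h.1 p).congr_fun (h1 p) (isOpen_sliceDom (A.chart p)).measurableSet), ?_, ?_⟩
  · simp only [← h2]; exact h.2.1
  · simp only [← h2]; exact h.2.2

theorem SlicePartition.HasSum.zero (A : SlicePartition 𝒪 S B) : A.HasSum 0 0 := by
  have h : ∀ p u, A.piece 0 p u = 0 := by
    intro p u
    simp only [SlicePartition.piece, DForm.inChart_eq]
    exact mul_eq_zero_of_right _ (mul_zero _)
  refine ⟨fun p => ?_, ?_, ?_⟩
  · have : A.piece 0 p = fun _ => 0 := funext (h p)
    rw [this]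
    exact integrableOn_zero
  · simp [h]
  · simp [h]

theorem SlicePartition.HasSum.add {A : SlicePartition 𝒪 S B} {α α' : DForm (n + 1) X n} {c c' : ℝ}
    (h : A.HasSum α c) (h' : A.HasSum α' c') : A.HasSum (α + α') (c + c') := by
  have h1 : ∀ p, A.piece (α + α') p = A.piece α p + A.piece α' p := by
    intro p
    ext y
    simp only [SlicePartition.piece_eq, DForm.sliceComp, DForm.inChart_eq, Pi.add_apply]
    rw [← mul_add, ← mul_add]
    rfl
  have h2 : (fun p => ∫ u in A.region p, A.piece (α + α') p u) = fun p =>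
      (∫ u in A.region p, A.piece α p u) + ∫ u in A.region p, A.piece α' p u := by
    ext p
    rw [h1]
    exact integral_add (h.1 p) (h'.1 p)
  refine ⟨fun p => ?_, ?_, ?_⟩
  · rw [h1]
    exact (h.1 p).add (h'.1 p)
  · rw [h2]
    exact (h.2.1.union h'.2.1).subset (Function.support_add _ _)
  · rw [h2, finsum_add_distrib h.2.1 h'.2.1, h.2.2, h'.2.2]

theorem SlicePartition.HasSum.sum {A : SlicePartition 𝒪 S B} {ι : Type*} (s : Finset ι)
    {α : ι → DForm (n + 1) X n} {c : ι → ℝ} (h : ∀ i ∈ s, A.HasSum (α i) (c i)) :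
    A.HasSum (∑ i ∈ s, α i) (∑ i ∈ s, c i) := by
  classical
  induction s using Finset.induction_on with
  | empty => simpa using SlicePartition.HasSum.zero A
  | insert i s hi ih =>
    rw [Finset.sum_insert hi, Finset.sum_insert hi]
    exact (h i (Finset.mem_insert_self i s)).add
      (ih fun j hj => h j (Finset.mem_insert_of_mem hj))

/-- The integral over `S` of a form with compact support in one adapted chart is computed in this
chart. -/
theorem SlicePartition.hasSum_of_supported (A : SlicePartition 𝒪 S B) {α : DForm (n + 1) X n}
    {e : OpenPartialHomeomorph X (Coord (n + 1))} {s : ℝ} (he : IsSliceChart 𝒪 S B e s)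
    {K : Set X} (hK : IsCompact K) (hKe : K ⊆ e.source) (h0 : ∀ x ∈ S, x ∉ K → α x = 0)
    (hint : IntegrableOn (α.sliceComp e) (sliceDom e)) :
    A.HasSum α (s * ∫ y in sliceDom e, α.sliceComp e y) := by
  have hDo : IsOpen (sliceDom e) := isOpen_sliceDom e
  have hin0 : ∀ (e' : OpenPartialHomeomorph X (Coord (n + 1))) y,
      e'.symm (Fin.cons 0 y) ∈ S → e'.symm (Fin.cons 0 y) ∉ K → α.sliceComp e' y = 0 := by
    intro e' v hv hvK
    rw [DForm.sliceComp, DForm.inChart_eq, h0 _ hv hvK]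
    rfl
  have hcs : ContinuousOn (fun y : Coord n => e.symm (Fin.cons 0 y)) (sliceDom e) :=
    e.continuousOn_symm.comp continuous_cons_zero.continuousOn fun y hy => hy
  obtain ⟨s1, s2, s3⟩ := finsum_integral_partition (w := fun p x => A.weight p x)
    (fun p x => A.weight.nonneg p x) (fun p x => A.weight.le_one p x) A.weight.locallyFinite hK
    hDo.measurableSet (hint.const_mul s) (g := fun y : Coord n => e.symm (Fin.cons 0 y))
    (fun u hu hu' => by rw [hin0 e u (he.symm_mem hu) hu', mul_zero])
    (fun u hu => A.weight.sum_eq_one (he.symm_mem hu))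
    (fun p => (A.weight p).contMDiff.continuous.comp_continuousOn hcs)
  have key : ∀ p, IntegrableOn (A.piece α p) (A.region p) ∧
      ∫ y in A.region p, A.piece α p y =
        ∫ y in sliceDom e, A.weight p (e.symm (Fin.cons 0 y)) * (s * α.sliceComp e y) := by
    intro p
    set e' := A.chart p
    have he' : IsSliceChart 𝒪 S B e' (A.sgn p) := A.slice p
    set W := {y | y ∈ sliceDom e ∧ e.symm (Fin.cons 0 y) ∈ e'.source} with hW
    have hWo : IsOpen W := hcs.isOpen_inter_preimage hDo e'.open_source
    set σ : Coord n → Coord n := fun y => sliceProj n (e' (e.symm (Fin.cons 0 y)))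
    set C : Coord n → Coord n →L[ℝ] Coord n := fun y =>
      (sliceProj n).comp ((transD e e' (Fin.cons 0 y)).comp (sliceIncl n))
    have hσ : ∀ y ∈ W, HasFDerivWithinAt σ (C y) W y := by
      intro y hy
      have h1 : HasFDerivAt (e' ∘ e.symm) (transD e e' (Fin.cons 0 y)) (sliceIncl n y) := by
        rw [sliceIncl_apply]
        exact hasFDerivAt_transition he.1.1 he'.1.1 hy.1 hy.2
      have h2 := (sliceProj n).hasFDerivAt.comp y (h1.comp y (sliceIncl n).hasFDerivAt)
      have h3 : σ = sliceProj n ∘ ((e' ∘ e.symm) ∘ sliceIncl n) := by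
        ext1 y
        simp only [σ, Function.comp, sliceIncl_apply]
      rw [h3]
      exact h2.hasFDerivWithinAt
    -- The point lies on `S`, so its transverse coordinate in `e'` is zero and nothing is lost by
    -- `sliceProj`.
    have hcons : ∀ y ∈ W, (Fin.cons 0 (σ y) : Coord (n + 1)) = e' (e.symm (Fin.cons 0 y)) :=
      fun y hy => sliceIncl_sliceProj ((he'.2.2 _ hy.2).1.1 (he.symm_mem hy.1))
    have hback : ∀ y ∈ W, e'.symm (Fin.cons 0 (σ y)) = e.symm (Fin.cons 0 y) := by
      intro y hy
      rw [hcons y hy, e'.left_inv hy.2]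
    have hσi : InjOn σ W := by
      intro u hu v hv huv
      have h1 : e.symm (Fin.cons 0 u) = e.symm (Fin.cons 0 v) := by
        rw [← hback u hu, ← hback v hv, huv]
      have h2 := e.symm.injOn hu.1 hv.1 h1
      have h3 := congrArg (sliceProj n) h2
      rwa [sliceProj_cons, sliceProj_cons] at h3
    have himg : ∀ v, v ∈ σ '' W ↔ v ∈ A.region p ∧ e'.symm (Fin.cons 0 v) ∈ e.source := by
      intro v
      constructor
      · rintro ⟨u, hu, rfl⟩
        refine ⟨?_, ?_⟩
        · change (Fin.cons 0 (σ u) : Coord (n + 1)) ∈ e'.target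
          rw [hcons u hu]
          exact e'.map_source hu.2
        · rw [hback u hu]
          exact e.map_target hu.1
      · rintro ⟨h1, h3⟩
        have h4 : (e (e'.symm (Fin.cons 0 v))) 0 = 0 := (he.2.2 _ h3).1.1 (he'.symm_mem h1)
        have h5 := sliceIncl_sliceProj h4
        have h6 : e.symm (Fin.cons 0 (sliceProj n (e (e'.symm (Fin.cons 0 v))))) =
            e'.symm (Fin.cons 0 v) := by rw [h5, e.left_inv h3]
        refine ⟨sliceProj n (e (e'.symm (Fin.cons 0 v))), ⟨?_, ?_⟩, ?_⟩
        · change (Fin.cons 0 _ : Coord (n + 1)) ∈ e.target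
          rw [h5]
          exact e.map_source h3
        · rw [h6]
          exact e'.map_target h1
        · change sliceProj n (e' (e.symm (Fin.cons 0 _))) = v
          rw [h6, e'.right_inv h1, sliceProj_cons]
    have hsub : σ '' W ⊆ A.region p := fun v hv => ((himg v).1 hv).1
    have hreg : MeasurableSet (A.region p) := (isOpen_sliceDom e').measurableSet
    have hz : ∀ v ∈ A.region p \ σ '' W, A.piece α p v = 0 := by
      rintro v ⟨hv, hv'⟩
      have h1 : e'.symm (Fin.cons 0 v) ∉ K := fun h => hv' ((himg v).2 ⟨hv, hKe h⟩)
      rw [A.piece_eq, hin0 e' v (he'.symm_mem hv) h1, mul_zero, mul_zero]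
    -- The slice components differ by `(C y).det`, while the change of variables has its absolute
    -- value. The signs attached to the two adapted charts account for the difference.
    have hpull : ∀ y ∈ W, |(C y).det| • A.piece α p (σ y) =
        A.weight p (e.symm (Fin.cons 0 y)) * (s * α.sliceComp e y) := by
      intro y hy
      obtain ⟨-, h2, h3⟩ := he.transition he' hy.1 hy.2
      have h4 : α.sliceComp e y = (C y).det * α.sliceComp e' (σ y) := by
        rw [DForm.sliceComp, α.inChart_change he.1.1 he'.1.1 hy.1 hy.2, ← hcons y hy]
        have h5 := alternating_comp_stdFrame
          ((α.inChart e' (Fin.cons 0 (σ y))).compContinuousLinearMap (sliceIncl n)) (C y)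
        have h6 : omitFrame (0 : Fin (n + 1)) = fun j => sliceIncl n (stdFrame n j) :=
          funext fun j => omitFrame_zero j
        have h7 : (fun j => transD e e' (Fin.cons 0 y) (omitFrame 0 j)) =
            fun j => sliceIncl n (C y (stdFrame n j)) := by
          ext1 j
          rw [omitFrame_zero]
          exact h3 _
        have h8 : α.inChart e' (Fin.cons 0 (σ y))
            (fun j => transD e e' (Fin.cons 0 y) (omitFrame 0 j)) =
            (C y).det * α.inChart e' (Fin.cons 0 (σ y)) (omitFrame 0) := by
          rw [h7, h6]
          exact h5
        exact h8
      rw [A.piece_eq, smul_eq_mul, ← mul_assoc, h2, h4]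
      change _ * (A.weight p (e'.symm (Fin.cons 0 (σ y))) * α.sliceComp e' (σ y)) = _
      rw [hback y hy]
      change s * (C y).det * _ = _
      ring
    have hzW : ∀ y ∈ sliceDom e \ W,
        A.weight p (e.symm (Fin.cons 0 y)) * (s * α.sliceComp e y) = 0 := by
      rintro u ⟨hu, hu'⟩
      refine mul_eq_zero_of_left ?_ _
      by_contra hne
      exact hu' ⟨hu, A.subordinate p (subset_tsupport _ hne)⟩
    constructor
    · refine IntegrableOn.of_forall_sdiff_eq_zero ?_ hreg hz
      rw [integrableOn_image_iff_integrableOn_abs_det_fderiv_smul volume hWo.measurableSet hσ hσi]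
      exact ((s1 p).mono_set fun y hy => hy.1).congr_fun (fun u hu => (hpull u hu).symm)
        hWo.measurableSet
    · rw [setIntegral_eq_of_subset_of_forall_sdiff_eq_zero hreg hsub hz,
        integral_image_eq_integral_abs_det_fderiv_smul volume hWo.measurableSet hσ hσi,
        setIntegral_congr_fun hWo.measurableSet hpull,
        setIntegral_eq_of_subset_of_forall_sdiff_eq_zero hDo.measurableSet (fun y hy => hy.1) hzW]
  refine ⟨fun p => (key p).1, ?_, ?_⟩
  · simp only [fun p => (key p).2]
    exact s2
  · simp only [fun p => (key p).2]
    rw [s3, integral_const_mul]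

end Slice

/-! ### Stokes' theorem -/

section Existence

variable {m : ℕ} {X : Type*} [TopologicalSpace X] [ChartedSpace (Coord m) X]
  [IsManifold (mdl m) ∞ X] [T2Space X] [SigmaCompactSpace X]

theorem nonempty_topPartition (𝒪 : OrientedAtlas m X) : Nonempty (TopPartition 𝒪) := by
  choose e he hx using 𝒪.cover
  obtain ⟨w, hw⟩ := SmoothPartitionOfUnity.exists_isSubordinate (mdl m) isClosed_univ
    (fun x => (e x).source) (fun x => (e x).open_source) fun x _ => mem_iUnion.2 ⟨x, hx x⟩
  exact ⟨⟨e, fun p => 𝒪.isPositive_of_mem (he p), hx, w, hw⟩⟩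

end Existence

/-! ### The exterior derivative of a form multiplied by a cutoff -/

section Exterior

variable {m n : ℕ} {X : Type*} [TopologicalSpace X]

section

variable [ChartedSpace (Coord m) X]

/-- The differential of a function, as a linear form on the coordinate space. -/
def diffForm (χ : X → ℝ) (x : X) : Coord m →L[ℝ] ℝ := mfderiv (mdl m) 𝓘(ℝ, ℝ) χ x

theorem diffForm_comp_symmD {χ : X → ℝ} (hχ : ContMDiff (mdl m) 𝓘(ℝ, ℝ) ∞ χ)
    {e : OpenPartialHomeomorph X (Coord m)} (he : e ∈ IsManifold.maximalAtlas (mdl m) ∞ X)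
    {u : Coord m} (hu : u ∈ e.target) :
    HasFDerivAt (fun v => χ (e.symm v)) ((diffForm χ (e.symm u)).comp (symmD e u)) u := by
  have h1 : MDifferentiableAt (mdl m) 𝓘(ℝ, ℝ) χ (e.symm u) :=
    (hχ _).mdifferentiableAt (by simp)
  have h2 : MDifferentiableAt (mdl m) (mdl m) e.symm u :=
    (contMDiffAt_chart_symm he hu).mdifferentiableAt (by simp)
  exact (h1.hasMFDerivAt.comp u h2.hasMFDerivAt).hasFDerivAt

theorem hasMFDerivAt_sum {ι : Type*} (s : Finset ι) {χ : ι → X → ℝ} {x : X}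
    {χ' : ι → Coord m →L[ℝ] ℝ}
    (h : ∀ i ∈ s, HasMFDerivAt (mdl m) 𝓘(ℝ, ℝ) (χ i) x (χ' i)) :
    HasMFDerivAt (mdl m) 𝓘(ℝ, ℝ) (∑ i ∈ s, χ i) x (∑ i ∈ s, χ' i) := by
  classical
  induction s using Finset.induction_on with
  | empty => exact hasMFDerivAt_const (0 : ℝ) x
  | insert i s hi ih =>
    have key : ∀ D : Coord m →L[ℝ] ℝ, D = χ' i + ∑ j ∈ s, χ' j →
        HasMFDerivAt (mdl m) 𝓘(ℝ, ℝ) (χ i + ∑ j ∈ s, χ j) x D := by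
      rintro _ rfl
      exact (h i (Finset.mem_insert_self i s)).add
        (ih fun j hj => h j (Finset.mem_insert_of_mem hj))
    rw [Finset.sum_insert hi]
    exact key _ (Finset.sum_insert hi)

/-- A locally constant function has zero differential. This cancels the terms `dχ ∧ α` when the
cutoffs are summed. -/
theorem diffForm_sum_eq_zero {ι : Type*} (s : Finset ι) {χ : ι → X → ℝ}
    (hχ : ∀ i ∈ s, ContMDiff (mdl m) 𝓘(ℝ, ℝ) ∞ (χ i)) {x : X} {c : ℝ}
    (h : ∀ᶠ y in 𝓝 x, ∑ i ∈ s, χ i y = c) : ∑ i ∈ s, diffForm (m := m) (χ i) x = 0 := by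
  have h1 : HasMFDerivAt (mdl m) 𝓘(ℝ, ℝ) (∑ i ∈ s, χ i) x (∑ i ∈ s, diffForm (m := m) (χ i) x) :=
    hasMFDerivAt_sum s fun i hi => ((hχ i hi x).mdifferentiableAt (by simp)).hasMFDerivAt
  have h2 : HasMFDerivAt (mdl m) 𝓘(ℝ, ℝ) (∑ i ∈ s, χ i) x (0 : Coord m →L[ℝ] ℝ) :=
    (hasMFDerivAt_const c x).congr_of_eventuallyEq (h.mono fun y hy => by simpa using hy)
  exact hasMFDerivAt_unique h1 h2

end

variable [ChartedSpace (Coord (n + 1)) X]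

/-- The value of a form at a point, as an alternating map on the coordinate space. -/
def DForm.val {p : ℕ} (α : DForm (n + 1) X p) (x : X) : Coord (n + 1) [⋀^Fin p]→L[ℝ] ℝ := α x

/-- The value of `leibnizForm`. -/
def leibnizAt (χ : X → ℝ) (α : DForm (n + 1) X n) (η : DForm (n + 1) X (n + 1)) (x : X) :
    Coord (n + 1) [⋀^Fin (n + 1)]→L[ℝ] ℝ :=
  χ x • η.val x + ContinuousAlternatingMap.alternatizeUncurryFin
    ((diffForm (m := n + 1) χ x).smulRight (α.val x))

/-- The exterior derivative of the product of a function with a form `α` that has derivative `η`. -/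
def leibnizForm (χ : X → ℝ) (α : DForm (n + 1) X n) (η : DForm (n + 1) X (n + 1)) :
    DForm (n + 1) X (n + 1) := leibnizAt χ α η

theorem leibnizAt_apply (χ : X → ℝ) (α : DForm (n + 1) X n) (η : DForm (n + 1) X (n + 1)) (x : X)
    (v : Fin (n + 1) → Coord (n + 1)) : leibnizAt χ α η x v = χ x * η.val x v +
      ∑ μ : Fin (n + 1), (-1) ^ (μ : ℕ) *
        (diffForm (m := n + 1) χ x (v μ) * α.val x (μ.removeNth v)) := by
  have h : leibnizAt χ α η x v = χ x * η.val x v +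
    ContinuousAlternatingMap.alternatizeUncurryFin
      ((diffForm (m := n + 1) χ x).smulRight (α.val x)) v := rfl
  rw [h, ContinuousAlternatingMap.alternatizeUncurryFin_apply]
  congr 1
  refine Finset.sum_congr rfl fun μ _ => ?_
  rw [zsmul_eq_mul]
  push_cast
  rfl

/-- The product of a function with a form. -/
def scaleForm (χ : X → ℝ) (α : DForm (n + 1) X n) : DForm (n + 1) X n := fun x => χ x • α x

theorem scaleForm_inChart (χ : X → ℝ) (α : DForm (n + 1) X n)
    (e : OpenPartialHomeomorph X (Coord (n + 1))) (u : Coord (n + 1))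
    (v : Fin n → Coord (n + 1)) :
    (scaleForm χ α).inChart e u v = χ (e.symm u) * α.inChart e u v := rfl

theorem leibnizForm_inChart {χ : X → ℝ} (hχ : ContMDiff (mdl (n + 1)) 𝓘(ℝ, ℝ) ∞ χ)
    (α : DForm (n + 1) X n) (η : DForm (n + 1) X (n + 1))
    {e : OpenPartialHomeomorph X (Coord (n + 1))}
    (he : e ∈ IsManifold.maximalAtlas (mdl (n + 1)) ∞ X) {u : Coord (n + 1)} (hu : u ∈ e.target) :
    (leibnizForm χ α η).inChart e u (stdFrame (n + 1)) =
      χ (e.symm u) * η.inChart e u (stdFrame (n + 1)) +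
      ∑ μ : Fin (n + 1), (-1) ^ (μ : ℕ) *
        (fderiv ℝ (fun v => χ (e.symm v)) u (stdFrame (n + 1) μ) *
          α.inChart e u (omitFrame μ)) := by
  have h1 : (leibnizForm χ α η).inChart e u (stdFrame (n + 1)) =
      leibnizAt χ α η (e.symm u) (fun i => symmD e u (stdFrame (n + 1) i)) := rfl
  rw [h1, leibnizAt_apply, (diffForm_comp_symmD hχ he hu).fderiv]
  rfl

/-- The differential of `χ` enters, so `χ` must vanish near `x`. The forms `α` and `η` enter only
through their values at `x`. -/
theorem leibnizForm_apply_eq_zero {χ : X → ℝ} {α : DForm (n + 1) X n}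
    {η : DForm (n + 1) X (n + 1)} {x : X} (h : (χ =ᶠ[𝓝 x] 0) ∨ (α x = 0 ∧ η x = 0)) :
    leibnizForm χ α η x = 0 := by
  have key : leibnizAt χ α η x = 0 := by
    ext v
    rw [leibnizAt_apply]
    rcases h with h | ⟨h1, h2⟩
    · have h1 : diffForm (m := n + 1) χ x = 0 := by
        have := h.mfderiv_eq (I := mdl (n + 1)) (I' := 𝓘(ℝ, ℝ))
        exact this.trans mfderiv_const
      have h3 : χ x = 0 := h.eq_of_nhds
      simp [h1, h3]
    · have h1 : α.val x = 0 := h1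
      have h2 : η.val x = 0 := h2
      simp [h1, h2]
  exact key

/-- Where the cutoffs sum to one in a neighbourhood, their differentials cancel and only `η`
remains. -/
theorem sum_leibnizForm_apply {ι : Type*} (s : Finset ι) {χ : ι → X → ℝ}
    (hχ : ∀ i ∈ s, ContMDiff (mdl (n + 1)) 𝓘(ℝ, ℝ) ∞ (χ i)) {x : X}
    (h : ∀ᶠ y in 𝓝 x, ∑ i ∈ s, χ i y = 1) (α : DForm (n + 1) X n)
    (η : DForm (n + 1) X (n + 1)) : (∑ i ∈ s, leibnizForm (χ i) α η) x = η x := by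
  have h0 := diffForm_sum_eq_zero s hχ h
  have h1 : ∑ i ∈ s, χ i x = 1 := h.self_of_nhds
  have e1 : (∑ i ∈ s, leibnizForm (χ i) α η) x = ∑ i ∈ s, leibnizAt (χ i) α η x :=
    Finset.sum_apply _ _ _
  have e2 : ∑ i ∈ s, leibnizAt (χ i) α η x = η.val x := by
    ext v
    simp only [ContinuousAlternatingMap.sum_apply, leibnizAt_apply]
    rw [Finset.sum_add_distrib, ← Finset.sum_mul, h1, one_mul, Finset.sum_comm]
    have e3 : ∀ w, ∑ i ∈ s, diffForm (m := n + 1) (χ i) x w = 0 := by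
      intro w
      have := congrArg (fun A : Coord (n + 1) →L[ℝ] ℝ => A w) h0
      simpa using this
    simp [← Finset.mul_sum, ← Finset.sum_mul, e3]
  exact e1.trans e2

end Exterior

/-! ### Stokes' theorem in a chart: the vector field of a cut-off form -/

section Stokes

variable {n : ℕ} {X : Type*} [TopologicalSpace X] [ChartedSpace (Coord (n + 1)) X]
  {𝒪 : OrientedAtlas (n + 1) X} {U K : Set X} {α : DForm (n + 1) X n}
  {η : DForm (n + 1) X (n + 1)}

/-- On the open set `U`, the form `α` has the exterior derivative `η`; both are continuous up to the
boundary of `U` and vanish outside `K`. -/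
structure IsPrimitive (𝒪 : OrientedAtlas (n + 1) X) (U K : Set X) (α : DForm (n + 1) X n)
    (η : DForm (n + 1) X (n + 1)) : Prop where
  continuousOn_form : ∀ e, 𝒪.IsPositive e → ∀ μ,
    ContinuousOn (fun u => α.inChart e u (omitFrame μ)) (e.target ∩ e.symm ⁻¹' closure U)
  continuousOn_deriv : ∀ e, 𝒪.IsPositive e →
    ContinuousOn (fun u => η.inChart e u (stdFrame (n + 1))) (e.target ∩ e.symm ⁻¹' closure U)
  differentiableAt : ∀ e, 𝒪.IsPositive e → ∀ μ, ∀ u ∈ e.target ∩ e.symm ⁻¹' U,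
    DifferentiableAt ℝ (fun u => α.inChart e u (omitFrame μ)) u
  deriv_eq : ∀ e, 𝒪.IsPositive e → ∀ u ∈ e.target ∩ e.symm ⁻¹' U,
    η.inChart e u (stdFrame (n + 1)) = ∑ μ : Fin (n + 1), (-1) ^ (μ : ℕ) *
      fderiv ℝ (fun u => α.inChart e u (omitFrame μ)) u (stdFrame (n + 1) μ)
  form_eq_zero : ∀ x ∈ closure U, x ∉ K → α x = 0
  deriv_eq_zero : ∀ x ∈ U, x ∉ K → η x = 0

theorem contMDiff_comp_symm {χ : X → ℝ} (hχ : ContMDiff (mdl (n + 1)) 𝓘(ℝ, ℝ) ∞ χ)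
    {e : OpenPartialHomeomorph X (Coord (n + 1))}
    (he : e ∈ IsManifold.maximalAtlas (mdl (n + 1)) ∞ X) {u : Coord (n + 1)} (hu : u ∈ e.target) :
    ContDiffAt ℝ ∞ (fun v => χ (e.symm v)) u :=
  ((hχ (e.symm u)).comp u (contMDiffAt_chart_symm he hu)).contDiffAt

/-- Extension by zero: near `C` the indicator agrees with `f` along `H`, since `O` is a
neighbourhood of `C`; away from the closed set `C` it is zero. -/
theorem continuousOn_indicator_of_compact {E : Type*} [TopologicalSpace E] [T2Space E]
    {f : E → ℝ} {C O H D : Set E} (hC : IsCompact C) (hO : IsOpen O) (hCO : C ⊆ O)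
    (hD : O ∩ H ⊆ D) (hf : ContinuousOn f D) (h0 : ∀ u ∈ D, u ∉ C → f u = 0) :
    ContinuousOn (D.indicator f) H := by
  intro u hu
  by_cases huC : u ∈ C
  · have huO := hCO huC
    have h1 : ContinuousWithinAt f (O ∩ H) u := (hf u (hD ⟨huO, hu⟩)).mono hD
    have h2 : ContinuousWithinAt (D.indicator f) (O ∩ H) u :=
      h1.congr (fun v hv => indicator_of_mem (hD hv) f) (indicator_of_mem (hD ⟨huO, hu⟩) f)
    exact (continuousWithinAt_inter' (mem_nhdsWithin_of_mem_nhds (hO.mem_nhds huO))).1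
      (by rwa [inter_comm] at h2)
  · have h1 : ∀ v ∈ Cᶜ, D.indicator f v = 0 := by
      intro v hv
      by_cases hvD : v ∈ D
      · rw [indicator_of_mem hvD, h0 v hvD hv]
      · rw [indicator_of_notMem hvD]
    have h2 : D.indicator f =ᶠ[𝓝 u] fun _ => 0 :=
      Filter.eventually_of_mem (hC.isClosed.isOpen_compl.mem_nhds huC) h1
    exact (continuousAt_const.congr h2.symm).continuousWithinAt

/-- The data for the divergence theorem in one chart. -/
theorem IsPrimitive.local_data (h : IsPrimitive 𝒪 U K α η) (hU : IsOpen U) (hK : IsCompact K)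
    [T2Space X] {χ : X → ℝ} (hχ : ContMDiff (mdl (n + 1)) 𝓘(ℝ, ℝ) ∞ χ)
    {e : OpenPartialHomeomorph X (Coord (n + 1))} (he : 𝒪.IsPositive e)
    (hχe : tsupport χ ⊆ e.source) {H Ho : Set (Coord (n + 1))} (hHo : IsOpen Ho)
    (hHU : ∀ u ∈ e.target, (u ∈ H ↔ e.symm u ∈ closure U) ∧ (u ∈ Ho ↔ e.symm u ∈ U)) :
    ∃ (Z : Fin (n + 1) → Coord (n + 1) → ℝ) (g : Coord (n + 1) → ℝ) (C : Set (Coord (n + 1))),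
      IsCompact C ∧ (∀ i u, u ∉ C → Z i u = 0) ∧ (∀ i, ContinuousOn (Z i) H) ∧
      (∀ u ∈ Ho, ∀ i, DifferentiableAt ℝ (Z i) u) ∧ IntegrableOn g Ho ∧
      (∀ u ∈ Ho, g u = ∑ i, fderiv ℝ (Z i) u (Pi.single i 1)) ∧ (∀ u, u ∉ C → g u = 0) ∧
      (∫ u in Ho, g u = ∫ u in e.target ∩ e.symm ⁻¹' U,
        (leibnizForm χ α η).inChart e u (stdFrame (n + 1))) ∧
      IntegrableOn (fun u => (leibnizForm χ α η).inChart e u (stdFrame (n + 1)))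
        (e.target ∩ e.symm ⁻¹' U) ∧
      (∀ u ∈ e.target, e.symm u ∈ closure U →
        Z 0 u = (scaleForm χ α).inChart e u (omitFrame 0)) ∧
      ∀ u, u ∉ e.target → Z 0 u = 0 := by
  set D := e.target ∩ e.symm ⁻¹' closure U with hD
  set D' := e.target ∩ e.symm ⁻¹' U with hD'
  have hD'o : IsOpen D' := e.isOpen_inter_preimage_symm hU
  have hD'D : D' ⊆ D := fun u hu => ⟨hu.1, subset_closure hu.2⟩
  -- The cut-off form and its derivative are carried by this compact set; its image `C` in
  -- coordinates lies inside the chart.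
  set Q := tsupport χ ∩ (K ∩ closure U) with hQ
  have hQc : IsCompact Q := by
    rw [hQ, inter_comm]
    exact (hK.inter_right isClosed_closure).inter_right (isClosed_tsupport χ)
  have hQe : Q ⊆ e.source := fun x hx => hχe hx.1
  set C := e '' Q with hC
  have hCc : IsCompact C := hQc.image_of_continuousOn (e.continuousOn.mono hQe)
  have hCt : C ⊆ e.target := by
    rintro _ ⟨x, hx, rfl⟩
    exact e.map_source (hQe hx)
  have hCQ : ∀ u ∈ e.target, e.symm u ∈ Q → u ∈ C := fun u hu hx =>
    ⟨e.symm u, hx, e.right_inv hu⟩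
  have hCD : C ⊆ D := by
    rintro _ ⟨x, hx, rfl⟩
    refine ⟨e.map_source (hQe hx), ?_⟩
    change e.symm (e x) ∈ closure U
    rw [e.left_inv (hQe hx)]
    exact hx.2.2
  -- vanishing
  have hnot : ∀ x, x ∈ closure U → x ∉ Q → (χ =ᶠ[𝓝 x] 0) ∨ x ∉ K := by
    intro x hx hxQ
    by_cases hxs : x ∈ tsupport χ
    · exact Or.inr fun hxK => hxQ ⟨hxs, hxK, hx⟩
    · exact Or.inl (notMem_tsupport_iff_eventuallyEq.1 hxs)
  have hform0 : ∀ u ∈ D, u ∉ C → ∀ μ, (scaleForm χ α).inChart e u (omitFrame μ) = 0 := by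
    intro u hu huC μ
    rw [scaleForm_inChart]
    rcases hnot _ hu.2 (fun hx => huC (hCQ u hu.1 hx)) with h1 | h1
    · rw [h1.eq_of_nhds]
      simp
    · rw [DForm.inChart_eq, h.form_eq_zero _ hu.2 h1]
      exact mul_zero _
  have hder0 : ∀ u ∈ D', u ∉ C → (leibnizForm χ α η).inChart e u (stdFrame (n + 1)) = 0 := by
    intro u hu huC
    have h2 : leibnizForm χ α η (e.symm u) = 0 := by
      refine leibnizForm_apply_eq_zero ?_
      rcases hnot _ (subset_closure hu.2) (fun hx => huC (hCQ u hu.1 hx)) with h1 | h1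
      · exact Or.inl h1
      · exact Or.inr ⟨h.form_eq_zero _ (subset_closure hu.2) h1, h.deriv_eq_zero _ hu.2 h1⟩
    rw [DForm.inChart_eq, h2]
    rfl
  -- continuity
  have hχc : ContinuousOn (fun u => χ (e.symm u)) D := fun u hu =>
    (contMDiff_comp_symm hχ he.1 hu.1).continuousAt.continuousWithinAt
  have hχdc : ∀ w, ContinuousOn (fun u => fderiv ℝ (fun v => χ (e.symm v)) u w) D := fun w u hu =>
    (((contMDiff_comp_symm hχ he.1 hu.1).fderiv_right (m := 0) (by simp)).continuousAt.clm_apply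
      continuousAt_const).continuousWithinAt
  have hdcont : ContinuousOn (fun u => (leibnizForm χ α η).inChart e u (stdFrame (n + 1))) D := by
    have h1 : ContinuousOn (fun u => χ (e.symm u) * η.inChart e u (stdFrame (n + 1)) +
        ∑ μ : Fin (n + 1), (-1) ^ (μ : ℕ) *
          (fderiv ℝ (fun v => χ (e.symm v)) u (stdFrame (n + 1) μ) *
            α.inChart e u (omitFrame μ))) D :=
      (hχc.mul (h.continuousOn_deriv e he)).add (continuousOn_finsetSum _ fun μ _ =>
        continuousOn_const.mul ((hχdc _).mul (h.continuousOn_form e he μ)))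
    exact h1.congr fun u hu => leibnizForm_inChart hχ α η he.1 hu.1
  have hdint : IntegrableOn (fun u => (leibnizForm χ α η).inChart e u (stdFrame (n + 1))) D' :=
    integrableOn_of_continuousOn_of_compact hD'o.measurableSet hCc hCD hdcont hder0
  have hHD : e.target ∩ H ⊆ D := fun u hu => ⟨hu.1, (hHU u hu.1).1.1 hu.2⟩
  have hD'Ho : D' ⊆ Ho := fun u hu => (hHU u hu.1).2.2 hu.2
  have hgz : ∀ u ∈ Ho \ D',
      D'.indicator (fun u => (leibnizForm χ α η).inChart e u (stdFrame (n + 1))) u = 0 :=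
    fun u hu => indicator_of_notMem hu.2 _
  -- derivative at interior points
  have hloc : ∀ u ∈ D', ∀ i : Fin (n + 1),
      D.indicator (fun u => (-1) ^ (i : ℕ) * (scaleForm χ α).inChart e u (omitFrame i)) =ᶠ[𝓝 u]
      fun u => (-1) ^ (i : ℕ) * (χ (e.symm u) * α.inChart e u (omitFrame i)) := by
    intro u hu i
    filter_upwards [hD'o.mem_nhds hu] with v hv
    rw [indicator_of_mem (hD'D hv)]
    rfl
  have hloc0 : ∀ u ∉ C, ∀ i : Fin (n + 1),
      D.indicator (fun u => (-1) ^ (i : ℕ) * (scaleForm χ α).inChart e u (omitFrame i)) u = 0 := by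
    intro u hu i
    by_cases huD : u ∈ D
    · rw [indicator_of_mem huD, hform0 u huD hu i, mul_zero]
    · rw [indicator_of_notMem huD]
  have hd1 : ∀ u ∈ D', ∀ i : Fin (n + 1), HasFDerivAt
      (fun u => (-1) ^ (i : ℕ) * (χ (e.symm u) * α.inChart e u (omitFrame i)))
      (((-1 : ℝ) ^ (i : ℕ)) • (χ (e.symm u) • fderiv ℝ (fun u => α.inChart e u (omitFrame i)) u +
        α.inChart e u (omitFrame i) • fderiv ℝ (fun v => χ (e.symm v)) u)) u := by
    intro u hu i
    have h1 := ((contMDiff_comp_symm hχ he.1 hu.1).differentiableAt (by simp)).hasFDerivAt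
    have h2 := (h.differentiableAt e he i u hu).hasFDerivAt
    exact (h1.mul h2).const_mul _
  have hoff : ∀ u ∉ C, ∀ i : Fin (n + 1),
      D.indicator (fun u => (-1) ^ (i : ℕ) * (scaleForm χ α).inChart e u (omitFrame i)) =ᶠ[𝓝 u]
      fun _ => 0 := fun u hu i =>
    Filter.eventually_of_mem (hCc.isClosed.isOpen_compl.mem_nhds hu) fun v hv => hloc0 v hv i
  -- The vector field whose flux is `χα` has the components `(-1)^i (χα)(…, ∂_{i-1}, ∂_{i+1}, …)`,
  -- and its divergence is the coefficient of `d(χα)`. Field and divergence are extended by zero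
  -- beyond the chart, so that the divergence theorem on all of `H` applies.
  refine ⟨fun i => D.indicator fun u => (-1) ^ (i : ℕ) *
      (scaleForm χ α).inChart e u (omitFrame i),
    D'.indicator fun u => (leibnizForm χ α η).inChart e u (stdFrame (n + 1)), C, hCc,
    fun i u hu => hloc0 u hu i, fun i => ?_, fun u hu i => ?_, ?_, fun u hu => ?_, fun u hu => ?_,
    ?_, hdint, fun u hu hu' => ?_, fun u hu => ?_⟩
  · refine continuousOn_indicator_of_compact hCc e.open_target hCt hHD ?_ fun u hu huC => by
      rw [hform0 u hu huC, mul_zero]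
    exact continuousOn_const.mul (hχc.mul (h.continuousOn_form e he i))
  -- A point of `Ho` outside `C` may be outside the chart, but the extended field is zero on a
  -- neighbourhood of it.
  · by_cases huC : u ∈ C
    · have huD' : u ∈ D' := ⟨hCt huC, (hHU u (hCt huC)).2.1 hu⟩
      exact ((hd1 u huD' i).congr_of_eventuallyEq (hloc u huD' i)).differentiableAt
    · exact ((hasFDerivAt_const (0 : ℝ) u).congr_of_eventuallyEq (hoff u huC i)).differentiableAt
  · refine IntegrableOn.of_forall_sdiff_eq_zero ?_ hHo.measurableSet hgz
    exact hdint.congr_fun (fun u hu => by rw [indicator_of_mem hu]) hD'o.measurableSet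
  · by_cases huC : u ∈ C
    · have huD' : u ∈ D' := ⟨hCt huC, (hHU u (hCt huC)).2.1 hu⟩
      rw [indicator_of_mem huD', leibnizForm_inChart hχ α η he.1 huD'.1, h.deriv_eq e he u huD',
        Finset.mul_sum, ← Finset.sum_add_distrib]
      refine Finset.sum_congr rfl fun i _ => ?_
      rw [((hd1 u huD' i).congr_of_eventuallyEq (hloc u huD' i)).fderiv]
      simp only [smul_apply, add_apply, smul_eq_mul,
        stdFrame]
      ring
    · have h1 : ∀ i : Fin (n + 1), fderiv ℝ (D.indicator fun u => (-1) ^ (i : ℕ) *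
          (scaleForm χ α).inChart e u (omitFrame i)) u = 0 := fun i =>
        ((hasFDerivAt_const (0 : ℝ) u).congr_of_eventuallyEq (hoff u huC i)).fderiv
      simp only [h1, zero_apply, Finset.sum_const_zero]
      by_cases huD' : u ∈ D'
      · rw [indicator_of_mem huD', hder0 u huD' huC]
      · rw [indicator_of_notMem huD']
  · by_cases huD' : u ∈ D'
    · rw [indicator_of_mem huD', hder0 u huD' hu]
    · rw [indicator_of_notMem huD']
  · rw [setIntegral_eq_of_subset_of_forall_sdiff_eq_zero hHo.measurableSet hD'Ho hgz]
    exact setIntegral_congr_fun hD'o.measurableSet fun u hu => indicator_of_mem hu _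
  · simp only
    rw [indicator_of_mem (show u ∈ D from ⟨hu, hu'⟩)]
    simp
  · exact indicator_of_notMem (fun hh => hu hh.1) _

end Stokes

theorem mem_restr_source {n : ℕ} {X : Type*} [TopologicalSpace X]
    {e : OpenPartialHomeomorph X (Coord (n + 1))} {O : Set X}
    (hO : IsOpen O) {x : X} (hx : x ∈ e.source) (hxO : x ∈ O) : x ∈ (e.restr O).source := by
  rw [e.restr_source' O hO]
  exact ⟨hx, hxO⟩

/-! ### Stokes' theorem on `U`, and hypersurfaces that make up its boundary -/

section StokesTheorem

variable {n : ℕ} {X : Type*} [TopologicalSpace X] [ChartedSpace (Coord (n + 1)) X]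
  {𝒪 : OrientedAtlas (n + 1) X} {U K : Set X} {α : DForm (n + 1) X n}
  {η : DForm (n + 1) X (n + 1)}

theorem IsSliceChart.mem_closure_iff {e : OpenPartialHomeomorph X (Coord (n + 1))} {s : ℝ}
    (he : IsSliceChart 𝒪 (frontier U) U e s) {q : X} (hq : q ∈ e.source) :
    (q ∈ closure U ↔ s * e q 0 ≤ 0) := by
  have h := he.2.2 q hq
  have hs : s ≠ 0 := by rcases he.2.1 with rfl | rfl <;> norm_num
  rw [closure_eq_self_union_frontier, mem_union, h.1, h.2, le_iff_lt_or_eq, mul_eq_zero]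
  simp [hs]

/-- Stokes' theorem for a form cut off to the domain of a chart that is adapted to the boundary of
`U` or contained in `U` or disjoint from `U`. -/
theorem IsPrimitive.stokes_local [T2Space X] (h : IsPrimitive 𝒪 U K α η) (hU : IsOpen U)
    (hK : IsCompact K) {χ : X → ℝ} (hχ : ContMDiff (mdl (n + 1)) 𝓘(ℝ, ℝ) ∞ χ)
    {e : OpenPartialHomeomorph X (Coord (n + 1))} (he : 𝒪.IsPositive e)
    (hχe : tsupport χ ⊆ e.source)
    (hkind : (∃ s, IsSliceChart 𝒪 (frontier U) U e s) ∨ e.source ⊆ U ∨ e.source ∩ closure U = ∅) :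
    ∃ c, (∀ A : TopPartition 𝒪, A.HasSum U (leibnizForm χ α η) c) ∧
      ∀ A : SlicePartition 𝒪 (frontier U) U, A.HasSum (scaleForm χ α) c := by
  have hQc : IsCompact (tsupport χ ∩ (K ∩ closure U)) := by
    rw [inter_comm]
    exact (hK.inter_right isClosed_closure).inter_right (isClosed_tsupport χ)
  have hQe : tsupport χ ∩ (K ∩ closure U) ⊆ e.source := fun x hx => hχe hx.1
  have hform0 : ∀ x ∈ closure U, x ∉ tsupport χ ∩ (K ∩ closure U) → scaleForm χ α x = 0 := by
    intro x hx hxQ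
    by_cases hxs : x ∈ tsupport χ
    · have h1 : α x = 0 := h.form_eq_zero _ hx fun hxK => hxQ ⟨hxs, hxK, hx⟩
      rw [scaleForm, h1, smul_zero]
    · rw [scaleForm, image_eq_zero_of_notMem_tsupport hxs, zero_smul]
  have hder0 : ∀ x ∈ U, x ∉ tsupport χ ∩ (K ∩ closure U) → leibnizForm χ α η x = 0 := by
    intro x hx hxQ
    refine leibnizForm_apply_eq_zero ?_
    by_cases hxs : x ∈ tsupport χ
    · have hxK : x ∉ K := fun hxK => hxQ ⟨hxs, hxK, subset_closure hx⟩
      exact Or.inr ⟨h.form_eq_zero _ (subset_closure hx) hxK, h.deriv_eq_zero _ hx hxK⟩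
    · exact Or.inl (notMem_tsupport_iff_eventuallyEq.1 hxs)
  have hzeroS : e.source ∩ frontier U = ∅ → ∀ A : SlicePartition 𝒪 (frontier U) U,
      A.HasSum (scaleForm χ α) 0 := by
    intro hdis A
    refine (SlicePartition.HasSum.zero A).congr fun x hx => ?_
    have hxs : x ∉ tsupport χ := fun hxs =>
      (hdis ▸ (⟨hχe hxs, hx⟩ : x ∈ e.source ∩ frontier U) : x ∈ (∅ : Set X))
    rw [scaleForm, image_eq_zero_of_notMem_tsupport hxs, zero_smul]
    rfl
  -- In an adapted chart the half space theorem equates the two integrals. In a chart inside `U` the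
  -- field has compact support in the whole space, so both are zero. In a chart away from `closure
  -- U` nothing is integrated.
  rcases hkind with ⟨s, hs⟩ | hin | hout
  · have hfr : ∀ x ∈ frontier U, x ∉ tsupport χ ∩ (K ∩ closure U) → scaleForm χ α x = 0 :=
      fun x hx => hform0 x (frontier_subset_closure hx)
    have hHU : ∀ u ∈ e.target, (u ∈ {u : Coord (n + 1) | s * u 0 ≤ 0} ↔ e.symm u ∈ closure U) ∧
        (u ∈ {u : Coord (n + 1) | s * u 0 < 0} ↔ e.symm u ∈ U) := by
      intro u hu
      have h1 := hs.mem_closure_iff (e.map_target hu)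
      have h2 := (hs.2.2 _ (e.map_target hu)).2
      rw [e.right_inv hu] at h1 h2
      exact ⟨h1.symm, h2.symm⟩
    obtain ⟨Z, g, C, hC, hZ0, hZc, hZd, hgi, hgZ, hg0, hgint, hint, hZ1, hZ2⟩ :=
      h.local_data hU hK hχ he hχe (isOpen_lt (by fun_prop) continuous_const) hHU
    have hdiv := integral_div_halfSpace hs.2.1 hC hZ0 hZc
      (fun u hu i => (hZd u hu i).hasFDerivAt) hgi hgZ hg0
    have hmemcl : ∀ y ∈ sliceDom e, e.symm (Fin.cons 0 y) ∈ closure U := fun y hy =>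
      frontier_subset_closure (hs.symm_mem hy)
    have hZs : ∀ y ∈ sliceDom e, (scaleForm χ α).sliceComp e y = Z 0 (Fin.cons 0 y) :=
      fun y hy => (hZ1 _ hy (hmemcl y hy)).symm
    have hZsint : IntegrableOn (fun y : Coord n => Z 0 (Fin.cons 0 y)) (sliceDom e) := by
      have hcont : Continuous fun y : Coord n => Z 0 (Fin.cons 0 y) := by
        refine (hZc 0).comp_continuous continuous_cons_zero fun y => ?_
        simp
      have hKc : IsCompact (sliceProj n '' C) := hC.image (sliceProj n).continuous
      refine integrableOn_of_continuousOn_of_compact (isOpen_sliceDom e).measurableSet hKc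
        (subset_univ _) hcont.continuousOn fun y _ hy => hZ0 _ _ fun hyC => hy ?_
      exact ⟨_, hyC, sliceProj_cons 0 y⟩
    have hslice : ∫ y in sliceDom e, (scaleForm χ α).sliceComp e y =
        ∫ y : Coord n, Z 0 (Fin.cons 0 y) := by
      rw [setIntegral_congr_fun (isOpen_sliceDom e).measurableSet hZs]
      exact setIntegral_eq_integral_of_forall_compl_eq_zero fun y hy => hZ2 _ hy
    refine ⟨s * ∫ y in sliceDom e, (scaleForm χ α).sliceComp e y, fun A => ?_, fun A => ?_⟩
    · rw [hslice, ← hdiv, hgint]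
      exact A.hasSum_of_supported hU he hQc hQe hder0 hint
    · exact A.hasSum_of_supported hs hQc hQe hfr
        (hZsint.congr_fun (fun y hy => (hZs y hy).symm) (isOpen_sliceDom e).measurableSet)
  · refine ⟨0, fun A => ?_, hzeroS ?_⟩
    · have hHU : ∀ u ∈ e.target, (u ∈ (univ : Set (Coord (n + 1))) ↔ e.symm u ∈ closure U) ∧
          (u ∈ (univ : Set (Coord (n + 1))) ↔ e.symm u ∈ U) := fun u hu =>
        ⟨iff_of_true (mem_univ _) (subset_closure (hin (e.map_target hu))),
          iff_of_true (mem_univ _) (hin (e.map_target hu))⟩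
      obtain ⟨Z, g, C, hC, hZ0, hZc, hZd, hgi, hgZ, hg0, hgint, hint, -, -⟩ :=
        h.local_data hU hK hχ he hχe isOpen_univ hHU
      have hdiv := integral_div_eq_zero hC hZ0 (fun u i => (hZd u (mem_univ u) i).hasFDerivAt)
        (integrableOn_univ.1 hgi) (fun u => hgZ u (mem_univ u)) hg0
      rw [Measure.restrict_univ] at hgint
      rw [← hdiv, hgint]
      exact A.hasSum_of_supported hU he hQc hQe hder0 hint
    · rw [hU.frontier_eq]
      exact eq_empty_of_forall_notMem fun x hx => hx.2.2 (hin hx.1)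
  · refine ⟨0, fun A => ?_, hzeroS ?_⟩
    · refine (TopPartition.HasSum.zero A).congr hU fun x hx => (hder0 x hx fun hxQ => ?_).symm
      exact (hout ▸ (⟨hχe hxQ.1, hxQ.2.2⟩ : x ∈ e.source ∩ closure U) : x ∈ (∅ : Set X))
    · exact subset_empty_iff.1 (hout ▸ inter_subset_inter_right _ frontier_subset_closure)

theorem exists_chart_kind (hU : IsOpen U) (hb : HasSmoothBoundary 𝒪 U) (x : X) :
    ∃ e : OpenPartialHomeomorph X (Coord (n + 1)), 𝒪.IsPositive e ∧ x ∈ e.source ∧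
      ((∃ s, IsSliceChart 𝒪 (frontier U) U e s) ∨ e.source ⊆ U ∨ e.source ∩ closure U = ∅) := by
  obtain ⟨e, he, hx⟩ := 𝒪.cover x
  have hpos := 𝒪.isPositive_of_mem he
  by_cases hxU : x ∈ U
  · refine ⟨e.restr U, hpos.restr hU, mem_restr_source hU hx hxU, Or.inr (Or.inl ?_)⟩
    rw [e.restr_source' U hU]
    exact inter_subset_right
  · by_cases hxc : x ∈ closure U
    · obtain ⟨e, s, hxe, hs⟩ := hb x (by rw [hU.frontier_eq]; exact ⟨hxc, hxU⟩)
      exact ⟨e, hs.1, hxe, Or.inl ⟨s, hs⟩⟩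
    · have hO : IsOpen (closure U)ᶜ := isClosed_closure.isOpen_compl
      refine ⟨e.restr (closure U)ᶜ, hpos.restr hO, mem_restr_source hO hx hxc,
        Or.inr (Or.inr ?_)⟩
      rw [e.restr_source' _ hO]
      exact eq_empty_of_forall_notMem fun y hy => hy.1.2 hy.2

/-- The integral over a hypersurface, computed with finitely many cutoff functions. -/
theorem SlicePartition.hasSum_of_cutoffs {S B : Set X} (hS : IsClosed S) (hK : IsCompact K)
    (A : SlicePartition 𝒪 S B)
    (hc : ∀ e, 𝒪.IsPositive e → ContinuousOn (fun u => α.inChart e u (omitFrame 0))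
      (e.target ∩ e.symm ⁻¹' S))
    (h0 : ∀ x ∈ S, x ∉ K → α x = 0) {ι : Type*} (I : Finset ι) {χ : ι → X → ℝ}
    (hχ : ∀ i ∈ I, ContMDiff (mdl (n + 1)) 𝓘(ℝ, ℝ) ∞ (χ i))
    {e : ι → OpenPartialHomeomorph X (Coord (n + 1))} {s : ι → ℝ}
    (he : ∀ i ∈ I, IsSliceChart 𝒪 S B (e i) (s i)) (hχe : ∀ i ∈ I, tsupport (χ i) ⊆ (e i).source)
    (h1 : ∀ x ∈ S ∩ K, ∑ i ∈ I, χ i x = 1) :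
    A.HasSum α (∑ i ∈ I, s i * ∫ y in sliceDom (e i), (scaleForm (χ i) α).sliceComp (e i) y) := by
  -- Each cut-off form lives in one adapted chart, so its integral is given by that chart and does
  -- not involve `A`.
  have key : ∀ i ∈ I, A.HasSum (scaleForm (χ i) α)
      (s i * ∫ y in sliceDom (e i), (scaleForm (χ i) α).sliceComp (e i) y) := by
    intro i hi
    have hQc : IsCompact (tsupport (χ i) ∩ (K ∩ S)) := by
      rw [inter_comm]
      exact (hK.inter_right hS).inter_right (isClosed_tsupport _)
    have hQe : tsupport (χ i) ∩ (K ∩ S) ⊆ (e i).source := fun x hx => hχe i hi hx.1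
    have hz : ∀ x ∈ S, x ∉ tsupport (χ i) ∩ (K ∩ S) → scaleForm (χ i) α x = 0 := by
      intro x hx hxQ
      by_cases hxs : x ∈ tsupport (χ i)
      · have h1 : α x = 0 := h0 _ hx fun hxK => hxQ ⟨hxs, hxK, hx⟩
        rw [scaleForm, h1, smul_zero]
      · rw [scaleForm, image_eq_zero_of_notMem_tsupport hxs, zero_smul]
    refine A.hasSum_of_supported (he i hi) hQc hQe hz ?_
    have hCc : IsCompact (sliceProj n '' ((e i) '' (tsupport (χ i) ∩ (K ∩ S)))) :=
      (hQc.image_of_continuousOn ((e i).continuousOn.mono hQe)).image (sliceProj n).continuous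
    refine integrableOn_of_continuousOn_of_compact (D := sliceDom (e i))
      (isOpen_sliceDom (e i)).measurableSet hCc ?_ ?_ ?_
    · rintro _ ⟨_, ⟨x, hx, rfl⟩, rfl⟩
      have h2 : e i x 0 = 0 := ((he i hi).2.2 x (hQe hx)).1.1 hx.2.2
      change (Fin.cons 0 _ : Coord (n + 1)) ∈ (e i).target
      rw [sliceIncl_sliceProj h2]
      exact (e i).map_source (hQe hx)
    · have h2 : ContinuousOn (fun u => χ i ((e i).symm u) * α.inChart (e i) u (omitFrame 0))
          ((e i).target ∩ (e i).symm ⁻¹' S) :=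
        ((hχ i hi).continuous.comp_continuousOn
          ((e i).continuousOn_symm.mono inter_subset_left)).mul (hc _ (he i hi).1)
      exact h2.comp continuous_cons_zero.continuousOn fun y hy => ⟨hy, (he i hi).symm_mem hy⟩
    · intro y hy hyC
      have h2 := (he i hi).symm_mem hy
      have h3 : scaleForm (χ i) α ((e i).symm (Fin.cons 0 y)) = 0 := hz _ h2 fun hx => hyC
        ⟨_, ⟨_, hx, rfl⟩, by rw [(e i).right_inv hy, sliceProj_cons]⟩
      rw [DForm.sliceComp, DForm.inChart_eq, h3]
      rfl
  refine (SlicePartition.HasSum.sum I key).congr fun x hx => ?_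
  rw [Finset.sum_apply]
  simp only [scaleForm]
  rw [← Finset.sum_smul]
  by_cases hxK : x ∈ K
  · rw [h1 x ⟨hx, hxK⟩, one_smul]
  · rw [h0 x hx hxK, smul_zero]

/-- Being adapted is a local condition on `S` and `B`, so both may be replaced by sets with the
prescribed behaviour on `O`. The sign is allowed to change because the new side may be the opposite
one. -/
theorem IsSliceChart.restr {S B : Set X} {e : OpenPartialHomeomorph X (Coord (n + 1))} {s s' : ℝ}
    (he : IsSliceChart 𝒪 S B e s) (hs' : s' = 1 ∨ s' = -1) {S' B' O : Set X} (hO : IsOpen O)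
    (hS : ∀ q ∈ O, (q ∈ S ↔ q ∈ S')) (hB : ∀ q ∈ O ∩ e.source, (q ∈ B' ↔ s' * e q 0 < 0)) :
    IsSliceChart 𝒪 S' B' (e.restr O) s' := by
  refine ⟨he.1.restr hO, hs', fun q hq => ?_⟩
  rw [e.restr_source' O hO] at hq
  exact ⟨(hS q hq.2).symm.trans (he.2.2 q hq.1).1, hB q ⟨hq.2, hq.1⟩⟩

variable [IsManifold (mdl (n + 1)) ∞ X] [T2Space X] [SigmaCompactSpace X]

theorem nonempty_slicePartition {S B : Set X} (hS : IsClosed S)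
    (h : ∀ p ∈ S, ∃ e s, p ∈ e.source ∧ IsSliceChart 𝒪 S B e s) :
    Nonempty (SlicePartition 𝒪 S B) := by
  choose e s hx hs using fun p : S => h p p.2
  obtain ⟨w, hw⟩ := SmoothPartitionOfUnity.exists_isSubordinate (mdl (n + 1)) hS
    (fun p : S => (e p).source) (fun p => (e p).open_source)
    fun p hp => mem_iUnion.2 ⟨⟨p, hp⟩, hx ⟨p, hp⟩⟩
  exact ⟨⟨e, s, hs, hx, w, hw⟩⟩

/-- **Stokes' theorem** for forms with compact support, in the sense of `HasTopIntegral` and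
`HasBoundaryIntegral`. -/
theorem IsPrimitive.stokes (h : IsPrimitive 𝒪 U K α η) (hU : IsOpen U)
    (hb : HasSmoothBoundary 𝒪 U) (hK : IsCompact K) :
    ∃ c, HasTopIntegral 𝒪 U η c ∧ HasBoundaryIntegral 𝒪 U α c := by
  have : LocallyCompactSpace X := ChartedSpace.locallyCompactSpace (Coord (n + 1)) X
  choose e he hxe hkind using exists_chart_kind (𝒪 := 𝒪) hU hb
  obtain ⟨w, hw⟩ := SmoothPartitionOfUnity.exists_isSubordinate (mdl (n + 1)) isClosed_univ
    (fun x => (e x).source) (fun x => (e x).open_source) fun x _ => mem_iUnion.2 ⟨x, hxe x⟩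
  -- The finitely many weights that meet `K` would sum to one only on `K`. With a compact
  -- neighbourhood of `K` the sum is one near each point of `K`, as the differentials require.
  obtain ⟨K₁, hK₁, hKK₁⟩ := exists_compact_superset hK
  have hfin := w.locallyFinite.finite_nonempty_inter_compact hK₁
  set s := hfin.toFinset with hs
  have hsum : ∀ y ∈ K₁, ∑ i ∈ s, w i y = 1 := by
    intro y hy
    rw [← w.sum_eq_one (mem_univ y)]
    refine (finsum_eq_sum_of_support_subset _ fun i hi => ?_).symm
    simpa [hs] using ⟨y, hi, hy⟩
  have hsum' : ∀ x ∈ K, ∀ᶠ y in 𝓝 x, ∑ i ∈ s, w i y = 1 := fun x hx =>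
    Filter.eventually_of_mem (mem_interior_iff_mem_nhds.1 (hKK₁ hx)) hsum
  have hwc : ∀ i, ContMDiff (mdl (n + 1)) 𝓘(ℝ, ℝ) ∞ (w i) := fun i => (w i).contMDiff
  choose c hc1 hc2 using fun i => h.stokes_local hU hK (hwc i) (he i) (hw i) (hkind i)
  refine ⟨∑ i ∈ s, c i, ⟨nonempty_topPartition 𝒪, fun A => ?_⟩,
    ⟨nonempty_slicePartition isClosed_frontier hb, fun A => ?_⟩⟩
  · refine (TopPartition.HasSum.sum s fun i _ => hc1 i A).congr hU fun x hx => ?_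
    by_cases hxK : x ∈ K
    · exact sum_leibnizForm_apply s (fun i _ => hwc i) (hsum' x hxK) α η
    · rw [h.deriv_eq_zero x hx hxK, Finset.sum_apply]
      exact Finset.sum_eq_zero fun i _ => leibnizForm_apply_eq_zero
        (Or.inr ⟨h.form_eq_zero x (subset_closure hx) hxK, h.deriv_eq_zero x hx hxK⟩)
  · refine (SlicePartition.HasSum.sum s fun i _ => hc2 i A).congr fun x hx => ?_
    rw [Finset.sum_apply]
    simp only [scaleForm]
    rw [← Finset.sum_smul]
    by_cases hxK : x ∈ K
    · rw [(hsum' x hxK).self_of_nhds, one_smul]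
    · rw [h.form_eq_zero x (frontier_subset_closure hx) hxK, smul_zero]

/-- A form whose integral over `∂U = S₊ - S₋` vanishes has the same integral over `S₊` and `S₋`. -/
theorem hasHypersurfaceIntegral_eq_of_boundary (hb : HasSmoothBoundary 𝒪 U) (hK : IsCompact K)
    (hc : ∀ e, 𝒪.IsPositive e → ContinuousOn (fun u => α.inChart e u (omitFrame 0))
      (e.target ∩ e.symm ⁻¹' frontier U))
    (h0 : ∀ x ∈ frontier U, x ∉ K → α x = 0) (hint : HasBoundaryIntegral 𝒪 U α 0)
    {Sp Sm Pp Pm : Set X} (hSp : IsClosed Sp) (hSm : IsClosed Sm) (hdis : Disjoint Sp Sm)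
    (hfr : frontier U = Sp ∪ Sm) (hPp : ∀ x ∈ Sp, ∀ᶠ q in 𝓝 x, (q ∈ U ↔ q ∈ Pp))
    (hPm : ∀ x ∈ Sm, ∀ᶠ q in 𝓝 x, (q ∈ closure U ↔ q ∉ Pm)) :
    ∃ c, HasHypersurfaceIntegral 𝒪 Sm Pm α c ∧ HasHypersurfaceIntegral 𝒪 Sp Pp α c := by
  -- Charts are shrunk until they meet only one of `Sp` and `Sm`. Near `Sp` the sides `U` and `Pp`
  -- agree and the sign is kept. Near `Sm` the set `Pm` is the complement of `closure U`, so the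
  -- same chart is adapted to `Pm` with the opposite sign.
  have hchart : ∀ x : frontier U, ∃ (e : OpenPartialHomeomorph X (Coord (n + 1))) (s : ℝ),
      (x : X) ∈ e.source ∧ IsSliceChart 𝒪 (frontier U) U e s ∧
      ((x : X) ∈ Sp → IsSliceChart 𝒪 Sp Pp e s ∧ e.source ∩ Sm = ∅) ∧
      ((x : X) ∈ Sm → IsSliceChart 𝒪 Sm Pm e (-s) ∧ e.source ∩ Sp = ∅) := by
    rintro ⟨x, hx⟩
    obtain ⟨e, s, hxe, hs⟩ := hb x hx
    rw [hfr] at hx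
    rcases hx with hx | hx
    · have hxm : x ∉ Sm := fun h => hdis.le_bot ⟨hx, h⟩
      obtain ⟨O, hO, hOo, hxO⟩ := eventually_nhds_iff.1
        ((hPp x hx).and (hSm.isOpen_compl.mem_nhds hxm))
      refine ⟨e.restr O, s, mem_restr_source hOo hxe hxO,
        hs.restr hs.2.1 hOo (fun q _ => Iff.rfl) (fun q hq => (hs.2.2 q hq.2).2),
        fun _ => ⟨hs.restr hs.2.1 hOo (fun q hq => ?_) fun q hq => ?_, ?_⟩, fun h => absurd h hxm⟩
      · rw [hfr, mem_union, or_iff_left (hO q hq).2]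
      · rw [← (hO q hq.1).1]
        exact (hs.2.2 q hq.2).2
      · rw [e.restr_source' O hOo]
        exact eq_empty_of_forall_notMem fun q hq => (hO q hq.1.2).2 hq.2
    · have hxp : x ∉ Sp := fun h => hdis.le_bot ⟨h, hx⟩
      obtain ⟨O, hO, hOo, hxO⟩ := eventually_nhds_iff.1
        ((hPm x hx).and (hSp.isOpen_compl.mem_nhds hxp))
      have hs' : -s = 1 ∨ -s = -1 := by
        rcases hs.2.1 with rfl | rfl
        · exact Or.inr rfl
        · exact Or.inl (neg_neg 1)
      refine ⟨e.restr O, s, mem_restr_source hOo hxe hxO,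
        hs.restr hs.2.1 hOo (fun q _ => Iff.rfl) (fun q hq => (hs.2.2 q hq.2).2),
        fun h => absurd h hxp, fun _ => ⟨hs.restr hs' hOo (fun q hq => ?_) fun q hq => ?_, ?_⟩⟩
      · rw [hfr, mem_union, or_iff_right (hO q hq).2]
      · rw [← not_iff_not, ← (hO q hq.1).1, hs.mem_closure_iff hq.2, neg_mul, neg_lt_zero, not_lt]
      · rw [e.restr_source' O hOo]
        exact eq_empty_of_forall_notMem fun q hq => (hO q hq.1.2).2 hq.2
  choose e s hxe hs hp hm using hchart
  obtain ⟨w, hw⟩ := SmoothPartitionOfUnity.exists_isSubordinate (mdl (n + 1)) isClosed_frontier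
    (fun x : frontier U => (e x).source) (fun x => (e x).open_source)
    fun x hx => mem_iUnion.2 ⟨⟨x, hx⟩, hxe ⟨x, hx⟩⟩
  have hfin := w.locallyFinite.finite_nonempty_inter_compact hK
  set I := hfin.toFinset with hI
  have hsum : ∀ y ∈ frontier U ∩ K, ∑ i ∈ I, w i y = 1 := by
    intro y hy
    rw [← w.sum_eq_one hy.1]
    refine (finsum_eq_sum_of_support_subset _ fun i hi => ?_).symm
    simpa [hI] using ⟨y, hi, hy.2⟩
  have hwc : ∀ i, ContMDiff (mdl (n + 1)) 𝓘(ℝ, ℝ) ∞ (w i) := fun i => (w i).contMDiff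
  have hSpf : Sp ⊆ frontier U := by rw [hfr]; exact subset_union_left
  have hSmf : Sm ⊆ frontier U := by rw [hfr]; exact subset_union_right
  have hcS : ∀ S ⊆ frontier U, ∀ e, 𝒪.IsPositive e →
      ContinuousOn (fun u => α.inChart e u (omitFrame 0)) (e.target ∩ e.symm ⁻¹' S) :=
    fun S hS e he => (hc e he).mono (inter_subset_inter_right _ (preimage_mono hS))
  classical
  have hnot : ∀ i : frontier U, (i : X) ∈ Sm ↔ ¬ (i : X) ∈ Sp := by
    intro i
    have h1 : (i : X) ∈ Sp ∪ Sm := hfr ▸ i.2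
    exact ⟨fun h h' => hdis.le_bot ⟨h', h⟩, fun h => h1.resolve_left h⟩
  set J : frontier U → ℝ := fun i => ∫ y in sliceDom (e i), (scaleForm (w i) α).sliceComp (e i) y
  -- Weights with index in `Sm` vanish on `Sp`, since their charts avoid `Sp`; the others therefore
  -- already sum to one there.
  have hsump : ∀ x ∈ Sp ∩ K, ∑ i ∈ I with i.1 ∈ Sp, w i x = 1 := by
    intro x hx
    rw [Finset.sum_filter, ← hsum x ⟨hSpf hx.1, hx.2⟩]
    refine Finset.sum_congr rfl fun i _ => ?_
    split_ifs with hi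
    · rfl
    · refine (image_eq_zero_of_notMem_tsupport fun h => ?_).symm
      exact (eq_empty_iff_forall_notMem.1 (hm i ((hnot i).2 hi)).2 x) ⟨hw i h, hx.1⟩
  have hsumm : ∀ x ∈ Sm ∩ K, ∑ i ∈ I with ¬ i.1 ∈ Sp, w i x = 1 := by
    intro x hx
    rw [Finset.sum_filter, ← hsum x ⟨hSmf hx.1, hx.2⟩]
    refine Finset.sum_congr rfl fun i _ => ?_
    split_ifs with hi
    · refine (image_eq_zero_of_notMem_tsupport fun h => ?_).symm
      exact (eq_empty_iff_forall_notMem.1 (hp i hi).2 x) ⟨hw i h, hx.1⟩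
    · rfl
  -- The vanishing boundary integral, sorted by the component that each chart meets.
  have htot : (∑ i ∈ I with i.1 ∈ Sp, s i * J i) +
      ∑ i ∈ I with ¬ i.1 ∈ Sp, s i * J i = 0 := by
    rw [Finset.sum_filter_add_sum_filter_not]
    obtain ⟨A⟩ := hint.1
    have h1 := A.hasSum_of_cutoffs isClosed_frontier hK (hcS _ subset_rfl) h0 I
      (fun i _ => hwc i) (fun i _ => hs i) (fun i _ => hw i) hsum
    exact h1.2.2.symm.trans (hint.2 A).2.2
  refine ⟨∑ i ∈ I with i.1 ∈ Sp, s i * J i,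
    ⟨nonempty_slicePartition hSm fun x hx => ⟨_, _, hxe ⟨x, hSmf hx⟩, (hm ⟨x, hSmf hx⟩ hx).1⟩,
      fun A => ?_⟩,
    ⟨nonempty_slicePartition hSp fun x hx => ⟨_, _, hxe ⟨x, hSpf hx⟩, (hp ⟨x, hSpf hx⟩ hx).1⟩,
      fun A => ?_⟩⟩
  · have h1 := A.hasSum_of_cutoffs hSm hK (hcS _ hSmf) (fun x hx => h0 x (hSmf hx))
      (I.filter fun i => ¬ i.1 ∈ Sp) (fun i _ => hwc i)
      (fun i hi => (hm i ((hnot i).2 (Finset.mem_filter.1 hi).2)).1) (fun i _ => hw i) hsumm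
    -- The reversed sign on `Sm` turns the vanishing of the total into equality of the two parts.
    have h2 : ∑ i ∈ I with ¬ i.1 ∈ Sp, -s i * J i = ∑ i ∈ I with i.1 ∈ Sp, s i * J i := by
      simp only [neg_mul, Finset.sum_neg_distrib]
      linarith
    rw [← h2]
    exact h1
  · exact A.hasSum_of_cutoffs hSp hK (hcS _ hSpf) (fun x hx => h0 x (hSpf hx))
      (I.filter fun i => i.1 ∈ Sp) (fun i _ => hwc i)
      (fun i hi => (hp i (Finset.mem_filter.1 hi).2).1) (fun i _ => hw i) hsump

end StokesTheorem

/-! ### The coordinate domains of the closure of `U` -/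

section Domains

/-- Since `U` is open, points with coordinates in `U` are interior, and they accumulate at every
point of the domain. This is the condition under which one-sided second derivatives are symmetric.
-/
theorem subset_closure_interior_preimage {m : ℕ} {X : Type*} [TopologicalSpace X] {U : Set X}
    (hU : IsOpen U) (e : OpenPartialHomeomorph X (Coord m)) :
    e.target ∩ e.symm ⁻¹' closure U ⊆ closure (interior (e.target ∩ e.symm ⁻¹' closure U)) := by
  rintro u ⟨hu, hx⟩
  have ho : IsOpen (e.target ∩ e.symm ⁻¹' U) := e.isOpen_inter_preimage_symm hU
  refine closure_mono (interior_maximal (inter_subset_inter_right _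
    (preimage_mono subset_closure)) ho) ?_
  rw [mem_closure_iff_frequently]
  have h1 : ∃ᶠ y in 𝓝 (e.symm u), y ∈ U := mem_closure_iff_frequently.1 hx
  rw [← e.symm.map_nhds_eq hu, Filter.frequently_map] at h1
  exact (h1.and_eventually (e.open_target.mem_nhds hu)).mono fun v hv => ⟨hv.2, hv.1⟩

variable {n : ℕ} {X : Type*} [TopologicalSpace X] [ChartedSpace (Coord (n + 1)) X]
  {𝒪 : OrientedAtlas (n + 1) X} {U : Set X}

theorem uniqueDiffOn_halfSpace {s : ℝ} (hs : s = 1 ∨ s = -1) :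
    UniqueDiffOn ℝ {w : Coord (n + 1) | s * w 0 ≤ 0} := by
  -- A convex set with an interior point; the constant vector `-s` is one because `s * (-s) = -1`.
  refine uniqueDiffOn_convex (fun x hx y hy a b ha hb _ => ?_) ⟨fun _ => -s, ?_⟩
  · simp only [mem_ofPred_eq, Pi.add_apply, Pi.smul_apply, smul_eq_mul] at *
    nlinarith
  · have ho : IsOpen {w : Coord (n + 1) | s * w 0 < 0} :=
      isOpen_lt (by fun_prop) continuous_const
    refine interior_maximal (show {w : Coord (n + 1) | s * w 0 < 0} ⊆ _ from
      fun w (hw : s * w 0 < 0) => hw.le) ho ?_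
    simp only [mem_ofPred_eq]
    rcases hs with rfl | rfl <;> norm_num

/-- Unique differentiability is local and passes through maps with surjective derivative. At a
boundary point an adapted chart turns the set into a half space, and the coordinate change carries
the property over to `e`. One-sided derivatives are thereby determined in every chart. -/
theorem uniqueDiffOn_preimage_closure (hU : IsOpen U) (hb : HasSmoothBoundary 𝒪 U)
    {e : OpenPartialHomeomorph X (Coord (n + 1))}
    (he : e ∈ IsManifold.maximalAtlas (mdl (n + 1)) ∞ X) :
    UniqueDiffOn ℝ (e.target ∩ e.symm ⁻¹' closure U) := by
  rintro u ⟨hu, hx⟩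
  by_cases hxU : e.symm u ∈ U
  · refine uniqueDiffWithinAt_of_mem_nhds (Filter.mem_of_superset
      ((e.isOpen_inter_preimage_symm hU).mem_nhds ⟨hu, hxU⟩) ?_)
    exact inter_subset_inter_right _ (preimage_mono subset_closure)
  · obtain ⟨e', s, hxe, hs⟩ := hb (e.symm u) (by rw [hU.frontier_eq]; exact ⟨hx, hxU⟩)
    have hev := eventually_mem_overlap (e := e') (e' := e) (e'.map_source hxe)
      (by rw [e'.left_inv hxe]; exact e.map_target hu)
    obtain ⟨N, hN, hNo, hxN⟩ := eventually_nhds_iff.1 hev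
    set w := e' (e.symm u) with hw
    have h1 : UniqueDiffWithinAt ℝ ({w : Coord (n + 1) | s * w 0 ≤ 0} ∩ N) w :=
      (uniqueDiffOn_halfSpace hs.2.1 w ((hs.mem_closure_iff hxe).1 hx)).inter (hNo.mem_nhds hxN)
    have h2 := (hasFDerivAt_transition hs.1.1 he (hN w hxN).1 (hN w hxN).2).hasFDerivWithinAt
      (s := {w : Coord (n + 1) | s * w 0 ≤ 0} ∩ N)
    have h3 : (transD e' e w).det ≠ 0 := det_transD_ne_zero hs.1.1 he (hN w hxN).1 (hN w hxN).2
    have h4 : DenseRange (transD e' e w) := by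
      refine Function.Surjective.denseRange ?_
      have h5 := transD_comp_inverse he hs.1.1 hu hxe
      have h5' := (LinearMap.comp_eq_id_comm ℝ (Coord (n + 1))).1
        (congrArg ContinuousLinearMap.toLinearMap h5 :
          (transD e' e w : Coord (n + 1) →ₗ[ℝ] Coord (n + 1)) ∘ₗ
            (transD e e' u : Coord (n + 1) →ₗ[ℝ] Coord (n + 1)) = LinearMap.id)
      have h6 : (transD e' e w : Coord (n + 1) →ₗ[ℝ] Coord (n + 1)) ∘ₗ
            (transD e e' u : Coord (n + 1) →ₗ[ℝ] Coord (n + 1)) = LinearMap.id :=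
        congrArg ContinuousLinearMap.toLinearMap h5
      exact fun v => ⟨transD e e' u v, congrArg (fun A : Coord (n + 1) →ₗ[ℝ] Coord (n + 1) => A v) h6⟩
    have h7 := h2.uniqueDiffWithinAt h1 h4
    have h8 : (e ∘ e'.symm) w = u := by
      simp [hw, e'.left_inv hxe, e.right_inv hu]
    rw [h8] at h7
    refine h7.mono ?_
    rintro _ ⟨v, ⟨hv, hvN⟩, rfl⟩
    obtain ⟨hv1, hv2⟩ := hN v hvN
    refine ⟨e.map_source hv2, ?_⟩
    simp only [mem_preimage, Function.comp_apply, e.left_inv hv2]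
    rw [hs.mem_closure_iff (e'.map_target hv1), e'.right_inv hv1]
    exact hv

end Domains

/-! ### Adapted charts over a given chart of the base -/

section AdaptedCharts

variable {m k : ℕ} {X : Type*} [TopologicalSpace X] [ChartedSpace (Coord m) X]
  {Y : Type*} [TopologicalSpace Y] [ChartedSpace (Coord m × Coord k) Y]
  [IsManifold (mdlTot m k) ∞ Y]
  {F : Type*} [TopologicalSpace F] [ChartedSpace (Coord k) F] [IsManifold (mdl k) ∞ F]
  {ρ : Y → X}

/-- Any smooth chart of the base is the base of an adapted chart, around any point. -/
theorem IsSmoothFiberBundle.exists_adaptedChart (hρ : IsSmoothFiberBundle m k F ρ)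
    {e : OpenPartialHomeomorph X (Coord m)} (he : e ∈ IsManifold.maximalAtlas (mdl m) ∞ X)
    {y : Y} (hy : ρ y ∈ e.source) :
    ∃ c : AdaptedChart m k ρ, c.base = e ∧ y ∈ c.tot.source := by
  obtain ⟨t, ht, ht1, ht2⟩ := hρ (ρ y)
  have hf : chartAt (Coord k) (t y).2 ∈ IsManifold.maximalAtlas (mdl k) ∞ F :=
    IsManifold.chart_mem_maximalAtlas _
  set f := chartAt (Coord k) (t y).2
  set g : OpenPartialHomeomorph (X × F) (Coord m × Coord k) := e.prod f with hg
  -- The total chart is a local trivialisation followed by `e` on the base and a chart of the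
  -- typical fibre.
  set T : OpenPartialHomeomorph Y (Coord m × Coord k) := t.toOpenPartialHomeomorph ≫ₕ g with hT
  have hTs : ∀ z ∈ T.source, z ∈ t.source ∧ t z ∈ e.source ×ˢ f.source := fun z hz => by
    simpa [hT, hg] using hz
  have hTt : ∀ w ∈ T.target, w ∈ g.target ∧ g.symm w ∈ t.target := fun z hz => by
    simpa [hT, hg] using hz
  have he1 := contMDiffOn_of_mem_maximalAtlas he
  have he2 := contMDiffOn_symm_of_mem_maximalAtlas he
  have hf1 := contMDiffOn_of_mem_maximalAtlas hf
  have hf2 := contMDiffOn_symm_of_mem_maximalAtlas hf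
  have hs : T ∈ IsManifold.maximalAtlas (mdlTot m k) ∞ Y := by
    rw [IsManifold.mem_maximalAtlas_iff_contMDiffOn]
    constructor
    · have h0 := ht1.mono fun z (hz : z ∈ T.source) => (hTs z hz).1
      exact (he1.comp (contMDiff_fst.comp_contMDiffOn h0)
        fun z hz => ((hTs z hz).2 : _ ∧ _).1).prodMk_space
        (hf1.comp (contMDiff_snd.comp_contMDiffOn h0) fun z hz => ((hTs z hz).2 : _ ∧ _).2)
    · have h0 : ContMDiffOn (mdlTot m k) ((mdl m).prod (mdl k)) ∞
          (fun w => (e.symm w.1, f.symm w.2)) T.target :=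
        (he2.comp contDiff_fst.contMDiff.contMDiffOn fun w hw => ((hTt w hw).1 : _ ∧ _).1).prodMk
          (hf2.comp contDiff_snd.contMDiff.contMDiffOn fun w hw => ((hTt w hw).1 : _ ∧ _).2)
      exact ht2.comp h0 fun w hw => (hTt w hw).2
  refine ⟨⟨e, T, he, hs, fun z hz => ?_⟩, rfl, ?_⟩
  · obtain ⟨h1, h2⟩ := hTs z hz
    have h3 : (t z).1 = ρ z := t.coe_fst h1
    exact ⟨h3 ▸ h2.1, by rw [← h3]; rfl⟩
  · have h1 : y ∈ t.source := t.mem_source.2 ht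
    have h3 : (t y).1 = ρ y := t.coe_fst h1
    simp only [hT, hg, OpenPartialHomeomorph.trans_source, OpenPartialHomeomorph.prod_source]
    exact ⟨h1, by rw [mem_preimage]; exact ⟨by erw [h3]; exact hy, mem_chart_source _ _⟩⟩

end AdaptedCharts

/-! ### Jets in adapted coordinates -/

section Jets

variable {m k : ℕ} {X : Type*} [TopologicalSpace X] [ChartedSpace (Coord m) X]
  {Y : Type*} [TopologicalSpace Y] [ChartedSpace (Coord m × Coord k) Y]
  {ρ : Y → X}

/-- The derivative of the total chart. -/
def AdaptedChart.totD (c : AdaptedChart m k ρ) (y : Y) :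
    (Coord m × Coord k) →L[ℝ] (Coord m × Coord k) :=
  mfderiv (mdlTot m k) (mdlTot m k) c.tot y

/-- The derivative of the inverse of the total chart. -/
def AdaptedChart.totSymmD (c : AdaptedChart m k ρ) (z : Coord m × Coord k) :
    (Coord m × Coord k) →L[ℝ] (Coord m × Coord k) :=
  mfderiv (mdlTot m k) (mdlTot m k) c.tot.symm z

theorem AdaptedChart.totSymmD_comp_totD (c : AdaptedChart m k ρ) {y : Y} (hy : y ∈ c.tot.source) :
    (c.totSymmD (c.tot y)).comp (c.totD y) = ContinuousLinearMap.id ℝ _ := by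
  have h1 : MDifferentiableAt (mdlTot m k) (mdlTot m k) c.tot y :=
    (contMDiffAt_of_mem_maximalAtlas c.tot_smooth hy).mdifferentiableAt (by simp)
  have h2 : MDifferentiableAt (mdlTot m k) (mdlTot m k) c.tot.symm (c.tot y) :=
    (contMDiffAt_symm_of_mem_maximalAtlas c.tot_smooth (c.tot.map_source hy)).mdifferentiableAt
      (by simp)
  have h3 := mfderiv_comp y h2 h1
  have h4 : mfderiv (mdlTot m k) (mdlTot m k) (c.tot.symm ∘ c.tot) y =
      mfderiv (mdlTot m k) (mdlTot m k) (id : Y → Y) y := by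
    refine Filter.EventuallyEq.mfderiv_eq ?_
    filter_upwards [c.tot.open_source.mem_nhds hy] with v hv
    exact c.tot.left_inv hv
  rw [mfderiv_id] at h4
  exact h3.symm.trans h4

open Classical in
/-- The density at the point `y`, as a function of all linear maps. -/
def LagrangianDensity.onLin (𝓛 : LagrangianDensity m k ρ) (y : Y)
    (A : Coord m →L[ℝ] Coord m × Coord k) : Coord m [⋀^Fin m]→L[ℝ] ℝ :=
  if h : ∀ ξ : Coord m, (mfderiv (mdlTot m k) (mdl m) ρ y : Coord m × Coord k →L[ℝ] Coord m)
    (A ξ) = ξ then 𝓛 ⟨y, A, h⟩ else 0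

/-- The linear map with coordinates `j`, as a map of coordinate spaces. -/
def AdaptedChart.linCoord (c : AdaptedChart m k ρ) (j : JetCoord m k) :
    Coord m →L[ℝ] Coord m × Coord k :=
  ((c.totSymmD (j.1, j.2.1)).comp ((ContinuousLinearMap.id ℝ (Coord m)).prod j.2.2)).comp
    (chartD c.base (ρ (c.tot.symm (j.1, j.2.1))))

/-- A jet contains a proof that depends on its point and its linear map. In `onLin` that proof is
hidden, so the two can be rewritten separately. -/
theorem AdaptedChart.lagrangian_eq (c : AdaptedChart m k ρ) (𝓛 : LagrangianDensity m k ρ)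
    (j : JetCoord m k) : c.lagrangian 𝓛 j =
      𝓛.onLin (c.tot.symm (j.1, j.2.1)) (c.linCoord j)
        fun μ => symmD c.base j.1 (stdFrame m μ) := by
  by_cases h : ∀ ξ, mfderiv (mdlTot m k) (mdl m) ρ (c.tot.symm (j.1, j.2.1)) (c.jetLin j ξ) = ξ
  · have h1 : c.lagrangian 𝓛 j = _ := dif_pos h
    have h2 : 𝓛.onLin (c.tot.symm (j.1, j.2.1)) (c.linCoord j) = _ := dif_pos h
    rw [h1, h2]
    rfl
  · have h1 : c.lagrangian 𝓛 j = _ := dif_neg h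
    have h2 : 𝓛.onLin (c.tot.symm (j.1, j.2.1)) (c.linCoord j) = _ := dif_neg h
    rw [h1, h2]
    rfl

/-- The derivative of a field on the closure of `U`, as a map of coordinate spaces. -/
def fieldD (m k : ℕ) {X : Type*} [TopologicalSpace X] [ChartedSpace (Coord m) X]
    {Y : Type*} [TopologicalSpace Y] [ChartedSpace (Coord m × Coord k) Y]
    (U : Set X) (φ : X → Y) (x : X) : Coord m →L[ℝ] Coord m × Coord k :=
  mfderivWithin (mdl m) (mdlTot m k) φ (closure U) x

variable {U : Set X} {φ : X → Y} {u : Coord m}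

theorem AdaptedChart.mem_dom (c : AdaptedChart m k ρ) {x : X} (hx : x ∈ c.base.source)
    (hxU : x ∈ closure U) : c.base x ∈ c.dom U :=
  ⟨c.base.map_source hx, by rwa [mem_preimage, c.base.left_inv hx]⟩

theorem AdaptedChart.tot_symm_field (c : AdaptedChart m k ρ) (hφ : ∀ x ∈ closure U, ρ (φ x) = x)
    (hu : u ∈ c.dom U) (hs : φ (c.base.symm u) ∈ c.tot.source) :
    c.tot (φ (c.base.symm u)) = (u, c.field φ u) := by
  refine Prod.ext ?_ rfl
  rw [(c.adapted _ hs).2, hφ _ hu.2, c.base.right_inv hu.1]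

theorem AdaptedChart.continuousWithinAt_comp_symm (c : AdaptedChart m k ρ)
    (hφ : ContinuousWithinAt φ (closure U) (c.base.symm u)) (hu : u ∈ c.dom U) :
    ContinuousWithinAt (fun v => φ (c.base.symm v)) (c.dom U) u :=
  ContinuousWithinAt.comp (f := c.base.symm) (t := closure U) hφ
    (c.base.continuousAt_symm hu.1).continuousWithinAt fun _ hv => hv.2

theorem AdaptedChart.eventually_mem_source (c : AdaptedChart m k ρ)
    (hφ : ContinuousWithinAt φ (closure U) (c.base.symm u)) (hu : u ∈ c.dom U)
    (hs : φ (c.base.symm u) ∈ c.tot.source) :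
    ∀ᶠ v in 𝓝[c.dom U] u, φ (c.base.symm v) ∈ c.tot.source :=
  (c.continuousWithinAt_comp_symm hφ hu).preimage_mem_nhdsWithin (c.tot.open_source.mem_nhds hs)

theorem AdaptedChart.hasFDerivWithinAt_tot (c : AdaptedChart m k ρ)
    (hφ : MDifferentiableWithinAt (mdl m) (mdlTot m k) φ (closure U) (c.base.symm u))
    (hu : u ∈ c.dom U) (hs : φ (c.base.symm u) ∈ c.tot.source) :
    HasFDerivWithinAt (fun v => c.tot (φ (c.base.symm v)))
      ((c.totD (φ (c.base.symm u))).comp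
        ((fieldD m k U φ (c.base.symm u)).comp (symmD c.base u))) (c.dom U) u := by
  have h1 : HasMFDerivAt (mdlTot m k) (mdlTot m k) c.tot (φ (c.base.symm u)) _ :=
    ((contMDiffAt_of_mem_maximalAtlas c.tot_smooth hs).mdifferentiableAt (by simp)).hasMFDerivAt
  have h2 : HasMFDerivAt (mdl m) (mdl m) c.base.symm u _ :=
    ((contMDiffAt_chart_symm c.base_smooth hu.1).mdifferentiableAt (by simp)).hasMFDerivAt
  have h3 := HasMFDerivWithinAt.comp u hφ.hasMFDerivWithinAt (h2.hasMFDerivWithinAt (s := c.dom U))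
    fun _ hv => hv.2
  exact (HasMFDerivAt.comp_hasMFDerivWithinAt u h1 h3).hasFDerivWithinAt

theorem AdaptedChart.hasFDerivWithinAt_field (c : AdaptedChart m k ρ)
    (hφ : MDifferentiableWithinAt (mdl m) (mdlTot m k) φ (closure U) (c.base.symm u))
    (hu : u ∈ c.dom U) (hs : φ (c.base.symm u) ∈ c.tot.source) :
    HasFDerivWithinAt (c.field φ)
      ((ContinuousLinearMap.snd ℝ (Coord m) (Coord k)).comp ((c.totD (φ (c.base.symm u))).comp
        ((fieldD m k U φ (c.base.symm u)).comp (symmD c.base u)))) (c.dom U) u :=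
  (hasFDerivAt_snd (p := c.tot (φ (c.base.symm u)))).comp_hasFDerivWithinAt u
    (c.hasFDerivWithinAt_tot hφ hu hs)

/-- Near `u` the map `v ↦ (v, φ^a(v))` is the field read in the total chart; the derivative is
computed once in each form, and unique differentiability identifies the results. -/
theorem AdaptedChart.id_prod_fderivWithin_field (c : AdaptedChart m k ρ)
    (hφ : MDifferentiableWithinAt (mdl m) (mdlTot m k) φ (closure U) (c.base.symm u))
    (hφ' : ∀ x ∈ closure U, ρ (φ x) = x) (hD : UniqueDiffOn ℝ (c.dom U))
    (hu : u ∈ c.dom U) (hs : φ (c.base.symm u) ∈ c.tot.source) :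
    (ContinuousLinearMap.id ℝ (Coord m)).prod (fderivWithin ℝ (c.field φ) (c.dom U) u) =
      (c.totD (φ (c.base.symm u))).comp
        ((fieldD m k U φ (c.base.symm u)).comp (symmD c.base u)) := by
  have h1 : HasFDerivWithinAt (fun v => (v, c.field φ v))
      ((ContinuousLinearMap.id ℝ (Coord m)).prod (fderivWithin ℝ (c.field φ) (c.dom U) u))
      (c.dom U) u :=
    (hasFDerivWithinAt_id u _).prodMk
      (c.hasFDerivWithinAt_field hφ hu hs).differentiableWithinAt.hasFDerivWithinAt
  refine (hD u hu).eq h1 ((c.hasFDerivWithinAt_tot hφ hu hs).congr_of_eventuallyEq ?_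
    (c.tot_symm_field hφ' hu hs).symm)
  filter_upwards [c.eventually_mem_source hφ.continuousWithinAt hu hs, self_mem_nhdsWithin]
    with v hv hvD
  exact (c.tot_symm_field hφ' hvD hv).symm

/-- The linear map given by the jet of a field is the derivative of the field. -/
theorem AdaptedChart.linCoord_jet (c : AdaptedChart m k ρ)
    (hφ : MDifferentiableWithinAt (mdl m) (mdlTot m k) φ (closure U) (c.base.symm u))
    (hφ' : ∀ x ∈ closure U, ρ (φ x) = x) (hD : UniqueDiffOn ℝ (c.dom U))
    (hu : u ∈ c.dom U) (hs : φ (c.base.symm u) ∈ c.tot.source) :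
    c.linCoord (c.jet U φ u) = fieldD m k U φ (c.base.symm u) := by
  have h1 := c.tot_symm_field hφ' hu hs
  have h2 : c.tot.symm (u, c.field φ u) = φ (c.base.symm u) := by
    rw [← h1, c.tot.left_inv hs]
  have h3 : c.linCoord (c.jet U φ u) = ((c.totSymmD (u, c.field φ u)).comp
      ((ContinuousLinearMap.id ℝ (Coord m)).prod (fderivWithin ℝ (c.field φ) (c.dom U) u))).comp
      (chartD c.base (ρ (c.tot.symm (u, c.field φ u)))) := rfl
  rw [h3, c.id_prod_fderivWithin_field hφ hφ' hD hu hs, h2, hφ' _ hu.2, ← h1,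
    ← ContinuousLinearMap.comp_assoc, c.totSymmD_comp_totD hs, ContinuousLinearMap.id_comp,
    ContinuousLinearMap.comp_assoc]
  have h4 := symmD_comp_chartD c.base_smooth (c.base.map_target hu.1)
  rw [c.base.right_inv hu.1] at h4
  rw [h4, ContinuousLinearMap.comp_id]

/-- The Lagrangian density of a field in coordinates. -/
theorem lagrangianForm_inChart (𝓛 : LagrangianDensity m k ρ) (c : AdaptedChart m k ρ)
    (hφ : MDifferentiableWithinAt (mdl m) (mdlTot m k) φ (closure U) (c.base.symm u))
    (hφ' : ∀ x ∈ closure U, ρ (φ x) = x) (hD : UniqueDiffOn ℝ (c.dom U))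
    (hu : u ∈ c.dom U) (hs : φ (c.base.symm u) ∈ c.tot.source) :
    (lagrangianForm 𝓛 U φ).inChart c.base u (stdFrame m) = c.lagrangian 𝓛 (c.jet U φ u) := by
  have h1 := c.tot_symm_field hφ' hu hs
  have h2 : c.tot.symm (u, c.field φ u) = φ (c.base.symm u) := by
    rw [← h1, c.tot.left_inv hs]
  rw [c.lagrangian_eq, c.linCoord_jet hφ hφ' hD hu hs, DForm.inChart_eq]
  change _ = 𝓛.onLin (c.tot.symm (u, c.field φ u)) _ fun μ => symmD c.base u (stdFrame m μ)
  rw [h2]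
  rfl

end Jets

/-! ### Change of adapted charts -/

section JetTransition

variable {m k : ℕ} {X : Type*} [TopologicalSpace X] [ChartedSpace (Coord m) X]
  {Y : Type*} [TopologicalSpace Y] [ChartedSpace (Coord m × Coord k) Y]
  {ρ : Y → X} (c c' : AdaptedChart m k ρ) {z : Coord m × Coord k} {j : JetCoord m k}

/-- The tangent vector to the fibre of `J¹Y → Y` with components `ℓ ⊗ w`. -/
def vel (ℓ : Coord m →L[ℝ] ℝ) (w : Coord k) : JetCoord m k := (0, 0, ℓ.smulRight w)

/-- The points in the domain of `c`, in coordinates, that lie in the domain of `c'`. -/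
def AdaptedChart.overlap : Set (Coord m × Coord k) := c.tot.target ∩ c.tot.symm ⁻¹' c'.tot.source

/-- The fibre part of the coordinate change. -/
def AdaptedChart.fibTrans (z : Coord m × Coord k) : Coord k := (c'.tot (c.tot.symm z)).2

/-- The coordinate change of jets. -/
def AdaptedChart.jetTrans (j : JetCoord m k) : JetCoord m k :=
  (c'.base (c.base.symm j.1), c.fibTrans c' (j.1, j.2.1),
    ((fderiv ℝ (c.fibTrans c') (j.1, j.2.1)).comp
      ((ContinuousLinearMap.id ℝ (Coord m)).prod j.2.2)).comp
        (transD c'.base c.base (c'.base (c.base.symm j.1))))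

/-- The derivative of the coordinate change of jets on vertical vectors. -/
def AdaptedChart.vertTrans (j J : JetCoord m k) : JetCoord m k :=
  (0, fderiv ℝ (c.fibTrans c') (j.1, j.2.1) (0, J.2.1),
    ((fderiv ℝ (fderiv ℝ (c.fibTrans c')) (j.1, j.2.1) (0, J.2.1)).comp
      ((ContinuousLinearMap.id ℝ (Coord m)).prod j.2.2) +
      (fderiv ℝ (c.fibTrans c') (j.1, j.2.1)).comp
        ((ContinuousLinearMap.inr ℝ (Coord m) (Coord k)).comp J.2.2)).comp
        (transD c'.base c.base (c'.base (c.base.symm j.1))))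

theorem AdaptedChart.isOpen_overlap : IsOpen (c.overlap c') :=
  c.tot.isOpen_inter_preimage_symm c'.tot.open_source

variable {c c'}

theorem AdaptedChart.base_point (hz : z ∈ c.tot.target) :
    ρ (c.tot.symm z) ∈ c.base.source ∧ c.base (ρ (c.tot.symm z)) = z.1 ∧ z.1 ∈ c.base.target ∧
      c.base.symm z.1 = ρ (c.tot.symm z) := by
  obtain ⟨h1, h2⟩ := c.adapted _ (c.tot.map_target hz)
  rw [c.tot.right_inv hz] at h2
  exact ⟨h1, h2.symm, h2 ▸ c.base.map_source h1, by rw [h2, c.base.left_inv h1]⟩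

theorem AdaptedChart.tot_symm_eq (hz : z ∈ c.overlap c') :
    c'.tot (c.tot.symm z) = (c'.base (c.base.symm z.1), c.fibTrans c' z) := by
  refine Prod.ext ?_ rfl
  rw [(c'.adapted _ hz.2).2, (base_point hz.1).2.2.2]

theorem AdaptedChart.contDiffAt_totTrans (hz : z ∈ c.overlap c') :
    ContDiffAt ℝ ∞ (c'.tot ∘ c.tot.symm) z :=
  ((contMDiffAt_of_mem_maximalAtlas c'.tot_smooth hz.2).comp z
    (contMDiffAt_symm_of_mem_maximalAtlas c.tot_smooth hz.1)).contDiffAt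

theorem AdaptedChart.contDiffAt_fibTrans (hz : z ∈ c.overlap c') :
    ContDiffAt ℝ ∞ (c.fibTrans c') z := (contDiffAt_totTrans hz).snd

theorem AdaptedChart.base_overlap (hz : z ∈ c.overlap c') :
    z.1 ∈ c.base.target ∧ c.base.symm z.1 ∈ c'.base.source := by
  obtain ⟨h1, h2, h3, h4⟩ := base_point hz.1
  exact ⟨h3, h4 ▸ (c'.adapted _ hz.2).1⟩

theorem AdaptedChart.hasFDerivAt_totTrans (hz : z ∈ c.overlap c') :
    HasFDerivAt (c'.tot ∘ c.tot.symm) ((c'.totD (c.tot.symm z)).comp (c.totSymmD z)) z := by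
  have h1 : HasMFDerivAt (mdlTot m k) (mdlTot m k) c'.tot (c.tot.symm z) _ :=
    ((contMDiffAt_of_mem_maximalAtlas c'.tot_smooth hz.2).mdifferentiableAt (by simp)).hasMFDerivAt
  have h2 : HasMFDerivAt (mdlTot m k) (mdlTot m k) c.tot.symm z _ :=
    ((contMDiffAt_symm_of_mem_maximalAtlas c.tot_smooth hz.1).mdifferentiableAt
      (by simp)).hasMFDerivAt
  exact (HasMFDerivAt.comp z h1 h2).hasFDerivAt

/-- The change of total coordinates covers that of the base, so its base component does not see the
fibre coordinates. -/
theorem AdaptedChart.totD_comp_totSymmD_eq (hz : z ∈ c.overlap c') :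
    (c'.totD (c.tot.symm z)).comp (c.totSymmD z) =
      ((transD c.base c'.base z.1).comp (ContinuousLinearMap.fst ℝ _ _)).prod
        (fderiv ℝ (c.fibTrans c') z) := by
  refine (hasFDerivAt_totTrans hz).unique ?_
  have h1 : HasFDerivAt (fun w : Coord m × Coord k => (c'.base ∘ c.base.symm) w.1)
      ((transD c.base c'.base z.1).comp (ContinuousLinearMap.fst ℝ _ _)) z :=
    (hasFDerivAt_transition c.base_smooth c'.base_smooth (base_overlap hz).1
      (base_overlap hz).2).comp z hasFDerivAt_fst
  have h2 := h1.prodMk ((contDiffAt_fibTrans hz).differentiableAt (by simp)).hasFDerivAt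
  refine h2.congr_of_eventuallyEq ?_
  filter_upwards [(c.isOpen_overlap c').mem_nhds hz] with w hw
  exact tot_symm_eq hw

theorem AdaptedChart.transD_comp_transD (hz : z ∈ c.overlap c') :
    (transD c.base c'.base z.1).comp (transD c'.base c.base (c'.base (c.base.symm z.1))) =
      ContinuousLinearMap.id ℝ (Coord m) := by
  obtain ⟨h1, h2⟩ := base_overlap hz
  have h := transD_comp_inverse (u := c'.base (c.base.symm z.1)) c'.base_smooth c.base_smooth
    (c'.base.map_source h2) (by rw [c'.base.left_inv h2]; exact c.base.map_target h1)
  rwa [c'.base.left_inv h2, c.base.right_inv h1] at h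

/-- This is why `jetTrans` has its form: by the chain rule the derivative of the total coordinate
change and the inverse base change reproduce the same linear map of tangent spaces. -/
theorem AdaptedChart.linCoord_jetTrans (hj : (j.1, j.2.1) ∈ c.overlap c') :
    c'.linCoord (c.jetTrans c' j) = c.linCoord j := by
  have hG := tot_symm_eq hj
  have h0 : c'.tot.symm (c'.base (c.base.symm j.1), c.fibTrans c' (j.1, j.2.1)) =
      c.tot.symm (j.1, j.2.1) := by
    rw [← c'.tot.left_inv hj.2, hG]
  obtain ⟨h1, h2, h3, h4⟩ := base_point hj.1
  obtain ⟨h5, h6⟩ := base_overlap hj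
  set B := transD c'.base c.base (c'.base (c.base.symm j.1)) with hB
  have hv : (ContinuousLinearMap.id ℝ (Coord m)).prod (c.jetTrans c' j).2.2 =
      (((c'.totD (c.tot.symm (j.1, j.2.1))).comp (c.totSymmD (j.1, j.2.1))).comp
        ((ContinuousLinearMap.id ℝ (Coord m)).prod j.2.2)).comp B := by
    rw [totD_comp_totSymmD_eq hj]
    ext1 v
    refine Prod.ext ?_ rfl
    exact (congrArg (fun A : Coord m →L[ℝ] Coord m => A v) (transD_comp_transD hj)).symm
  have hl : c'.linCoord (c.jetTrans c' j) =
      ((c'.totSymmD (c'.base (c.base.symm j.1), c.fibTrans c' (j.1, j.2.1))).comp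
        ((ContinuousLinearMap.id ℝ (Coord m)).prod (c.jetTrans c' j).2.2)).comp
        (chartD c'.base (ρ (c'.tot.symm (c'.base (c.base.symm j.1),
          c.fibTrans c' (j.1, j.2.1))))) := rfl
  have hc := chartD_eq_comp c'.base_smooth c.base_smooth (x := c.base.symm j.1) h6
    (c.base.map_target h5)
  have hs := c'.totSymmD_comp_totD hj.2
  rw [hl, hv, h0, ← h4, ← hG]
  rw [AdaptedChart.linCoord, ← h4, hc, ← hB]
  simp only [← ContinuousLinearMap.comp_assoc]
  rw [hs, ContinuousLinearMap.id_comp]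

/-- The jet is the same in both charts, and only the frame on which the density is evaluated
changes. All later transformation laws are derivatives of this identity. -/
theorem AdaptedChart.lagrangian_jetTrans (𝓛 : LagrangianDensity m k ρ)
    (hj : (j.1, j.2.1) ∈ c.overlap c') :
    c.lagrangian 𝓛 j = (transD c.base c'.base j.1).det * c'.lagrangian 𝓛 (c.jetTrans c' j) := by
  have hG := tot_symm_eq hj
  have h0 : c'.tot.symm (c'.base (c.base.symm j.1), c.fibTrans c' (j.1, j.2.1)) =
      c.tot.symm (j.1, j.2.1) := by
    rw [← c'.tot.left_inv hj.2, hG]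
  obtain ⟨h5, h6⟩ := base_overlap hj
  rw [c.lagrangian_eq, c'.lagrangian_eq, linCoord_jetTrans hj]
  change _ = _ * 𝓛.onLin (c'.tot.symm (c'.base (c.base.symm j.1), c.fibTrans c' (j.1, j.2.1))) _
    fun μ => symmD c'.base (c'.base (c.base.symm j.1)) (stdFrame m μ)
  rw [h0, symmD_eq_comp c.base_smooth c'.base_smooth h5 h6]
  exact alternating_comp_stdFrame ((𝓛.onLin (c.tot.symm (j.1, j.2.1))
    (c.linCoord j)).compContinuousLinearMap (symmD c'.base (c'.base (c.base.symm j.1)))) _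

/-- With the base point fixed, the inverse base change is constant along the curve. The velocity
part is a product of two varying factors, and the first one contributes the second derivative of the
fibre transition to `vertTrans`. -/
theorem AdaptedChart.hasDerivAt_jetTrans {γ : ℝ → JetCoord m k} {J : JetCoord m k} {t : ℝ}
    (hγ : HasDerivAt γ J t) (h1 : ∀ᶠ τ in 𝓝 t, (γ τ).1 = (γ t).1)
    (hj : ((γ t).1, (γ t).2.1) ∈ c.overlap c') :
    HasDerivAt (fun τ => c.jetTrans c' (γ τ)) (c.vertTrans c' (γ t) J) t := by
  set x := (γ t).1 with hx
  have hy : HasDerivAt (fun τ => (γ τ).2.1) J.2.1 t := hγ.snd.fst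
  have hv : HasDerivAt (fun τ => (γ τ).2.2) J.2.2 t := hγ.snd.snd
  have hxy : HasDerivAt (fun τ => (x, (γ τ).2.1)) ((0 : Coord m), J.2.1) t :=
    (hasDerivAt_const t x).prodMk hy
  have hsm := contDiffAt_fibTrans hj
  have hh : HasDerivAt (fun τ => c.fibTrans c' (x, (γ τ).2.1))
      (fderiv ℝ (c.fibTrans c') (x, (γ t).2.1) (0, J.2.1)) t :=
    HasFDerivAt.comp_hasDerivAt (l := c.fibTrans c') t (hsm.differentiableAt (by simp)).hasFDerivAt hxy
  have hsm' : ContDiffAt ℝ ∞ (fderiv ℝ (c.fibTrans c')) (x, (γ t).2.1) :=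
    hsm.fderiv_right (by simp)
  have hh' : HasDerivAt (fun τ => fderiv ℝ (c.fibTrans c') (x, (γ τ).2.1))
      (fderiv ℝ (fderiv ℝ (c.fibTrans c')) (x, (γ t).2.1) (0, J.2.1)) t :=
    HasFDerivAt.comp_hasDerivAt t (hsm'.differentiableAt (by simp)).hasFDerivAt hxy
  have hp : HasDerivAt (fun τ => (ContinuousLinearMap.id ℝ (Coord m)).prod (γ τ).2.2)
      ((ContinuousLinearMap.inr ℝ (Coord m) (Coord k)).comp J.2.2) t := by
    have h2 := (((ContinuousLinearMap.compL ℝ (Coord m) (Coord k) (Coord m × Coord k)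
      (ContinuousLinearMap.inr ℝ (Coord m) (Coord k))).hasFDerivAt.comp_hasDerivAt t hv).const_add
      (ContinuousLinearMap.inl ℝ (Coord m) (Coord k)))
    refine h2.congr_of_eventuallyEq (Filter.Eventually.of_forall fun τ => ?_)
    ext1 v
    simp
  have hc := (hh'.clm_comp hp).clm_comp
    (hasDerivAt_const t (transD c'.base c.base (c'.base (c.base.symm x))))
  rw [ContinuousLinearMap.comp_zero, add_zero] at hc
  have := (hasDerivAt_const t (c'.base (c.base.symm x))).prodMk (hh.prodMk hc)
  refine this.congr_of_eventuallyEq ?_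
  filter_upwards [h1] with τ hτ
  simp only [jetTrans, hτ]

theorem AdaptedChart.isOpen_jetDomain (c : AdaptedChart m k ρ) :
    IsOpen {j : JetCoord m k | (j.1, j.2.1) ∈ c.tot.target} :=
  c.tot.open_target.preimage (by fun_prop)

theorem LagrangianDensity.IsSmooth.contDiffAt {𝓛 : LagrangianDensity m k ρ} (h : 𝓛.IsSmooth)
    (hj : (j.1, j.2.1) ∈ c.tot.target) : ContDiffAt ℝ ∞ (c.lagrangian 𝓛) j :=
  (h c).contDiffAt (c.isOpen_jetDomain.mem_nhds hj)

theorem LagrangianDensity.IsSmooth.contDiffAt_fderiv {𝓛 : LagrangianDensity m k ρ}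
    (h : 𝓛.IsSmooth) (hj : (j.1, j.2.1) ∈ c.tot.target) :
    ContDiffAt ℝ ∞ (fderiv ℝ (c.lagrangian 𝓛)) j :=
  (h.contDiffAt hj).fderiv_right (by simp)

theorem hasDerivAt_line (j J : JetCoord m k) : HasDerivAt (fun τ : ℝ => j + τ • J) J 0 := by
  simpa using ((hasDerivAt_id (0 : ℝ)).smul_const J).const_add j

theorem AdaptedChart.jetTrans_mem (hj : (j.1, j.2.1) ∈ c.overlap c') :
    ((c.jetTrans c' j).1, (c.jetTrans c' j).2.1) ∈ c'.tot.target := by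
  change (c'.base (c.base.symm j.1), c.fibTrans c' (j.1, j.2.1)) ∈ _
  have h := tot_symm_eq hj
  exact h ▸ c'.tot.map_source hj.2

/-- The derivative of `lagrangian_jetTrans` in a pure velocity direction. The base transition inside
`ℓ` cancels against its inverse in `jetTrans`; the momenta thus transform as a vector density. -/
theorem AdaptedChart.fderiv_lagrangian_vel {𝓛 : LagrangianDensity m k ρ} (h : 𝓛.IsSmooth)
    (hj : (j.1, j.2.1) ∈ c.overlap c') (ℓ : Coord m →L[ℝ] ℝ) (w : Coord k) :
    fderiv ℝ (c.lagrangian 𝓛) j (vel (ℓ.comp (transD c.base c'.base j.1)) w) =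
      (transD c.base c'.base j.1).det * fderiv ℝ (c'.lagrangian 𝓛) (c.jetTrans c' j)
        (vel ℓ (fderiv ℝ (c.fibTrans c') (j.1, j.2.1) (0, w))) := by
  set J : JetCoord m k := vel (ℓ.comp (transD c.base c'.base j.1)) w with hJ
  have hl := hasDerivAt_line j J
  have h00 : j + (0 : ℝ) • J = j := by simp
  have h1 : ∀ τ : ℝ, (j + τ • J).1 = j.1 := fun τ => by simp [hJ, vel]
  have h2 : ∀ τ : ℝ, (j + τ • J).2.1 = j.2.1 := fun τ => by simp [hJ, vel]
  have hT := hasDerivAt_jetTrans (c := c) (c' := c') hl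
    (Filter.Eventually.of_forall fun τ => (h1 τ).trans (h1 0).symm) (by rwa [h00])
  rw [h00] at hT
  have hvt : c.vertTrans c' j J = vel ℓ (fderiv ℝ (c.fibTrans c') (j.1, j.2.1) (0, w)) := by
    refine Prod.ext rfl (Prod.ext ?_ ?_)
    · change fderiv ℝ (c.fibTrans c') (j.1, j.2.1) (0, 0) = 0
      exact map_zero _
    · refine ContinuousLinearMap.ext fun v => ?_
      have h3 : transD c.base c'.base j.1 (transD c'.base c.base (c'.base (c.base.symm j.1)) v) =
        v := congrArg (fun A : Coord m →L[ℝ] Coord m => A v) (transD_comp_transD hj)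
      set y := transD c'.base c.base (c'.base (c.base.symm j.1)) v
      change fderiv ℝ (fderiv ℝ (c.fibTrans c')) (j.1, j.2.1) (0, 0) (y, j.2.2 y) +
        fderiv ℝ (c.fibTrans c') (j.1, j.2.1) (0, ℓ (transD c.base c'.base j.1 y) • w) =
        ℓ v • fderiv ℝ (c.fibTrans c') (j.1, j.2.1) (0, w)
      rw [h3, ← map_smul, Prod.smul_mk, smul_zero, Prod.mk_zero_zero, map_zero,
        zero_apply, zero_add]
  have hL := HasFDerivAt.comp_hasDerivAt_of_eq (0 : ℝ)
    ((h.contDiffAt hj.1).differentiableAt (by simp)).hasFDerivAt hl h00.symm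
  have hL' := HasFDerivAt.comp_hasDerivAt_of_eq (0 : ℝ)
    ((h.contDiffAt (jetTrans_mem hj)).differentiableAt (by simp)).hasFDerivAt hT (by rw [h00])
  rw [hvt] at hL'
  refine hL.unique ((hL'.const_mul _).congr_of_eventuallyEq (Filter.Eventually.of_forall
    fun τ => ?_))
  have h4 := lagrangian_jetTrans (c := c) (c' := c') 𝓛 (j := j + τ • J)
    (by rw [h1, h2]; exact hj)
  rw [h1] at h4
  exact h4

theorem hasDerivAt_vel (ℓ : Coord m →L[ℝ] ℝ) {g : ℝ → Coord k} {g' : Coord k} {t : ℝ}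
    (hg : HasDerivAt g g' t) : HasDerivAt (fun τ => vel (m := m) ℓ (g τ)) (vel ℓ g') t := by
  have h1 := ((ContinuousLinearMap.smulRightL ℝ (Coord m) (Coord k)) ℓ).hasFDerivAt.comp_hasDerivAt
    t hg
  exact (hasDerivAt_const t (0 : Coord m)).prodMk ((hasDerivAt_const t (0 : Coord k)).prodMk h1)

/-- The law of the momenta is differentiated once more, in a vertical direction `J`. The fibre
transition applied to `w` varies too and gives the additional term. That term is symmetric in
`J.2.1` and `w`, and so disappears from the multisymplectic flux. -/
theorem AdaptedChart.fderiv_fderiv_lagrangian_vel {𝓛 : LagrangianDensity m k ρ} (h : 𝓛.IsSmooth)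
    (hj : (j.1, j.2.1) ∈ c.overlap c') (ℓ : Coord m →L[ℝ] ℝ) (w : Coord k) {J : JetCoord m k}
    (hJ : J.1 = 0) :
    fderiv ℝ (fderiv ℝ (c.lagrangian 𝓛)) j J (vel (ℓ.comp (transD c.base c'.base j.1)) w) =
      (transD c.base c'.base j.1).det *
        (fderiv ℝ (fderiv ℝ (c'.lagrangian 𝓛)) (c.jetTrans c' j) (c.vertTrans c' j J)
          (vel ℓ (fderiv ℝ (c.fibTrans c') (j.1, j.2.1) (0, w))) +
        fderiv ℝ (c'.lagrangian 𝓛) (c.jetTrans c' j) (vel ℓ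
          (fderiv ℝ (fderiv ℝ (c.fibTrans c')) (j.1, j.2.1) (0, J.2.1) (0, w)))) := by
  have hl := hasDerivAt_line j J
  have h00 : j + (0 : ℝ) • J = j := by simp
  have h1 : ∀ τ : ℝ, (j + τ • J).1 = j.1 := fun τ => by simp [hJ]
  have hT := hasDerivAt_jetTrans (c := c) (c' := c') hl
    (Filter.Eventually.of_forall fun τ => (h1 τ).trans (h1 0).symm) (by rwa [h00])
  rw [h00] at hT
  have hL := (HasFDerivAt.comp_hasDerivAt_of_eq (0 : ℝ)
    ((h.contDiffAt_fderiv hj.1).differentiableAt (by simp)).hasFDerivAt hl h00.symm).clm_apply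
    (hasDerivAt_const (0 : ℝ) (vel (ℓ.comp (transD c.base c'.base j.1)) w))
  have hL' := HasFDerivAt.comp_hasDerivAt_of_eq (0 : ℝ)
    ((h.contDiffAt_fderiv (jetTrans_mem hj)).differentiableAt (by simp)).hasFDerivAt hT
    (by rw [h00])
  have hxy : HasDerivAt (fun τ : ℝ => (j.1, (j + τ • J).2.1)) ((0 : Coord m), J.2.1) 0 :=
    (hasDerivAt_const (0 : ℝ) j.1).prodMk hl.snd.fst
  have hsm' : ContDiffAt ℝ ∞ (fderiv ℝ (c.fibTrans c')) (j.1, j.2.1) :=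
    (contDiffAt_fibTrans hj).fderiv_right (by simp)
  have hh' := (HasFDerivAt.comp_hasDerivAt_of_eq (l := fderiv ℝ (c.fibTrans c')) (0 : ℝ)
    (hsm'.differentiableAt (by simp)).hasFDerivAt hxy (by rw [h00])).clm_apply
    (hasDerivAt_const (0 : ℝ) ((0 : Coord m), w))
  have hR := (hL'.clm_apply (hasDerivAt_vel ℓ hh')).const_mul (transD c.base c'.base j.1).det
  simp only [Function.comp_apply, h00, map_zero, add_zero] at hL hR
  have hU := hL.unique (hR.congr_of_eventuallyEq ?_)
  · exact hU
  · have hopen : ∀ᶠ τ in 𝓝 (0 : ℝ), (j.1, (j + τ • J).2.1) ∈ c.overlap c' :=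
      hxy.continuousAt.preimage_mem_nhds ((c.isOpen_overlap c').mem_nhds (by rwa [h00]))
    filter_upwards [hopen] with τ hτ
    have h4 := fderiv_lagrangian_vel (c := c) (c' := c') h (j := j + τ • J)
      (by rw [h1]; exact hτ) ℓ w
    rw [h1] at h4
    exact h4

/-- The components of `(j¹φ)^* i_{j¹V} Θ_L`. -/
def AdaptedChart.thetaFlux (c : AdaptedChart m k ρ) (𝓛 : LagrangianDensity m k ρ)
    (j : JetCoord m k) (w : Coord k) : Coord m :=
  fun μ => fderiv ℝ (c.lagrangian 𝓛) j (vel (ContinuousLinearMap.proj μ) w)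

/-- The components of `(j¹φ)^* i_{j¹W} i_{j¹V} Ω_L`. -/
def AdaptedChart.omegaFlux (c : AdaptedChart m k ρ) (𝓛 : LagrangianDensity m k ρ)
    (j J J' : JetCoord m k) : Coord m :=
  fun μ => fderiv ℝ (fderiv ℝ (c.lagrangian 𝓛)) j J' (vel (ContinuousLinearMap.proj μ) J.2.1) -
    fderiv ℝ (fderiv ℝ (c.lagrangian 𝓛)) j J (vel (ContinuousLinearMap.proj μ) J'.2.1)

theorem apply_vel_comp (Λ : JetCoord m k →L[ℝ] ℝ) (A : Coord m →L[ℝ] Coord m) (w : Coord k)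
    (μ : Fin m) : A (fun ν => Λ (vel (ContinuousLinearMap.proj ν) w)) μ =
      Λ (vel ((ContinuousLinearMap.proj μ).comp A) w) := by
  have h1 : (vel ((ContinuousLinearMap.proj μ).comp A) w : JetCoord m k) =
      ∑ ν, A (stdFrame m ν) μ • vel (ContinuousLinearMap.proj ν) w := by
    refine Prod.ext (by simp [vel, Prod.fst_sum]) (Prod.ext (by simp [vel, Prod.fst_sum, Prod.snd_sum]) ?_)
    refine ContinuousLinearMap.ext fun v => ?_
    have hv : v = ∑ ν, v ν • stdFrame m ν := by
      funext i
      simp [stdFrame, Finset.sum_apply, Pi.single_apply]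
    have hA : A v μ = ∑ ν, v ν * A (stdFrame m ν) μ := by
      conv_lhs => rw [hv]
      simp
    simp only [vel, Prod.snd_sum, Prod.smul_mk, ContinuousLinearMap.smulRight_apply,
      ContinuousLinearMap.comp_apply, ContinuousLinearMap.proj_apply, hA, Finset.sum_smul,
      sum_apply, smul_apply, smul_smul]
    exact Finset.sum_congr rfl fun ν _ => by rw [mul_comm]
  set b := fun ν => Λ (vel (ContinuousLinearMap.proj ν) w) with hb
  have hbs : b = ∑ ν, b ν • stdFrame m ν := by
    funext i
    simp [stdFrame, Finset.sum_apply, Pi.single_apply]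
  rw [h1, map_sum]
  conv_lhs => rw [hbs]
  simp only [map_sum, map_smul, Finset.sum_apply, Pi.smul_apply, smul_eq_mul]
  exact Finset.sum_congr rfl fun ν _ => mul_comm _ _

theorem AdaptedChart.thetaFlux_jetTrans {𝓛 : LagrangianDensity m k ρ} (h : 𝓛.IsSmooth)
    (hj : (j.1, j.2.1) ∈ c.overlap c') (J : JetCoord m k) :
    (transD c.base c'.base j.1).det •
      c'.thetaFlux 𝓛 (c.jetTrans c' j) (c.vertTrans c' j J).2.1 =
      transD c.base c'.base j.1 (c.thetaFlux 𝓛 j J.2.1) := by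
  funext μ
  exact (fderiv_lagrangian_vel h hj (ContinuousLinearMap.proj μ) J.2.1).symm.trans
    (apply_vel_comp _ _ _ _).symm

/-- The second-order terms of the two halves of the flux are equal by the symmetry of the second
derivative of the fibre transition, and cancel. -/
theorem AdaptedChart.omegaFlux_jetTrans {𝓛 : LagrangianDensity m k ρ} (h : 𝓛.IsSmooth)
    (hj : (j.1, j.2.1) ∈ c.overlap c') {J J' : JetCoord m k} (hJ : J.1 = 0) (hJ' : J'.1 = 0) :
    (transD c.base c'.base j.1).det • c'.omegaFlux 𝓛 (c.jetTrans c' j)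
      (c.vertTrans c' j J) (c.vertTrans c' j J') =
      transD c.base c'.base j.1 (c.omegaFlux 𝓛 j J J') := by
  funext μ
  have h1 := fderiv_fderiv_lagrangian_vel h hj (ContinuousLinearMap.proj μ) J.2.1 hJ'
  have h2 := fderiv_fderiv_lagrangian_vel h hj (ContinuousLinearMap.proj μ) J'.2.1 hJ
  have hs : fderiv ℝ (fderiv ℝ (c.fibTrans c')) (j.1, j.2.1) (0, J.2.1) (0, J'.2.1) =
      fderiv ℝ (fderiv ℝ (c.fibTrans c')) (j.1, j.2.1) (0, J'.2.1) (0, J.2.1) :=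
    ((contDiffAt_fibTrans hj).isSymmSndFDerivAt (by
      simp only [minSmoothness_of_isRCLikeNormedField]; exact ENat.LEInfty.out)) _ _
  have h3 : c.omegaFlux 𝓛 j J J' = (fun μ => fderiv ℝ (fderiv ℝ (c.lagrangian 𝓛)) j J'
      (vel (ContinuousLinearMap.proj μ) J.2.1)) - fun μ =>
      fderiv ℝ (fderiv ℝ (c.lagrangian 𝓛)) j J (vel (ContinuousLinearMap.proj μ) J'.2.1) := rfl
  rw [h3, map_sub, Pi.sub_apply, apply_vel_comp, apply_vel_comp, h1, h2, hs]
  simp only [Pi.smul_apply, smul_eq_mul, omegaFlux]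
  change _ * (_ - _) = _
  simp only [vertTrans]
  ring

end JetTransition

/-! ### The Poincaré–Cartan form on vertical vectors and along jets -/

section CartanAlgebra

theorem fluxForm_eq_sum {n : ℕ} (Z : Coord (n + 1)) (v : Fin n → Coord (n + 1)) :
    fluxForm Z v = ∑ μ, Z μ * stdVol (n + 1) (Fin.cons (stdFrame (n + 1) μ) v) := by
  have hZ : Z = ∑ μ, Z μ • stdFrame (n + 1) μ := by
    funext i
    simp [stdFrame, Finset.sum_apply, Pi.single_apply]
  conv_lhs => rw [hZ, fluxForm, map_sum]
  simp only [map_smul]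
  rw [ContinuousAlternatingMap.sum_apply]
  rfl

theorem differentiableAt_smul_add_sum {ι κ E V : Type*} [Fintype ι] [Fintype κ]
    [NormedAddCommGroup E] [NormedSpace ℝ E] [NormedAddCommGroup V] [NormedSpace ℝ V] {f : E → ℝ}
    {g : ι → κ → E → ℝ} {x : E} (hf : DifferentiableAt ℝ f x)
    (hg : ∀ a b, DifferentiableAt ℝ (g a b) x) (A : V) (B : ι → κ → V) :
    DifferentiableAt ℝ (fun y => f y • A + ∑ a, ∑ b, g a b y • B a b) x :=
  (hf.smul_const A).fun_add (DifferentiableAt.fun_sum fun a _ => DifferentiableAt.fun_sum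
    fun b _ => (hg a b).smul_const (B a b))

variable {m n k : ℕ}

theorem vel_proj_eq_sum (w : Coord k) (μ : Fin m) :
    (vel (ContinuousLinearMap.proj μ) w : JetCoord m k) = ∑ a, w a • ddv m k a μ := by
  refine Prod.ext (by simp [ddv, vel, Prod.fst_sum])
    (Prod.ext (by simp [ddv, vel, Prod.fst_sum, Prod.snd_sum]) ?_)
  refine ContinuousLinearMap.ext fun v => ?_
  funext b
  simp [ddv, vel, Prod.snd_sum, Finset.sum_apply, sum_apply, Pi.single_apply, mul_comm]

theorem wedge_apply {E : Type*} [NormedAddCommGroup E] [NormedSpace ℝ E] {p : ℕ}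
    (l : Fin p → (E →L[ℝ] ℝ)) (v : Fin p → E) :
    wedge l v = stdVol p fun i ν => l ν (v i) := rfl

/-- As `J` is vertical, its row has the single entry `J^a`, in the replaced column. Expansion along
this row leaves a minor in which the replaced column no longer occurs. -/
theorem stdVol_update_column (a : Fin k) (μ : Fin (n + 1)) (J : JetCoord (n + 1) k) (hJ : J.1 = 0)
    (b : Fin n → JetCoord (n + 1) k) :
    wedge (Function.update (dx (n + 1) k) μ (dy (n + 1) k a)) (Fin.cons J b) =
      J.2.1 a * stdVol (n + 1) (Fin.cons (stdFrame (n + 1) μ) fun i => (b i).1) := by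
  rw [wedge_apply, stdVol_apply, stdVol_apply, Matrix.det_succ_row_zero, Matrix.det_succ_row_zero,
    Finset.sum_eq_single μ, Finset.sum_eq_single μ]
  · have h1 : (Matrix.of fun i ν => (Function.update (dx (n + 1) k) μ (dy (n + 1) k a)) ν
        ((Fin.cons J b : Fin (n + 1) → JetCoord (n + 1) k) i)).submatrix Fin.succ μ.succAbove =
        (Matrix.of (Fin.cons (stdFrame (n + 1) μ) fun i => (b i).1 :
          Fin (n + 1) → Coord (n + 1))).submatrix Fin.succ μ.succAbove := by
      ext i ν
      simp [dx]
    rw [h1]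
    simp [stdFrame, dy]
    ring
  · intro ν _ hν
    simp [stdFrame, hν]
  · simp
  · intro ν _ hν
    simp [Function.update_of_ne hν, dx, hJ]
  · simp

variable {X : Type*} [TopologicalSpace X]
  {Y : Type*} [TopologicalSpace Y]

section Base

variable [ChartedSpace (Coord (n + 1)) X] [ChartedSpace (Coord (n + 1) × Coord k) Y]
  {ρ : Y → X} (c : AdaptedChart (n + 1) k ρ) (𝓛 : LagrangianDensity (n + 1) k ρ)

/-- The term with `d^{n+1}x` vanishes on a vertical vector, and each momentum term contributes one
component of the flux. The other arguments enter only through their base parts. -/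
theorem AdaptedChart.poincareCartan_cons (j : JetCoord (n + 1) k) {J : JetCoord (n + 1) k}
    (hJ : J.1 = 0) (b : Fin n → JetCoord (n + 1) k) :
    c.poincareCartan 𝓛 j (Fin.cons J b) =
      fluxForm (c.thetaFlux 𝓛 j J.2.1) fun i => (b i).1 := by
  have h0 : wedge (dx (n + 1) k) (Fin.cons J b) = 0 := by
    rw [wedge_apply]
    refine (stdVol (n + 1)).map_coord_zero (i := 0) ?_
    funext ν
    simp [dx, hJ]
  have h1 : c.poincareCartan 𝓛 j (Fin.cons J b) =
      (c.lagrangian 𝓛 j - ∑ a, ∑ μ, c.momentum 𝓛 a μ j * j.2.2 (Pi.single μ 1) a) *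
        wedge (dx (n + 1) k) (Fin.cons J b) + ∑ a, ∑ μ, c.momentum 𝓛 a μ j *
        wedge (Function.update (dx (n + 1) k) μ (dy (n + 1) k a)) (Fin.cons J b) := by
    simp [AdaptedChart.poincareCartan, ContinuousAlternatingMap.sum_apply]
  rw [h1, h0, mul_zero, zero_add, fluxForm_eq_sum, Finset.sum_comm]
  refine Finset.sum_congr rfl fun μ _ => ?_
  rw [AdaptedChart.thetaFlux, vel_proj_eq_sum, map_sum, Finset.sum_mul]
  refine Finset.sum_congr rfl fun a _ => ?_
  rw [stdVol_update_column a μ J hJ b, map_smul, smul_eq_mul, AdaptedChart.momentum]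
  ring

variable {c 𝓛}

theorem AdaptedChart.differentiableAt_poincareCartan (h : 𝓛.IsSmooth) {j : JetCoord (n + 1) k}
    (hj : (j.1, j.2.1) ∈ c.tot.target) : DifferentiableAt ℝ (c.poincareCartan 𝓛) j := by
  have h1 : DifferentiableAt ℝ (c.lagrangian 𝓛) j := (h.contDiffAt hj).differentiableAt (by simp)
  have h2 : DifferentiableAt ℝ (fderiv ℝ (c.lagrangian 𝓛)) j :=
    (h.contDiffAt_fderiv hj).differentiableAt (by simp)
  have h3 : ∀ a μ, DifferentiableAt ℝ (c.momentum 𝓛 a μ) j := fun a μ =>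
    h2.clm_apply (differentiableAt_const _)
  have h4 : ∀ (a : Fin k) (μ : Fin (n + 1)),
      DifferentiableAt ℝ (fun j : JetCoord (n + 1) k => j.2.2 (Pi.single μ 1) a) j := by
    intro a μ
    have hd : DifferentiableAt ℝ (fun j : JetCoord (n + 1) k => j.2.2) j := by fun_prop
    exact differentiableAt_pi.1 (hd.clm_apply (differentiableAt_const (Pi.single μ 1 : Coord (n + 1)))) a
  have h5 : DifferentiableAt ℝ (fun j : JetCoord (n + 1) k => c.lagrangian 𝓛 j -
      ∑ a, ∑ μ, c.momentum 𝓛 a μ j * j.2.2 (Pi.single μ 1) a) j :=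
    h1.fun_sub (DifferentiableAt.fun_sum fun a _ => DifferentiableAt.fun_sum fun μ _ =>
      (h3 a μ).fun_mul (h4 a μ))
  exact differentiableAt_smul_add_sum h5 h3 (wedge (dx (n + 1) k))
    fun a μ => wedge (Function.update (dx (n + 1) k) μ (dy (n + 1) k a))

/-- The formula of `poincareCartan_cons` holds at every jet, so it can be differentiated in the jet
with the arguments kept fixed. -/
theorem AdaptedChart.fderiv_poincareCartan_cons (h : 𝓛.IsSmooth) {j : JetCoord (n + 1) k}
    (hj : (j.1, j.2.1) ∈ c.tot.target) (I : JetCoord (n + 1) k) {J : JetCoord (n + 1) k}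
    (hJ : J.1 = 0) (b : Fin n → JetCoord (n + 1) k) :
    fderiv ℝ (c.poincareCartan 𝓛) j I (Fin.cons J b) =
      fluxForm (fun μ => fderiv ℝ (fderiv ℝ (c.lagrangian 𝓛)) j I
        (vel (ContinuousLinearMap.proj μ) J.2.1)) fun i => (b i).1 := by
  have h2 : DifferentiableAt ℝ (fderiv ℝ (c.lagrangian 𝓛)) j :=
    (h.contDiffAt_fderiv hj).differentiableAt (by simp)
  have h3 : HasFDerivAt (fun j' => c.poincareCartan 𝓛 j' (Fin.cons J b))
      (∑ μ : Fin (n + 1), (stdVol (n + 1) (Fin.cons (stdFrame (n + 1) μ) fun i => (b i).1)) •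
        (fderiv ℝ (fderiv ℝ (c.lagrangian 𝓛)) j).flip
          (vel (ContinuousLinearMap.proj μ) J.2.1)) j := by
    have : (fun j' => c.poincareCartan 𝓛 j' (Fin.cons J b)) = fun j' =>
        ∑ μ : Fin (n + 1), fderiv ℝ (c.lagrangian 𝓛) j' (vel (ContinuousLinearMap.proj μ) J.2.1) *
          stdVol (n + 1) (Fin.cons (stdFrame (n + 1) μ) fun i => (b i).1) := by
      funext j'
      rw [c.poincareCartan_cons 𝓛 j' hJ b, fluxForm_eq_sum]
      rfl
    rw [this]
    refine HasFDerivAt.fun_sum fun μ _ => HasFDerivAt.mul_const ?_ _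
    have h4 := h2.hasFDerivAt.clm_apply
      (hasFDerivAt_const (vel (ContinuousLinearMap.proj μ) J.2.1 : JetCoord (n + 1) k) j)
    rw [ContinuousLinearMap.comp_zero, zero_add] at h4
    exact h4
  rw [← fderiv_continuousAlternatingMap_apply_const_apply (differentiableAt_poincareCartan h hj),
    h3.fderiv]
  rw [fluxForm_eq_sum, sum_apply]
  exact Finset.sum_congr rfl fun μ _ => mul_comm _ _

/-- In the alternating sum for the exterior derivative, a term that differentiates along a vector of
`b` retains both vertical arguments, and the flux form then has an argument with zero base part.
Only the terms that differentiate along `J` and `J'` survive. -/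
theorem AdaptedChart.multisymplectic_cons_cons (h : 𝓛.IsSmooth) {j : JetCoord (n + 1) k}
    (hj : (j.1, j.2.1) ∈ c.tot.target) {J J' : JetCoord (n + 1) k} (hJ : J.1 = 0) (hJ' : J'.1 = 0)
    (b : Fin n → JetCoord (n + 1) k) :
    c.multisymplectic 𝓛 j (Fin.cons J (Fin.cons J' b)) =
      fluxForm (c.omegaFlux 𝓛 j J J') fun i => (b i).1 := by
  have h1 : c.multisymplectic 𝓛 j (Fin.cons J (Fin.cons J' b)) =
      -∑ i : Fin (n + 2), (-1) ^ (i : ℕ) • fderiv ℝ (c.poincareCartan 𝓛) j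
        ((Fin.cons J (Fin.cons J' b) : Fin (n + 2) → JetCoord (n + 1) k) i)
        (i.removeNth (Fin.cons J (Fin.cons J' b) : Fin (n + 2) → JetCoord (n + 1) k)) := by
    rw [← ContinuousAlternatingMap.alternatizeUncurryFin_apply]
    rfl
  have h2 : ∀ i : Fin n, fderiv ℝ (c.poincareCartan 𝓛) j
        ((Fin.cons J (Fin.cons J' b) : Fin (n + 2) → JetCoord (n + 1) k) i.succ.succ)
        (i.succ.succ.removeNth
          (Fin.cons J (Fin.cons J' b) : Fin (n + 2) → JetCoord (n + 1) k)) = 0 := by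
    intro i
    -- The index `i : Fin n` forces `n > 0`, so `J'` is the first entry of the tail after `J`.
    obtain ⟨n', rfl⟩ : ∃ n', n = n' + 1 := ⟨n - 1, by have := i.2; omega⟩
    set r := i.succ.succ.removeNth
      (Fin.cons J (Fin.cons J' b) : Fin (n' + 1 + 2) → JetCoord (n' + 1 + 1) k) with hr
    have hr0 : r = Fin.cons J (Fin.tail r) := by
      conv_lhs => rw [← Fin.cons_self_tail r]
      rfl
    have hr1 : Fin.tail r 0 = J' := rfl
    rw [hr0, fderiv_poincareCartan_cons h hj _ hJ]
    exact ContinuousAlternatingMap.map_coord_zero _ (i := 0) (by rw [hr1, hJ'])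
  have h3 : (Fin.succ (0 : Fin (n + 1))).removeNth
      (Fin.cons J (Fin.cons J' b) : Fin (n + 2) → JetCoord (n + 1) k) = Fin.cons J b := by
    funext i
    refine Fin.cases rfl (fun i => ?_) i
    rfl
  rw [h1, Fin.sum_univ_succ, Fin.sum_univ_succ, Finset.sum_eq_zero, add_zero, h3]
  · have h4 : (0 : Fin (n + 2)).removeNth
      (Fin.cons J (Fin.cons J' b) : Fin (n + 2) → JetCoord (n + 1) k) = Fin.cons J' b := rfl
    rw [h4]
    simp only [Fin.cons_zero, Fin.cons_succ]
    rw [fderiv_poincareCartan_cons h hj _ hJ', fderiv_poincareCartan_cons h hj _ hJ]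
    have h5 : fluxForm (c.omegaFlux 𝓛 j J J') = fluxForm (fun μ =>
        fderiv ℝ (fderiv ℝ (c.lagrangian 𝓛)) j J' (vel (ContinuousLinearMap.proj μ) J.2.1)) -
        fluxForm (fun μ => fderiv ℝ (fderiv ℝ (c.lagrangian 𝓛)) j J
          (vel (ContinuousLinearMap.proj μ) J'.2.1)) := by
      rw [fluxForm, fluxForm, fluxForm, ← map_sub]
      rfl
    rw [h5, ContinuousAlternatingMap.sub_apply]
    simp [sub_eq_add_neg]
  · intro i _
    rw [h2, smul_zero]

end Base

variable [ChartedSpace (Coord m) X] [ChartedSpace (Coord m × Coord k) Y]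
  {ρ : Y → X} (c : AdaptedChart m k ρ) (𝓛 : LagrangianDensity m k ρ)

/-- On vectors along a section with the jet `j`, the Poincaré–Cartan form is the Lagrangian. -/
theorem AdaptedChart.poincareCartan_jet (j : JetCoord m k) (b : Fin m → JetCoord m k)
    (hb : ∀ i, (b i).2.1 = j.2.2 (b i).1) :
    c.poincareCartan 𝓛 j b = c.lagrangian 𝓛 j * stdVol m fun i => (b i).1 := by
  have h0 : wedge (dx m k) b = stdVol m fun i => (b i).1 := rfl
  have h1 : ∀ a μ, wedge (Function.update (dx m k) μ (dy m k a)) b =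
      j.2.2 (Pi.single μ 1) a * stdVol m fun i => (b i).1 := by
    intro a μ
    set M : Matrix (Fin m) (Fin m) ℝ := Matrix.of fun i => (b i).1 with hM
    set q : Fin m → ℝ := fun ν => j.2.2 (Pi.single ν 1) a with hq
    -- On these vectors `dy^a` is the combination of the `dx^ν` with coefficients `q ν`, so the
    -- replaced column is `M q`. Cramer's rule gives the determinant `q μ` times that of `M`.
    have h2 : (Matrix.of fun i ν => Function.update (dx m k) μ (dy m k a) ν (b i)) =
        M.updateCol μ (M.mulVec q) := by
      ext i ν
      by_cases hν : ν = μ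
      · subst hν
        simp only [Matrix.of_apply, Function.update_self, Matrix.updateCol_self, dy,
          ContinuousLinearMap.comp_apply, ContinuousLinearMap.coe_fst', ContinuousLinearMap.coe_snd',
          ContinuousLinearMap.proj_apply, hb]
        have hv : (b i).1 = ∑ ν, (b i).1 ν • (Pi.single ν 1 : Coord m) := by
          funext i
          simp [Finset.sum_apply, Pi.single_apply]
        conv_lhs => rw [hv]
        simp [hM, hq, Matrix.mulVec, dotProduct]
      · simp [Function.update_of_ne hν, Matrix.updateCol_ne hν, dx, hM]
    rw [wedge_apply, stdVol_apply, stdVol_apply, h2, ← Matrix.cramer_apply,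
      Matrix.cramer_eq_adjugate_mulVec, Matrix.mulVec_mulVec, Matrix.adjugate_mul,
      Matrix.smul_mulVec, Matrix.one_mulVec, Pi.smul_apply, smul_eq_mul, mul_comm]
  have h3 : c.poincareCartan 𝓛 j b =
      (c.lagrangian 𝓛 j - ∑ a, ∑ μ, c.momentum 𝓛 a μ j * j.2.2 (Pi.single μ 1) a) *
        wedge (dx m k) b + ∑ a, ∑ μ, c.momentum 𝓛 a μ j *
        wedge (Function.update (dx m k) μ (dy m k a)) b := by
    simp [AdaptedChart.poincareCartan, ContinuousAlternatingMap.sum_apply]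
  rw [h3, h0]
  simp only [h1, ← mul_assoc, ← Finset.sum_mul]
  ring

end CartanAlgebra

/-! ### Smooth families of fields -/

section Families

variable {m k : ℕ} {X : Type*} [TopologicalSpace X] [ChartedSpace (Coord m) X]
  {Y : Type*} [TopologicalSpace Y] [ChartedSpace (Coord m × Coord k) Y]
  {ρ : Y → X} {G : Type*} [NormedAddCommGroup G] [NormedSpace ℝ G]

/-- A family of fields on `U`, smooth in all variables up to the boundary, with an open set of
parameters. -/
structure IsFieldFamily (m k : ℕ) {X : Type*} [TopologicalSpace X] [ChartedSpace (Coord m) X]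
    {Y : Type*} [TopologicalSpace Y] [ChartedSpace (Coord m × Coord k) Y] (ρ : Y → X)
    (U : Set X) (P : Set G) (Φ : G → X → Y) : Prop where
  isOpen : IsOpen P
  isField : ∀ q ∈ P, IsField (m := m) (k := k) U ρ (Φ q)
  smooth : ∀ c : AdaptedChart m k ρ, ContMDiffOn 𝓘(ℝ, G × Coord m) (mdlTot m k) ∞
    (fun z : G × Coord m => Φ z.1 (c.base.symm z.2)) (P ×ˢ c.dom U)

variable {𝓛 : LagrangianDensity m k ρ} {U : Set X}

theorem AdaptedChart.contMDiffOn_base_symm_snd (c : AdaptedChart m k ρ) (P : Set G) :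
    ContMDiffOn 𝓘(ℝ, G × Coord m) (mdl m) ∞ (fun z : G × Coord m => c.base.symm z.2)
      (P ×ˢ c.dom U) :=
  (contMDiffOn_symm_of_mem_maximalAtlas c.base_smooth).comp contDiff_snd.contMDiff.contMDiffOn
    fun _ hz => hz.2.1

theorem IsSolutionCurve.isFieldFamily {δ : ℝ} {Φ : ℝ → X → Y} (h : IsSolutionCurve 𝓛 U δ Φ) :
    IsFieldFamily m k ρ U (Ioo (-δ) δ) Φ where
  isOpen := isOpen_Ioo
  isField q hq := (h.2.2 q hq).1
  smooth c := by
    have h1 : ContMDiffOn 𝓘(ℝ, ℝ × Coord m) (𝓘(ℝ, ℝ).prod (mdl m)) ∞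
        (fun z : ℝ × Coord m => (z.1, c.base.symm z.2)) (Ioo (-δ) δ ×ˢ c.dom U) :=
      contDiff_fst.contMDiff.contMDiffOn.prodMk (c.contMDiffOn_base_symm_snd _)
    exact h.2.1.comp h1 fun z hz => ⟨hz.1, hz.2.2⟩

theorem IsSolutionSurface.isFieldFamily {δ : ℝ} {Ψ : ℝ → ℝ → X → Y}
    (h : IsSolutionSurface 𝓛 U δ Ψ) :
    IsFieldFamily m k ρ U (Ioo (-δ) δ ×ˢ Ioo (-δ) δ) fun q : ℝ × ℝ => Ψ q.1 q.2 where
  isOpen := isOpen_Ioo.prod isOpen_Ioo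
  isField q hq := (h.2.2 q.1 hq.1 q.2 hq.2).1
  smooth c := by
    have h0 : ContMDiffOn 𝓘(ℝ, (ℝ × ℝ) × Coord m) (𝓘(ℝ, ℝ).prod 𝓘(ℝ, ℝ)) ∞
        (fun z : (ℝ × ℝ) × Coord m => (z.1.1, z.1.2))
        ((Ioo (-δ) δ ×ˢ Ioo (-δ) δ) ×ˢ c.dom U) :=
      contDiff_fst.fst.contMDiff.contMDiffOn.prodMk contDiff_fst.snd.contMDiff.contMDiffOn
    have h1 : ContMDiffOn 𝓘(ℝ, (ℝ × ℝ) × Coord m) ((𝓘(ℝ, ℝ).prod 𝓘(ℝ, ℝ)).prod (mdl m)) ∞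
        (fun z : (ℝ × ℝ) × Coord m => ((z.1.1, z.1.2), c.base.symm z.2))
        ((Ioo (-δ) δ ×ˢ Ioo (-δ) δ) ×ˢ c.dom U) :=
      h0.prodMk (c.contMDiffOn_base_symm_snd _)
    exact h.2.1.comp h1 fun z hz => ⟨hz.1, hz.2.2⟩

/-- Viewing one field as a constant family makes the smoothness of its jet a case of the statement
for families. -/
theorem IsField.isFieldFamily {φ : X → Y} (h : IsField (m := m) (k := k) U ρ φ) :
    IsFieldFamily m k ρ U (univ : Set ℝ) fun _ => φ where
  isOpen := isOpen_univ
  isField _ _ := h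
  smooth c := h.1.comp (c.contMDiffOn_base_symm_snd _) fun _ hz => hz.2.2

variable {P : Set G} {Φ : G → X → Y} {c : AdaptedChart m k ρ} {q : G} {u : Coord m}

theorem IsField.mdifferentiableWithinAt {φ : X → Y} (h : IsField (m := m) (k := k) U ρ φ) {x : X}
    (hx : x ∈ closure U) : MDifferentiableWithinAt (mdl m) (mdlTot m k) φ (closure U) x :=
  (h.1 x hx).mdifferentiableWithinAt (by simp)

theorem IsFieldFamily.eventually_mem_source (h : IsFieldFamily m k ρ U P Φ) (hq : q ∈ P)
    (hu : u ∈ c.dom U) (hs : Φ q (c.base.symm u) ∈ c.tot.source) :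
    ∀ᶠ z in 𝓝[P ×ˢ c.dom U] (q, u), Φ z.1 (c.base.symm z.2) ∈ c.tot.source :=
  ((h.smooth c).continuousOn (q, u) (mk_mem_prod hq hu)).preimage_mem_nhdsWithin
    (c.tot.open_source.mem_nhds hs)

theorem IsFieldFamily.contDiffWithinAt_field (h : IsFieldFamily m k ρ U P Φ) (hq : q ∈ P)
    (hu : u ∈ c.dom U) (hs : Φ q (c.base.symm u) ∈ c.tot.source) :
    ContDiffWithinAt ℝ ∞ (fun z : G × Coord m => c.field (Φ z.1) z.2) (P ×ˢ c.dom U) (q, u) := by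
  have h1 := ContMDiffAt.comp_contMDiffWithinAt (q, u)
    (contMDiffAt_of_mem_maximalAtlas c.tot_smooth hs) (h.smooth c (q, u) (mk_mem_prod hq hu))
  exact h1.contDiffWithinAt.snd

omit [NormedSpace ℝ G] in
theorem tendsto_slice {D : Set (Coord m)} (hq : q ∈ P) :
    Filter.Tendsto (fun v => (q, v)) (𝓝[D] u) (𝓝[P ×ˢ D] (q, u)) :=
  tendsto_nhdsWithin_iff.2 ⟨(Continuous.prodMk_right q).continuousWithinAt.tendsto,
    eventually_mem_nhdsWithin.mono fun _ hv => mk_mem_prod hq hv⟩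

theorem tendsto_line {D : Set (Coord m)} (hP : IsOpen P) (hq : q ∈ P) (hu : u ∈ D) (v : G) :
    Filter.Tendsto (fun τ : ℝ => (q + τ • v, u)) (𝓝 0) (𝓝[P ×ˢ D] (q, u)) := by
  have h0 : ContinuousAt (fun τ : ℝ => q + τ • v) 0 := by fun_prop
  have h1 : Filter.Tendsto (fun τ : ℝ => q + τ • v) (𝓝 0) (𝓝 q) := by
    simpa [ContinuousAt] using h0
  refine tendsto_nhdsWithin_iff.2 ⟨h1.prodMk_nhds tendsto_const_nhds, ?_⟩
  exact (h1.eventually (hP.mem_nhds hq)).mono fun τ hτ => mk_mem_prod hτ hu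

variable (hD : ∀ c : AdaptedChart m k ρ, UniqueDiffOn ℝ (c.dom U))
include hD

/-- The spatial derivative of each member is a component of the joint derivative of the family,
which is smooth in all variables. -/
theorem IsFieldFamily.contDiffWithinAt_jet (h : IsFieldFamily m k ρ U P Φ) (hq : q ∈ P)
    (hu : u ∈ c.dom U) (hs : Φ q (c.base.symm u) ∈ c.tot.source) :
    ContDiffWithinAt ℝ ∞ (fun z : G × Coord m => c.jet U (Φ z.1) z.2) (P ×ˢ c.dom U) (q, u) := by
  have h1 := h.contDiffWithinAt_field hq hu hs
  have hS : UniqueDiffOn ℝ (P ×ˢ c.dom U) := h.isOpen.uniqueDiffOn.prod (hD c)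
  have h2 := ContDiffWithinAt.fderivWithin_self h1 hS (mk_mem_prod hq hu)
  have h3 := h2.clm_comp (contDiffWithinAt_const (c := ContinuousLinearMap.inr ℝ G (Coord m)))
  refine contDiffWithinAt_snd.prodMk (h1.prodMk (h3.congr_of_eventuallyEq ?_ ?_))
  · filter_upwards [eventually_differentiableWithinAt h1, self_mem_nhdsWithin] with z hz hzS
    exact (hasFDerivWithinAt_slice_right (q := z.1) (x := z.2) hzS.1 hz).fderivWithin
      (hD c _ hzS.2)
  · exact (hasFDerivWithinAt_slice_right hq (h1.differentiableWithinAt (by simp))).fderivWithin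
      (hD c _ hu)

/-- The derivative of the jets in the direction `v` of the parameters. -/
theorem IsFieldFamily.hasDerivAt_jet (hU : IsOpen U) (h : IsFieldFamily m k ρ U P Φ) (hq : q ∈ P)
    (hu : u ∈ c.dom U) (hs : Φ q (c.base.symm u) ∈ c.tot.source) (v : G) :
    HasDerivAt (fun τ : ℝ => c.jet U (Φ (q + τ • v)) u)
      (0, fderivWithin ℝ (fun z : G × Coord m => c.field (Φ z.1) z.2) (P ×ˢ c.dom U) (q, u) (v, 0),
        fderivWithin ℝ (fun u => fderivWithin ℝ (fun z : G × Coord m => c.field (Φ z.1) z.2)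
          (P ×ˢ c.dom U) (q, u) (v, 0)) (c.dom U) u) 0 := by
  have h1 := h.contDiffWithinAt_field hq hu hs
  have h2 := hasFDerivAt_fderivWithin_slice h.isOpen (hD c) hq hu
    (subset_closure_interior_preimage hU c.base hu) h1 v
  have h3 := hasFDerivAt_slice_left h.isOpen hq hu (h1.differentiableWithinAt (by simp))
  have hl : HasDerivAt (fun τ : ℝ => q + τ • v) v 0 := by
    simpa using ((hasDerivAt_id (0 : ℝ)).smul_const v).const_add q
  have h4 := HasFDerivAt.comp_hasDerivAt_of_eq (0 : ℝ) h3 hl (by simp)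
  exact (hasDerivAt_const _ u).prodMk (h4.prodMk h2)

omit hD in
theorem AdaptedChart.jet_congr {φ ψ : X → Y} (h : ∀ x ∈ closure U, ψ x = φ x) (hu : u ∈ c.dom U) :
    c.jet U ψ u = c.jet U φ u := by
  have h1 : ∀ v ∈ c.dom U, c.field ψ v = c.field φ v := fun v hv => by
    rw [AdaptedChart.field, h _ hv.2, AdaptedChart.field]
  rw [AdaptedChart.jet, h1 u hu, fderivWithin_congr h1 (h1 u hu), AdaptedChart.jet]

omit hD in
-- The velocity is defined through tangent vectors of `Y`. Its coordinate form as a parameter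
-- derivative makes the calculus of smooth families available for `V`.
theorem IsFieldFamily.variation_eq {P : Set ℝ} {Φ : ℝ → X → Y} (h : IsFieldFamily m k ρ U P Φ)
    (h0 : (0 : ℝ) ∈ P) {φ : X → Y} {V : FieldVariation m k φ}
    (hV : ∀ x ∈ closure U, Φ 0 x = φ x ∧ V x = velocity m k Φ x)
    (hu : u ∈ c.dom U) (hs : φ (c.base.symm u) ∈ c.tot.source) :
    c.variation φ V u = fderivWithin ℝ (fun z : ℝ × Coord m => c.field (Φ z.1) z.2)
      (P ×ˢ c.dom U) (0, u) (1, 0) := by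
  obtain ⟨h1, h2⟩ := hV _ hu.2
  have hs' : Φ 0 (c.base.symm u) ∈ c.tot.source := h1 ▸ hs
  have h3 := hasFDerivAt_slice_left h.isOpen h0 hu
    ((h.contDiffWithinAt_field h0 hu hs').differentiableWithinAt (by simp))
  have h4 : HasMFDerivAt 𝓘(ℝ, ℝ) (mdlTot m k) (fun ε => Φ ε (c.base.symm u)) 0
      (mfderiv 𝓘(ℝ, ℝ) (mdlTot m k) (fun ε => Φ ε (c.base.symm u)) 0) := by
    refine MDifferentiableAt.hasMFDerivAt ?_
    have h5 : ContMDiffWithinAt 𝓘(ℝ, ℝ) 𝓘(ℝ, ℝ × Coord m) ∞ (fun ε : ℝ => (ε, u)) P 0 :=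
      (contDiff_id.prodMk contDiff_const).contMDiff.contMDiffAt.contMDiffWithinAt
    have h6 := ContMDiffWithinAt.comp (0 : ℝ) (h.smooth c (0, u) (mk_mem_prod h0 hu)) h5
      fun ε hε => mk_mem_prod hε hu
    exact (h6.contMDiffAt (h.isOpen.mem_nhds h0)).mdifferentiableAt (by simp)
  have h7 : HasMFDerivAt (mdlTot m k) (mdlTot m k) c.tot (Φ 0 (c.base.symm u)) _ :=
    ((contMDiffAt_of_mem_maximalAtlas c.tot_smooth hs').mdifferentiableAt (by simp)).hasMFDerivAt
  have h8 := (HasMFDerivAt.comp (0 : ℝ) h7 h4).hasFDerivAt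
  have h9 := (hasFDerivAt_snd (p := c.tot (Φ 0 (c.base.symm u)))).comp (0 : ℝ) h8
  have h10 := congrArg (fun A : ℝ →L[ℝ] Coord k => A 1) (h3.unique h9)
  refine Eq.trans ?_ h10.symm
  have h11 : c.variation φ V u = (c.totD (φ (c.base.symm u))
    (V (c.base.symm u) : Coord m × Coord k)).2 := rfl
  rw [h11, ← h1]
  exact congrArg (fun w : Coord m × Coord k => (c.totD (Φ 0 (c.base.symm u)) w).2) h2

end Families

/-! ### Prolonged variations and the linearised Euler–Lagrange equations -/

section Variations

variable {m k : ℕ} {X : Type*} [TopologicalSpace X] [ChartedSpace (Coord m) X]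
  {Y : Type*} [TopologicalSpace Y] [ChartedSpace (Coord m × Coord k) Y]
  {ρ : Y → X} {𝓛 : LagrangianDensity m k ρ} {U : Set X} {c : AdaptedChart m k ρ} {u : Coord m}

theorem ContDiffWithinAt.slice {G F : Type*} [NormedAddCommGroup G] [NormedSpace ℝ G]
    [NormedAddCommGroup F] [NormedSpace ℝ F] {P : Set G} {D : Set (Coord m)} {q : G}
    {f : G × Coord m → F} (hf : ContDiffWithinAt ℝ ∞ f (P ×ˢ D) (q, u)) (hq : q ∈ P) :
    ContDiffWithinAt ℝ ∞ (fun v => f (q, v)) D u :=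
  _root_.ContDiffWithinAt.comp (t := P ×ˢ D) u hf
    (contDiff_const.prodMk contDiff_id).contDiffWithinAt fun _ hv => mk_mem_prod hq hv

theorem vel_eq (ℓ : Coord m →L[ℝ] ℝ) (w : Coord k) : (vel ℓ w : JetCoord m k) =
    ((ContinuousLinearMap.inr ℝ (Coord m) (Coord k × (Coord m →L[ℝ] Coord k))).comp
      ((ContinuousLinearMap.inr ℝ (Coord k) (Coord m →L[ℝ] Coord k)).comp
        (ContinuousLinearMap.smulRightL ℝ (Coord m) (Coord k) ℓ))) w := rfl

theorem jetCoord_eq_sum (w : Coord k) (A : Coord m →L[ℝ] Coord k) :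
    ((0, w, A) : JetCoord m k) =
      (0, w, 0) + ∑ μ, vel (ContinuousLinearMap.proj μ) (A (stdFrame m μ)) := by
  refine Prod.ext (by simp [vel, Prod.fst_sum]) (Prod.ext
    (by simp [vel, Prod.fst_sum, Prod.snd_sum]) (ContinuousLinearMap.ext fun v => ?_))
  have hv : v = ∑ ν, v ν • stdFrame m ν := by
    funext i
    simp [stdFrame, Finset.sum_apply, Pi.single_apply]
  conv_lhs => rw [hv]
  simp [vel, Prod.snd_sum, sum_apply]

/-- The divergence of the flux `Λ(∂/∂y^a_μ) V^a`, for a covector field `Λ` along a jet that satisfies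
the Euler–Lagrange equations. -/
theorem sum_fderivWithin_flux {D : Set (Coord m)} (hD : UniqueDiffOn ℝ D) (hu : u ∈ D)
    {Λ : Coord m → JetCoord m k →L[ℝ] ℝ} {V : Coord m → Coord k}
    (hΛ : DifferentiableWithinAt ℝ Λ D u) (hV : DifferentiableWithinAt ℝ V D u)
    (hEL : ∀ w, ∑ μ, fderivWithin ℝ (fun v => Λ v (vel (ContinuousLinearMap.proj μ) w)) D u
      (stdFrame m μ) = Λ u (0, w, 0)) :
    ∑ μ, fderivWithin ℝ (fun v => Λ v (vel (ContinuousLinearMap.proj μ) (V v))) D u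
      (stdFrame m μ) = Λ u (0, V u, fderivWithin ℝ V D u) := by
  have h1 : ∀ (μ : Fin m) (W : Coord m → Coord k), DifferentiableWithinAt ℝ W D u →
      fderivWithin ℝ (fun v => Λ v (vel (ContinuousLinearMap.proj μ) (W v))) D u (stdFrame m μ) =
      fderivWithin ℝ Λ D u (stdFrame m μ) (vel (ContinuousLinearMap.proj μ) (W u)) +
        Λ u (vel (ContinuousLinearMap.proj μ) (fderivWithin ℝ W D u (stdFrame m μ))) := by
    intro μ W hW
    have h2 := ((((ContinuousLinearMap.inr ℝ (Coord m) (Coord k × (Coord m →L[ℝ] Coord k))).comp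
      ((ContinuousLinearMap.inr ℝ (Coord k) (Coord m →L[ℝ] Coord k)).comp
        (ContinuousLinearMap.smulRightL ℝ (Coord m) (Coord k)
          (ContinuousLinearMap.proj μ)))).hasFDerivAt).comp_hasFDerivWithinAt u
            hW.hasFDerivWithinAt)
    have h3 := (hΛ.hasFDerivWithinAt.clm_apply h2).fderivWithin (hD u hu)
    have h4 := congrArg (fun A : Coord m →L[ℝ] ℝ => A (stdFrame m μ)) h3
    refine h4.trans ?_
    rw [add_comm]
    rfl
  -- The equations are tested with the constant vector `V u`. This accounts for the terms of the
  -- product rule in which `Λ` is differentiated; those with the derivative of `V` form the velocity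
  -- part of the prolongation.
  have h5 := hEL (V u)
  rw [jetCoord_eq_sum, map_add, map_sum, ← h5, ← Finset.sum_add_distrib]
  refine Finset.sum_congr rfl fun μ _ => ?_
  rw [h1 μ V hV, h1 μ (fun _ => V u) (differentiableWithinAt_const _), fderivWithin_fun_const]
  simp only [vel_eq, Pi.zero_apply, zero_apply, map_zero, add_zero]

variable (hD : ∀ c : AdaptedChart m k ρ, UniqueDiffOn ℝ (c.dom U))
include hD

theorem IsField.contDiffWithinAt_jet {φ : X → Y} (h : IsField (m := m) (k := k) U ρ φ)
    (hu : u ∈ c.dom U) (hs : φ (c.base.symm u) ∈ c.tot.source) :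
    ContDiffWithinAt ℝ ∞ (c.jet U φ) (c.dom U) u :=
  ContDiffWithinAt.slice (q := (0 : ℝ)) (h.isFieldFamily.contDiffWithinAt_jet hD (mem_univ _) hu hs)
    (mem_univ _)

/-- Holonomy of `j¹φ`: its velocity component is by definition the derivative of its fibre
component. Contact forms therefore pull back to zero. -/
theorem IsField.dJet_apply {φ : X → Y} (h : IsField (m := m) (k := k) U ρ φ)
    (hu : u ∈ c.dom U) (hs : φ (c.base.symm u) ∈ c.tot.source) (v : Coord m) :
    (c.dJet U φ u v).1 = v ∧ (c.dJet U φ u v).2.1 = (c.jet U φ u).2.2 v := by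
  have h1 := ((h.contDiffWithinAt_jet hD hu hs).differentiableWithinAt
    (by simp)).hasFDerivWithinAt
  have h2 : fderivWithin ℝ (fun v => (c.jet U φ v).1) (c.dom U) u = _ :=
    (hasFDerivAt_fst.comp_hasFDerivWithinAt u h1).fderivWithin (hD c u hu)
  have h3 : fderivWithin ℝ (c.field φ) (c.dom U) u = _ :=
    (((ContinuousLinearMap.fst ℝ (Coord k) (Coord m →L[ℝ] Coord k)).comp
      (ContinuousLinearMap.snd ℝ (Coord m) _)).hasFDerivAt.comp_hasFDerivWithinAt u
        h1).fderivWithin (hD c u hu)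
  have h4 : fderivWithin ℝ (fun v => (c.jet U φ v).1) (c.dom U) u =
      ContinuousLinearMap.id ℝ (Coord m) := fderivWithin_id (hD c u hu)
  exact ⟨(congrArg (fun A : Coord m →L[ℝ] Coord m => A v) (h2.symm.trans h4)),
    (congrArg (fun A : Coord m →L[ℝ] Coord k => A v) h3).symm⟩

omit hD in
theorem AdaptedChart.jet_mem {φ : X → Y} (hφ : ∀ x ∈ closure U, ρ (φ x) = x)
    (hu : u ∈ c.dom U) (hs : φ (c.base.symm u) ∈ c.tot.source) :
    ((c.jet U φ u).1, (c.jet U φ u).2.1) ∈ c.tot.target := by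
  change (u, c.field φ u) ∈ c.tot.target
  rw [← c.tot_symm_field hφ hu hs]
  exact c.tot.map_source hs

omit hD in
theorem IsField.eventually_mem_source {φ : X → Y} (h : IsField (m := m) (k := k) U ρ φ)
    (hu : u ∈ c.dom U) (hs : φ (c.base.symm u) ∈ c.tot.source) :
    ∀ᶠ v in 𝓝[c.dom U] u, φ (c.base.symm v) ∈ c.tot.source :=
  c.eventually_mem_source (h.1.continuousOn _ hu.2) hu hs

section Curve

variable {P : Set ℝ} {Φ : ℝ → X → Y} {φ : X → Y} {V : FieldVariation m k φ}

omit hD in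
theorem IsFieldFamily.prolong_eq (h : IsFieldFamily m k ρ U P Φ)
    (h0 : (0 : ℝ) ∈ P) (hV : ∀ x ∈ closure U, Φ 0 x = φ x ∧ V x = velocity m k Φ x)
    (hu : u ∈ c.dom U) (hs : φ (c.base.symm u) ∈ c.tot.source) :
    c.prolong U φ V u =
      (0, fderivWithin ℝ (fun z : ℝ × Coord m => c.field (Φ z.1) z.2) (P ×ˢ c.dom U) (0, u) (1, 0),
        fderivWithin ℝ (fun u => fderivWithin ℝ (fun z : ℝ × Coord m => c.field (Φ z.1) z.2)
          (P ×ˢ c.dom U) (0, u) (1, 0)) (c.dom U) u) := by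
  have h1 := h.variation_eq h0 hV hu hs
  have hs' : Φ 0 (c.base.symm u) ∈ c.tot.source := (hV _ hu.2).1 ▸ hs
  have h2 : c.variation φ V =ᶠ[𝓝[c.dom U] u] fun u =>
      fderivWithin ℝ (fun z : ℝ × Coord m => c.field (Φ z.1) z.2) (P ×ˢ c.dom U) (0, u) (1, 0) := by
    filter_upwards [(tendsto_slice h0).eventually (h.eventually_mem_source h0 hu hs'),
      self_mem_nhdsWithin] with v hv hvD
    exact h.variation_eq h0 hV hvD ((hV _ hvD.2).1 ▸ hv)
  rw [AdaptedChart.prolong, h2.fderivWithin_eq h1, h1]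

/-- Differentiation in the parameter commutes with differentiation in space, also one-sidedly at the
boundary; hence the jets vary by the prolongation of the velocity. -/
theorem IsFieldFamily.hasDerivAt_jet_prolong (hU : IsOpen U) (h : IsFieldFamily m k ρ U P Φ)
    (h0 : (0 : ℝ) ∈ P) (hV : ∀ x ∈ closure U, Φ 0 x = φ x ∧ V x = velocity m k Φ x)
    (hu : u ∈ c.dom U) (hs : φ (c.base.symm u) ∈ c.tot.source) :
    HasDerivAt (fun ε : ℝ => c.jet U (Φ ε) u) (c.prolong U φ V u) 0 := by
  have hs' : Φ 0 (c.base.symm u) ∈ c.tot.source := (hV _ hu.2).1 ▸ hs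
  rw [h.prolong_eq h0 hV hu hs]
  have h1 := h.hasDerivAt_jet hD hU h0 hu hs' 1
  simpa using h1

theorem IsFieldFamily.contDiffWithinAt_prolong (h : IsFieldFamily m k ρ U P Φ)
    (h0 : (0 : ℝ) ∈ P) (hV : ∀ x ∈ closure U, Φ 0 x = φ x ∧ V x = velocity m k Φ x)
    (hu : u ∈ c.dom U) (hs : φ (c.base.symm u) ∈ c.tot.source) :
    ContDiffWithinAt ℝ ∞ (c.prolong U φ V) (c.dom U) u := by
  have hs' : Φ 0 (c.base.symm u) ∈ c.tot.source := (hV _ hu.2).1 ▸ hs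
  have h1 := h.contDiffWithinAt_field h0 hu hs'
  have hS : UniqueDiffOn ℝ (P ×ˢ c.dom U) := h.isOpen.uniqueDiffOn.prod (hD c)
  have h2 := (ContDiffWithinAt.fderivWithin_self h1 hS (mk_mem_prod h0 hu)).clm_apply
    (contDiffWithinAt_const (c := ((1 : ℝ), (0 : Coord m))))
  have h3 := ContDiffWithinAt.slice h2 h0
  refine (contDiffWithinAt_const.prodMk (h3.prodMk
    (ContDiffWithinAt.fderivWithin_self h3 (hD c) hu))).congr_of_eventuallyEq ?_
    (h.prolong_eq h0 hV hu hs)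
  filter_upwards [(tendsto_slice h0).eventually (h.eventually_mem_source h0 hu hs'),
    self_mem_nhdsWithin] with v hv hvD
  exact h.prolong_eq h0 hV hvD ((hV _ hvD.2).1 ▸ hv)

end Curve

theorem IsField.contDiffWithinAt_fderiv_lagrangian {φ : X → Y} (h𝓛 : 𝓛.IsSmooth)
    (h : IsField (m := m) (k := k) U ρ φ) (hu : u ∈ c.dom U)
    (hs : φ (c.base.symm u) ∈ c.tot.source) :
    ContDiffWithinAt ℝ ∞ (fun v => fderiv ℝ (c.lagrangian 𝓛) (c.jet U φ v)) (c.dom U) u :=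
  (h𝓛.contDiffAt_fderiv (AdaptedChart.jet_mem h.2 hu hs)).comp_contDiffWithinAt u
    (h.contDiffWithinAt_jet hD hu hs)

/-- The Euler–Lagrange equations, tested with `w`. -/
theorem IsSolution.sum_fderivWithin {φ : X → Y} (h𝓛 : 𝓛.IsSmooth) (h : IsSolution 𝓛 U φ)
    (hu : u ∈ c.base.target) (huU : c.base.symm u ∈ U)
    (hs : φ (c.base.symm u) ∈ c.tot.source) (w : Coord k) :
    ∑ μ, fderivWithin ℝ (fun v => fderiv ℝ (c.lagrangian 𝓛) (c.jet U φ v)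
      (vel (ContinuousLinearMap.proj μ) w)) (c.dom U) u (stdFrame m μ) =
      fderiv ℝ (c.lagrangian 𝓛) (c.jet U φ u) (0, w, 0) := by
  have huD : u ∈ c.dom U := ⟨hu, subset_closure huU⟩
  have h1 := h.2 c _ huU hs
  rw [c.base.right_inv hu] at h1
  have h2 := ((h.1.contDiffWithinAt_fderiv_lagrangian hD h𝓛 huD hs).differentiableWithinAt
    (by simp)).hasFDerivWithinAt
  have h3 : ∀ J : JetCoord m k, fderivWithin ℝ (fun v => fderiv ℝ (c.lagrangian 𝓛) (c.jet U φ v) J)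
      (c.dom U) u = (fderivWithin ℝ (fun v => fderiv ℝ (c.lagrangian 𝓛) (c.jet U φ v))
        (c.dom U) u).flip J := by
    intro J
    rw [(h2.clm_apply (hasFDerivWithinAt_const J u _)).fderivWithin (hD c u huD),
      ContinuousLinearMap.comp_zero, zero_add]
  have hw : ((0, w, 0) : JetCoord m k) = ∑ a, w a • ddy m k a := by
    refine Prod.ext (by simp [ddy, Prod.fst_sum]) (Prod.ext ?_
      (by simp [ddy, Prod.snd_sum]))
    funext b
    simp [ddy, Prod.fst_sum, Prod.snd_sum, Finset.sum_apply, Pi.single_apply]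
  rw [hw, map_sum]
  simp only [h3]
  simp only [vel_proj_eq_sum, map_sum, sum_apply]
  rw [Finset.sum_comm]
  refine Finset.sum_congr rfl fun a _ => ?_
  rw [map_smul, ← sub_eq_zero.1 (h1 a), Finset.smul_sum]
  refine Finset.sum_congr rfl fun μ _ => ?_
  have h4 : fderivWithin ℝ (fun v => c.momentum 𝓛 a μ (c.jet U φ v)) (c.dom U) u = _ :=
    h3 (ddv m k a μ)
  rw [h4, map_smul, smul_apply]
  rfl

/-- The Euler–Lagrange equations linearised along a curve of solutions. -/
theorem IsFieldFamily.sum_fderivWithin_prolong {P : Set ℝ} {Φ : ℝ → X → Y} {φ : X → Y}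
    {V : FieldVariation m k φ} (hU : IsOpen U) (h𝓛 : 𝓛.IsSmooth) (h : IsFieldFamily m k ρ U P Φ)
    (h0 : (0 : ℝ) ∈ P) (hsol : ∀ ε ∈ P, IsSolution 𝓛 U (Φ ε))
    (hV : ∀ x ∈ closure U, Φ 0 x = φ x ∧ V x = velocity m k Φ x)
    (hu : u ∈ c.base.target) (huU : c.base.symm u ∈ U)
    (hs : φ (c.base.symm u) ∈ c.tot.source) (w : Coord k) :
    ∑ μ, fderivWithin ℝ (fun v => fderiv ℝ (fderiv ℝ (c.lagrangian 𝓛)) (c.jet U φ v)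
      (c.prolong U φ V v) (vel (ContinuousLinearMap.proj μ) w)) (c.dom U) u (stdFrame m μ) =
      fderiv ℝ (fderiv ℝ (c.lagrangian 𝓛)) (c.jet U φ u) (c.prolong U φ V u) (0, w, 0) := by
  have huD : u ∈ c.dom U := ⟨hu, subset_closure huU⟩
  have hs' : Φ 0 (c.base.symm u) ∈ c.tot.source := (hV _ huD.2).1 ▸ hs
  have hjet := fun v (hv : v ∈ c.dom U) => c.jet_congr (fun x hx => (hV x hx).1) hv
  have hL : ∀ v ∈ c.dom U, Φ 0 (c.base.symm v) ∈ c.tot.source → ∀ J : JetCoord m k,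
      HasDerivAt (fun ε => fderiv ℝ (c.lagrangian 𝓛) (c.jet U (Φ ε) v) J)
        (fderiv ℝ (fderiv ℝ (c.lagrangian 𝓛)) (c.jet U φ v) (c.prolong U φ V v) J) 0 := by
    intro v hv hvs J
    have h1 := h.hasDerivAt_jet_prolong hD hU h0 hV hv ((hV _ hv.2).1 ▸ hvs)
    have h2 := ((h𝓛.contDiffAt_fderiv (AdaptedChart.jet_mem (h.isField 0 h0).2 hv
      hvs)).differentiableAt (by simp)).hasFDerivAt.comp_hasDerivAt (0 : ℝ) h1
    have h3 := h2.clm_apply (hasDerivAt_const (0 : ℝ) J)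
    simp only [hjet v hv, map_zero, add_zero] at h3
    exact h3
  have hf : ∀ J : JetCoord m k, ContDiffWithinAt ℝ ∞ (fun z : ℝ × Coord m =>
      fderiv ℝ (c.lagrangian 𝓛) (c.jet U (Φ z.1) z.2) J) (P ×ˢ c.dom U) (0, u) := fun J =>
    ((h𝓛.contDiffAt_fderiv (AdaptedChart.jet_mem (h.isField 0 h0).2 huD
      hs')).comp_contDiffWithinAt (0, u) (h.contDiffWithinAt_jet hD h0 huD hs')).clm_apply
      contDiffWithinAt_const
  -- The parameter derivative is moved inside the spatial one, where `hL` evaluates it.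
  have hleft : ∀ J : JetCoord m k, HasDerivAt (fun ε => fderivWithin ℝ (fun v =>
      fderiv ℝ (c.lagrangian 𝓛) (c.jet U (Φ ε) v) J) (c.dom U) u)
      (fderivWithin ℝ (fun v => fderiv ℝ (fderiv ℝ (c.lagrangian 𝓛)) (c.jet U φ v)
        (c.prolong U φ V v) J) (c.dom U) u) 0 := by
    intro J
    have h1 := hasFDerivAt_fderivWithin_slice h.isOpen (hD c) h0 huD
      (subset_closure_interior_preimage hU c.base huD) (hf J) 1
    have h2 : ∀ v ∈ c.dom U, Φ 0 (c.base.symm v) ∈ c.tot.source →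
        DifferentiableWithinAt ℝ (fun z : ℝ × Coord m =>
          fderiv ℝ (c.lagrangian 𝓛) (c.jet U (Φ z.1) z.2) J) (P ×ˢ c.dom U) (0, v) →
        fderivWithin ℝ (fun z : ℝ × Coord m =>
          fderiv ℝ (c.lagrangian 𝓛) (c.jet U (Φ z.1) z.2) J) (P ×ˢ c.dom U) (0, v) (1, 0) =
        fderiv ℝ (fderiv ℝ (c.lagrangian 𝓛)) (c.jet U φ v) (c.prolong U φ V v) J := by
      intro v hv hvs hd
      exact (hasFDerivAt_slice_left h.isOpen h0 hv hd).hasDerivAt.unique (hL v hv hvs J)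
    have h3 := h2 u huD hs' ((hf J).differentiableWithinAt (by simp))
    have h4 : (fun v => fderivWithin ℝ (fun z : ℝ × Coord m =>
          fderiv ℝ (c.lagrangian 𝓛) (c.jet U (Φ z.1) z.2) J) (P ×ˢ c.dom U) (0, v) (1, 0))
        =ᶠ[𝓝[c.dom U] u] fun v => fderiv ℝ (fderiv ℝ (c.lagrangian 𝓛)) (c.jet U φ v)
          (c.prolong U φ V v) J := by
      filter_upwards [(tendsto_slice h0).eventually (h.eventually_mem_source h0 huD hs'),
        (tendsto_slice h0).eventually (eventually_differentiableWithinAt (hf J)),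
        self_mem_nhdsWithin] with v hv1 hv2 hvD
      exact h2 v hvD hv1 hv2
    rw [h4.fderivWithin_eq h3] at h1
    simpa using h1
  have h5 : HasDerivAt (fun ε => ∑ μ, fderivWithin ℝ (fun v => fderiv ℝ (c.lagrangian 𝓛)
      (c.jet U (Φ ε) v) (vel (ContinuousLinearMap.proj μ) w)) (c.dom U) u (stdFrame m μ))
      (∑ μ, fderivWithin ℝ (fun v => fderiv ℝ (fderiv ℝ (c.lagrangian 𝓛)) (c.jet U φ v)
        (c.prolong U φ V v) (vel (ContinuousLinearMap.proj μ) w)) (c.dom U) u (stdFrame m μ)) 0 := by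
    refine HasDerivAt.fun_sum fun μ _ => ?_
    have h6 := (hleft (vel (ContinuousLinearMap.proj μ) w)).clm_apply
      (hasDerivAt_const (0 : ℝ) (stdFrame m μ))
    rw [map_zero, add_zero] at h6
    exact h6
  -- The Euler–Lagrange equations hold for all small `ε`, so both sides of the linearised equation
  -- are derivatives of the same function of `ε`.
  refine h5.unique ((hL u huD hs' (0, w, 0)).congr_of_eventuallyEq ?_)
  have h7 := (tendsto_line (D := c.dom U) h.isOpen h0 huD (1 : ℝ)).eventually
    ((h.eventually_mem_source h0 huD hs').and self_mem_nhdsWithin)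
  filter_upwards [h7] with ε hε
  rw [zero_add, smul_eq_mul, mul_one] at hε
  exact (hsol ε hε.2.1).sum_fderivWithin hD h𝓛 hu huU hε.1 w

end Variations

/-! ### Independence of the adapted chart -/

section ChartIndependence

variable {m k : ℕ} {X : Type*} [TopologicalSpace X] [ChartedSpace (Coord m) X]
  {Y : Type*} [TopologicalSpace Y] [ChartedSpace (Coord m × Coord k) Y]
  {ρ : Y → X} {U : Set X} {c c' : AdaptedChart m k ρ} {u : Coord m} {φ : X → Y}

/-- At each point `formAlong` uses an arbitrarily chosen adapted chart. The compatibility `hloc`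
makes the choice immaterial. -/
theorem formAlong_inChart {p : ℕ} {loc : AdaptedChart m k ρ → Coord m → Coord m [⋀^Fin p]→L[ℝ] ℝ}
    (hφ : ∀ x ∈ closure U, ρ (φ x) = x)
    (hloc : ∀ c c' : AdaptedChart m k ρ, ∀ u ∈ c.dom U, φ (c.base.symm u) ∈ c.tot.source →
      φ (c.base.symm u) ∈ c'.tot.source →
      loc c u = (loc c' (c'.base (c.base.symm u))).compContinuousLinearMap
        (transD c.base c'.base u))
    (hu : u ∈ c.dom U) (hs : φ (c.base.symm u) ∈ c.tot.source) :
    (formAlong φ loc).inChart c.base u = loc c u := by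
  have hex : ∃ c : AdaptedChart m k ρ, φ (c.base.symm u) ∈ c.tot.source := ⟨c, hs⟩
  have hex' : ∃ c' : AdaptedChart m k ρ, φ (c.base.symm u) ∈ c'.tot.source := ⟨c, hs⟩
  have h1 : formAlong φ loc (c.base.symm u) =
      (loc hex'.choose (hex'.choose.base (c.base.symm u))).compContinuousLinearMap
        (chartD hex'.choose.base (c.base.symm u)) := dif_pos hex'
  have hs' := hex'.choose_spec
  set c' := hex'.choose
  have hb : c.base.symm u ∈ c'.base.source := by
    have := (c'.adapted _ hs').1
    rwa [hφ _ hu.2] at this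
  rw [DForm.inChart_eq, h1, hloc c c' u hu hs hs',
    transD_eq_comp c.base_smooth c'.base_smooth hu.1 hb]
  rfl

theorem AdaptedChart.overlap_mem (hφ : ∀ x ∈ closure U, ρ (φ x) = x) (hu : u ∈ c.dom U)
    (hs : φ (c.base.symm u) ∈ c.tot.source) (hs' : φ (c.base.symm u) ∈ c'.tot.source) :
    (u, c.field φ u) ∈ c.overlap c' := by
  rw [← c.tot_symm_field hφ hu hs]
  exact ⟨c.tot.map_source hs, by rwa [mem_preimage, c.tot.left_inv hs]⟩

theorem AdaptedChart.mem_dom_of_mem (hφ : ∀ x ∈ closure U, ρ (φ x) = x) (hu : u ∈ c.dom U)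
    (hs' : φ (c.base.symm u) ∈ c'.tot.source) :
    c.base.symm u ∈ c'.base.source ∧ c'.base (c.base.symm u) ∈ c'.dom U := by
  have h1 := (c'.adapted _ hs').1
  rw [hφ _ hu.2] at h1
  exact ⟨h1, c'.mem_dom h1 hu.2⟩

variable (hD : ∀ c : AdaptedChart m k ρ, UniqueDiffOn ℝ (c.dom U))
include hD

/-- The jet of a field in two adapted charts. -/
theorem IsField.jet_jetTrans (h : IsField (m := m) (k := k) U ρ φ) (hu : u ∈ c.dom U)
    (hs : φ (c.base.symm u) ∈ c.tot.source) (hs' : φ (c.base.symm u) ∈ c'.tot.source) :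
    c'.jet U φ (c'.base (c.base.symm u)) = c.jetTrans c' (c.jet U φ u) := by
  obtain ⟨hb, hu'⟩ := AdaptedChart.mem_dom_of_mem h.2 hu hs'
  set u' := c'.base (c.base.symm u) with hu'_def
  have hsymm : c'.base.symm u' = c.base.symm u := c'.base.left_inv hb
  have hg : (c.base ∘ c'.base.symm) u' = u := by
    rw [Function.comp_apply, hsymm, c.base.right_inv hu.1]
  have hmem := eventually_mem_overlap (e := c'.base) (e' := c.base) hu'.1
    (by rw [hsymm]; exact c.base.map_target hu.1)
  have hgd := hasFDerivAt_transition c'.base_smooth c.base_smooth hu'.1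
    (by rw [hsymm]; exact c.base.map_target hu.1)
  have htend : Filter.Tendsto (c.base ∘ c'.base.symm) (𝓝[c'.dom U] u')
      (𝓝[c.dom U] ((c.base ∘ c'.base.symm) u')) := by
    refine tendsto_nhdsWithin_iff.2 ⟨hgd.continuousAt.continuousWithinAt.tendsto, ?_⟩
    filter_upwards [nhdsWithin_le_nhds hmem, self_mem_nhdsWithin] with v hv hvD
    exact c.mem_dom hv.2 hvD.2
  have hfield : ∀ v ∈ c'.dom U, c'.base.symm v ∈ c.base.source →
      φ (c'.base.symm v) ∈ c.tot.source →
      c'.field φ v = c.fibTrans c' ((c.base ∘ c'.base.symm) v,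
        c.field φ ((c.base ∘ c'.base.symm) v)) := by
    intro v hv hvs hvt
    have h1 : c.base.symm ((c.base ∘ c'.base.symm) v) = c'.base.symm v := c.base.left_inv hvs
    have h2 := c.tot_symm_field h.2 (c.mem_dom hvs hv.2) (h1.symm ▸ hvt)
    rw [c.base.left_inv hvs] at h2
    simp only [Function.comp_apply]
    rw [AdaptedChart.fibTrans, ← h2, c.tot.left_inv hvt]
    rfl
  have hF : HasFDerivWithinAt (fun v => c.fibTrans c' (v, c.field φ v))
      ((fderiv ℝ (c.fibTrans c') (u, c.field φ u)).comp ((ContinuousLinearMap.id ℝ (Coord m)).prod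
        (fderivWithin ℝ (c.field φ) (c.dom U) u))) (c.dom U) u := by
    have h1 : HasFDerivAt (c.fibTrans c') _ (u, c.field φ u) :=
      ((AdaptedChart.contDiffAt_fibTrans (AdaptedChart.overlap_mem h.2 hu hs hs')).differentiableAt
        (by simp)).hasFDerivAt
    exact HasFDerivAt.comp_hasFDerivWithinAt (g := c.fibTrans c') u h1 ((hasFDerivWithinAt_id u _).prodMk
      (c.hasFDerivWithinAt_field (h.mdifferentiableWithinAt hu.2) hu
        hs).differentiableWithinAt.hasFDerivWithinAt)
  have h0 := hfield u' hu' (by rw [hsymm]; exact c.base.map_target hu.1) (by rwa [hsymm])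
  -- The components in `c'` are those in `c` after the inverse base change, followed by the fibre
  -- transition; the chain rule yields the three factors of `jetTrans`.
  have hcomp := HasFDerivWithinAt.comp_of_tendsto (x := u') (f := c.base ∘ c'.base.symm)
    (g := fun v => c.fibTrans c' (v, c.field φ v)) (by rw [hg]; exact hF)
    hgd.hasFDerivWithinAt htend
  have hev : c'.field φ =ᶠ[𝓝[c'.dom U] u']
      ((fun v => c.fibTrans c' (v, c.field φ v)) ∘ (c.base ∘ c'.base.symm)) := by
    filter_upwards [nhdsWithin_le_nhds hmem, self_mem_nhdsWithin,
      (c'.continuousWithinAt_comp_symm (h.1.continuousOn _ hu'.2) hu').preimage_mem_nhdsWithin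
        (c.tot.open_source.mem_nhds (by rwa [hsymm]))] with v hv hvD hvs
    exact hfield v hvD hv.2 hvs
  have hder := (hcomp.congr_of_eventuallyEq hev h0).fderivWithin (hD c' u' hu')
  rw [hg] at h0
  exact Prod.ext rfl (Prod.ext h0 hder)

/-- The prolongation of a variation in two adapted charts. -/
theorem IsFieldFamily.prolong_vertTrans {P : Set ℝ} {Φ : ℝ → X → Y} {V : FieldVariation m k φ}
    (hU : IsOpen U) (h : IsFieldFamily m k ρ U P Φ) (h0 : (0 : ℝ) ∈ P)
    (hφ : ∀ x ∈ closure U, ρ (φ x) = x)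
    (hV : ∀ x ∈ closure U, Φ 0 x = φ x ∧ V x = velocity m k Φ x)
    (hu : u ∈ c.dom U) (hs : φ (c.base.symm u) ∈ c.tot.source)
    (hs' : φ (c.base.symm u) ∈ c'.tot.source) :
    c'.prolong U φ V (c'.base (c.base.symm u)) =
      c.vertTrans c' (c.jet U φ u) (c.prolong U φ V u) := by
  obtain ⟨hb, hu'⟩ := AdaptedChart.mem_dom_of_mem hφ hu hs'
  have hsymm : c'.base.symm (c'.base (c.base.symm u)) = c.base.symm u := c'.base.left_inv hb
  have h1 := h.hasDerivAt_jet_prolong hD hU h0 hV hu' (by rwa [hsymm])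
  have h2 := h.hasDerivAt_jet_prolong hD hU h0 hV hu hs
  have h3 : c.jet U (Φ 0) u = c.jet U φ u := c.jet_congr (fun x hx => (hV x hx).1) hu
  have h4 := AdaptedChart.hasDerivAt_jetTrans (c := c) (c' := c') h2
    (Filter.Eventually.of_forall fun τ => rfl)
    (by rw [h3]; exact AdaptedChart.overlap_mem hφ hu hs hs')
  rw [h3] at h4
  -- For small `ε` the jets of the curve in the two charts are related by `jetTrans`; both sides are
  -- derivatives of this curve of jets at zero.
  refine h1.unique (h4.congr_of_eventuallyEq ?_)
  have h00 : Φ 0 (c.base.symm u) = φ (c.base.symm u) := (hV _ hu.2).1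
  have h5 := (tendsto_line (D := c.dom U) h.isOpen h0 hu (1 : ℝ)).eventually
    ((h.eventually_mem_source h0 hu (h00 ▸ hs)).and self_mem_nhdsWithin)
  have h6 := (tendsto_line (D := c'.dom U) h.isOpen h0 hu' (1 : ℝ)).eventually
    (h.eventually_mem_source (c := c') h0 hu' (by rw [hsymm]; exact h00 ▸ hs'))
  filter_upwards [h5, h6] with ε hε hε'
  simp only [zero_add, smul_eq_mul, mul_one, hsymm] at hε hε'
  exact (h.isField ε hε.2.1).jet_jetTrans hD hu hε.1 hε'

end ChartIndependence

/-! ### The boundary forms as flux forms in every adapted chart -/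

section BoundaryFormsInCharts

variable {n k : ℕ} {X : Type*} [TopologicalSpace X] [ChartedSpace (Coord (n + 1)) X]
  {Y : Type*} [TopologicalSpace Y] [ChartedSpace (Coord (n + 1) × Coord k) Y]
  {ρ : Y → X} {U : Set X} {c : AdaptedChart (n + 1) k ρ} {u : Coord (n + 1)} {φ : X → Y}
  {𝓛 : LagrangianDensity (n + 1) k ρ}
  (hD : ∀ c : AdaptedChart (n + 1) k ρ, UniqueDiffOn ℝ (c.dom U))
include hD

theorem IsField.theta_local (h : IsField (m := n + 1) (k := k) U ρ φ)
    (V : FieldVariation (n + 1) k φ) (hu : u ∈ c.dom U)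
    (hs : φ (c.base.symm u) ∈ c.tot.source) :
    ((c.poincareCartan 𝓛 (c.jet U φ u)).curryLeft (c.prolong U φ V u)).compContinuousLinearMap
      (c.dJet U φ u) = fluxForm (c.thetaFlux 𝓛 (c.jet U φ u) (c.prolong U φ V u).2.1) := by
  ext v
  have h1 := c.poincareCartan_cons 𝓛 (c.jet U φ u) (J := c.prolong U φ V u) rfl
    fun i => c.dJet U φ u (v i)
  simp only [(h.dJet_apply hD hu hs _).1] at h1
  exact h1

theorem IsField.omega_local (h : IsField (m := n + 1) (k := k) U ρ φ) (h𝓛 : 𝓛.IsSmooth)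
    (V W : FieldVariation (n + 1) k φ) (hu : u ∈ c.dom U)
    (hs : φ (c.base.symm u) ∈ c.tot.source) :
    (((c.multisymplectic 𝓛 (c.jet U φ u)).curryLeft (c.prolong U φ V u)).curryLeft
      (c.prolong U φ W u)).compContinuousLinearMap (c.dJet U φ u) =
      fluxForm (c.omegaFlux 𝓛 (c.jet U φ u) (c.prolong U φ V u) (c.prolong U φ W u)) := by
  ext v
  have h1 := AdaptedChart.multisymplectic_cons_cons h𝓛 (AdaptedChart.jet_mem h.2 hu hs)
    (J := c.prolong U φ V u) (J' := c.prolong U φ W u) rfl rfl fun i => c.dJet U φ u (v i)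
  simp only [(h.dJet_apply hD hu hs _).1] at h1
  exact h1

variable {P P' : Set ℝ} {Φ Φ' : ℝ → X → Y} {V W : FieldVariation (n + 1) k φ}

theorem thetaForm_inChart (hU : IsOpen U) (h𝓛 : 𝓛.IsSmooth)
    (hf : IsField (m := n + 1) (k := k) U ρ φ) (h : IsFieldFamily (n + 1) k ρ U P Φ)
    (h0 : (0 : ℝ) ∈ P) (hV : ∀ x ∈ closure U, Φ 0 x = φ x ∧ V x = velocity (n + 1) k Φ x)
    (hu : u ∈ c.dom U) (hs : φ (c.base.symm u) ∈ c.tot.source) :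
    (thetaForm 𝓛 U φ V).inChart c.base u =
      fluxForm (c.thetaFlux 𝓛 (c.jet U φ u) (c.prolong U φ V u).2.1) := by
  refine (formAlong_inChart hf.2 (fun c c' u hu hs hs' => ?_) hu hs).trans
    (hf.theta_local hD V hu hs)
  obtain ⟨hb, hu'⟩ := AdaptedChart.mem_dom_of_mem hf.2 hu hs'
  have hsymm : c'.base.symm (c'.base (c.base.symm u)) = c.base.symm u := c'.base.left_inv hb
  have hj := AdaptedChart.overlap_mem hf.2 hu hs hs'
  rw [hf.theta_local hD V hu hs, hf.theta_local hD V hu' (by rwa [hsymm]),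
    hf.jet_jetTrans hD hu hs hs', h.prolong_vertTrans hD hU h0 hf.2 hV hu hs hs']
  exact (fluxForm_comp _ _ _ (det_transD_ne_zero c.base_smooth c'.base_smooth hu.1 hb)
    (AdaptedChart.thetaFlux_jetTrans h𝓛 (j := c.jet U φ u) hj _)).symm

theorem omegaForm_inChart (hU : IsOpen U) (h𝓛 : 𝓛.IsSmooth)
    (hf : IsField (m := n + 1) (k := k) U ρ φ) (h : IsFieldFamily (n + 1) k ρ U P Φ)
    (h0 : (0 : ℝ) ∈ P) (hV : ∀ x ∈ closure U, Φ 0 x = φ x ∧ V x = velocity (n + 1) k Φ x)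
    (h' : IsFieldFamily (n + 1) k ρ U P' Φ') (h0' : (0 : ℝ) ∈ P')
    (hW : ∀ x ∈ closure U, Φ' 0 x = φ x ∧ W x = velocity (n + 1) k Φ' x)
    (hu : u ∈ c.dom U) (hs : φ (c.base.symm u) ∈ c.tot.source) :
    (omegaForm 𝓛 U φ V W).inChart c.base u =
      fluxForm (c.omegaFlux 𝓛 (c.jet U φ u) (c.prolong U φ V u) (c.prolong U φ W u)) := by
  refine (formAlong_inChart hf.2 (fun c c' u hu hs hs' => ?_) hu hs).trans
    (hf.omega_local hD h𝓛 V W hu hs)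
  obtain ⟨hb, hu'⟩ := AdaptedChart.mem_dom_of_mem hf.2 hu hs'
  have hsymm : c'.base.symm (c'.base (c.base.symm u)) = c.base.symm u := c'.base.left_inv hb
  have hj := AdaptedChart.overlap_mem hf.2 hu hs hs'
  rw [hf.omega_local hD h𝓛 V W hu hs, hf.omega_local hD h𝓛 V W hu' (by rwa [hsymm]),
    hf.jet_jetTrans hD hu hs hs', h.prolong_vertTrans hD hU h0 hf.2 hV hu hs hs',
    h'.prolong_vertTrans hD hU h0' hf.2 hW hu hs hs']
  exact (fluxForm_comp _ _ _ (det_transD_ne_zero c.base_smooth c'.base_smooth hu.1 hb)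
    (AdaptedChart.omegaFlux_jetTrans h𝓛 (j := c.jet U φ u) hj rfl rfl)).symm

end BoundaryFormsInCharts

/-! ### The boundary forms and their exterior derivatives -/

section Primitives

variable {n k : ℕ} {X : Type*} [TopologicalSpace X] [ChartedSpace (Coord (n + 1)) X]
  {Y : Type*} [TopologicalSpace Y] [ChartedSpace (Coord (n + 1) × Coord k) Y]
  {ρ : Y → X} {U K : Set X} {φ : X → Y} {𝒪 : OrientedAtlas (n + 1) X}
  {𝓛 : LagrangianDensity (n + 1) k ρ}

theorem uniqueDiffOn_dom (hU : IsOpen U) (hb : HasSmoothBoundary 𝒪 U)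
    (c : AdaptedChart (n + 1) k ρ) : UniqueDiffOn ℝ (c.dom U) :=
  uniqueDiffOn_preimage_closure hU hb c.base_smooth

theorem ContDiffAt.fderiv_fderiv {E F : Type*} [NormedAddCommGroup E] [NormedSpace ℝ E]
    [NormedAddCommGroup F] [NormedSpace ℝ F] {f : E → F} {x : E} (h : ContDiffAt ℝ ∞ f x) :
    ContDiffAt ℝ ∞ (fderiv ℝ (fderiv ℝ f)) x := by
  have h1 : ContDiffAt ℝ ∞ (fderiv ℝ f) x := h.fderiv_right (by simp)
  exact h1.fderiv_right (by simp)

/-- The sign in the components of a flux form cancels the one in the exterior derivative, which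
leaves the divergence. Every positive chart is the base of an adapted chart around the field, so
data in adapted charts suffice; over `U` one-sided derivatives are ordinary ones. -/
theorem isPrimitive_of_flux [IsManifold (mdlTot (n + 1) k) ∞ Y]
    {F : Type*} [TopologicalSpace F] [ChartedSpace (Coord k) F] [IsManifold (mdl k) ∞ F]
    (hρ : IsSmoothFiberBundle (n + 1) k F ρ) (hU : IsOpen U)
    (hf : IsField (m := n + 1) (k := k) U ρ φ) {α : DForm (n + 1) X n}
    {η : DForm (n + 1) X (n + 1)} {Z : AdaptedChart (n + 1) k ρ → Coord (n + 1) → Coord (n + 1)}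
    (hα : ∀ c : AdaptedChart (n + 1) k ρ, ∀ u ∈ c.dom U, φ (c.base.symm u) ∈ c.tot.source →
      α.inChart c.base u = fluxForm (Z c u))
    (hZ : ∀ c : AdaptedChart (n + 1) k ρ, ∀ u ∈ c.dom U, φ (c.base.symm u) ∈ c.tot.source →
      ContDiffWithinAt ℝ ∞ (Z c) (c.dom U) u)
    (hη : ∀ c : AdaptedChart (n + 1) k ρ, ∀ u ∈ c.base.target, c.base.symm u ∈ U →
      φ (c.base.symm u) ∈ c.tot.source → η.inChart c.base u (stdFrame (n + 1)) =
        ∑ μ, fderivWithin ℝ (fun v => Z c v μ) (c.dom U) u (stdFrame (n + 1) μ))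
    (hηc : ∀ e, 𝒪.IsPositive e → ContinuousOn (fun u => η.inChart e u (stdFrame (n + 1)))
      (e.target ∩ e.symm ⁻¹' closure U))
    (h0 : ∀ x ∈ closure U, x ∉ K → α x = 0) (h0' : ∀ x ∈ U, x ∉ K → η x = 0) :
    IsPrimitive 𝒪 U K α η := by
  have hchart : ∀ e, 𝒪.IsPositive e → ∀ u ∈ e.target ∩ e.symm ⁻¹' closure U,
      ∃ c : AdaptedChart (n + 1) k ρ, c.base = e ∧ φ (e.symm u) ∈ c.tot.source := by
    intro e he u hu
    exact hρ.exists_adaptedChart he.1 (by rw [hf.2 _ hu.2]; exact e.map_target hu.1)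
  have hcomp : ∀ c : AdaptedChart (n + 1) k ρ, ∀ u ∈ c.dom U, φ (c.base.symm u) ∈ c.tot.source →
      ∀ μ, (fun v => α.inChart c.base v (omitFrame μ)) =ᶠ[𝓝[c.dom U] u]
        fun v => (-1) ^ (μ : ℕ) * Z c v μ := by
    intro c u hu hs μ
    filter_upwards [hf.eventually_mem_source hu hs, self_mem_nhdsWithin] with v hv hvD
    rw [hα c v hvD hv, fluxForm_omitFrame]
  have hZμ : ∀ c : AdaptedChart (n + 1) k ρ, ∀ u ∈ c.dom U, φ (c.base.symm u) ∈ c.tot.source →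
      ∀ μ, ContDiffWithinAt ℝ ∞ (fun v => Z c v μ) (c.dom U) u := fun c u hu hs μ =>
    contDiffWithinAt_pi.1 (hZ c u hu hs) μ
  have hnhds : ∀ c : AdaptedChart (n + 1) k ρ, ∀ u ∈ c.base.target, c.base.symm u ∈ U →
      c.dom U ∈ 𝓝 u := fun c u hu huU =>
    Filter.mem_of_superset ((c.base.isOpen_inter_preimage_symm hU).mem_nhds ⟨hu, huU⟩)
      (inter_subset_inter_right _ (preimage_mono subset_closure))
  refine ⟨fun e he μ u hu => ?_, hηc, fun e he μ u hu => ?_, fun e he u hu => ?_, h0, h0'⟩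
  · obtain ⟨c, rfl, hs⟩ := hchart e he u hu
    exact (continuousWithinAt_const.mul (hZμ c u hu hs μ).continuousWithinAt).congr_of_eventuallyEq
      (hcomp c u hu hs μ) ((hcomp c u hu hs μ).self_of_nhdsWithin hu)
  · have hu' : u ∈ e.target ∩ e.symm ⁻¹' closure U := ⟨hu.1, subset_closure hu.2⟩
    obtain ⟨c, rfl, hs⟩ := hchart e he u hu'
    have hn := hnhds c u hu.1 hu.2
    have h1 := hcomp c u hu' hs μ
    rw [nhdsWithin_eq_nhds.2 hn] at h1
    exact ((((hZμ c u hu' hs μ).contDiffAt hn).differentiableAt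
      (by simp)).const_mul _).congr_of_eventuallyEq h1
  · have hu' : u ∈ e.target ∩ e.symm ⁻¹' closure U := ⟨hu.1, subset_closure hu.2⟩
    obtain ⟨c, rfl, hs⟩ := hchart e he u hu'
    have hn := hnhds c u hu.1 hu.2
    rw [hη c u hu.1 hu.2 hs]
    refine Finset.sum_congr rfl fun μ _ => ?_
    have h1 := hcomp c u hu' hs μ
    rw [nhdsWithin_eq_nhds.2 hn] at h1
    have h2 : DifferentiableAt ℝ (fun v => Z c v μ) u :=
      ((hZμ c u hu' hs μ).contDiffAt hn).differentiableAt (by simp)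
    rw [h1.fderiv_eq, fderiv_const_mul h2, fderivWithin_of_mem_nhds hn, smul_apply, smul_eq_mul,
      ← mul_assoc, ← mul_pow]
    simp

variable {P P' : Set ℝ} {Φ Φ' : ℝ → X → Y} {V W : FieldVariation (n + 1) k φ}

theorem IsFieldFamily.contDiffWithinAt_thetaFlux
    (hD : ∀ c : AdaptedChart (n + 1) k ρ, UniqueDiffOn ℝ (c.dom U)) (h𝓛 : 𝓛.IsSmooth)
    (hf : IsField (m := n + 1) (k := k) U ρ φ) (h : IsFieldFamily (n + 1) k ρ U P Φ)
    (h0 : (0 : ℝ) ∈ P) (hV : ∀ x ∈ closure U, Φ 0 x = φ x ∧ V x = velocity (n + 1) k Φ x)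
    {c : AdaptedChart (n + 1) k ρ} {u : Coord (n + 1)} (hu : u ∈ c.dom U)
    (hs : φ (c.base.symm u) ∈ c.tot.source) :
    ContDiffWithinAt ℝ ∞ (fun v => c.thetaFlux 𝓛 (c.jet U φ v) (c.prolong U φ V v).2.1)
      (c.dom U) u := by
  refine contDiffWithinAt_pi.2 fun μ => ?_
  refine (hf.contDiffWithinAt_fderiv_lagrangian hD h𝓛 hu hs).clm_apply ?_
  simp only [vel_eq]
  exact (ContinuousLinearMap.contDiff _).comp_contDiffWithinAt
    (h.contDiffWithinAt_prolong hD h0 hV hu hs).snd.fst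

theorem IsFieldFamily.contDiffWithinAt_fderiv_fderiv
    (hD : ∀ c : AdaptedChart (n + 1) k ρ, UniqueDiffOn ℝ (c.dom U)) (h𝓛 : 𝓛.IsSmooth)
    (hf : IsField (m := n + 1) (k := k) U ρ φ) (h : IsFieldFamily (n + 1) k ρ U P Φ)
    (h0 : (0 : ℝ) ∈ P) (hV : ∀ x ∈ closure U, Φ 0 x = φ x ∧ V x = velocity (n + 1) k Φ x)
    {c : AdaptedChart (n + 1) k ρ} {u : Coord (n + 1)} (hu : u ∈ c.dom U)
    (hs : φ (c.base.symm u) ∈ c.tot.source) :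
    ContDiffWithinAt ℝ ∞ (fun v => fderiv ℝ (fderiv ℝ (c.lagrangian 𝓛)) (c.jet U φ v)
      (c.prolong U φ V v)) (c.dom U) u := by
  have h1 := ContDiffAt.fderiv_fderiv (h𝓛.contDiffAt (AdaptedChart.jet_mem hf.2 hu hs))
  exact (h1.comp_contDiffWithinAt u (hf.contDiffWithinAt_jet hD hu hs)).clm_apply
    (h.contDiffWithinAt_prolong hD h0 hV hu hs)

/-- Off the support of a variation its prolongation vanishes. -/
theorem prolong_eq_zero (hK : IsClosed K) (hV : ∀ x ∈ closure U \ K, V x = 0)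
    {c : AdaptedChart (n + 1) k ρ} {u : Coord (n + 1)} (hu : u ∈ c.dom U)
    (huK : c.base.symm u ∉ K) : c.prolong U φ V u = 0 := by
  have h1 : ∀ v ∈ c.dom U, c.base.symm v ∉ K → c.variation φ V v = 0 := by
    intro v hv hvK
    rw [AdaptedChart.variation, hV _ ⟨hv.2, hvK⟩]
    exact congrArg Prod.snd (map_zero (c.totD (φ (c.base.symm v))))
  have h2 : c.variation φ V =ᶠ[𝓝[c.dom U] u] fun _ => 0 := by
    filter_upwards [self_mem_nhdsWithin, nhdsWithin_le_nhds
      ((c.base.continuousAt_symm hu.1).preimage_mem_nhds (hK.isOpen_compl.mem_nhds huK))]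
      with v hv hvK
    exact h1 v hv hvK
  have h3 := h2.fderivWithin_eq (𝕜 := ℝ) (h1 u hu huK)
  rw [AdaptedChart.prolong, h1 u hu huK, h3, fderivWithin_fun_const]
  rfl

theorem omegaFlux_eq_zero {c : AdaptedChart (n + 1) k ρ} {j J J' : JetCoord (n + 1) k}
    (h : J = 0 ∨ J' = 0) : c.omegaFlux 𝓛 j J J' = 0 := by
  funext μ
  have h0 : (vel (ContinuousLinearMap.proj μ) 0 : JetCoord (n + 1) k) = 0 := by
    rw [vel_eq, map_zero]
  rcases h with rfl | rfl <;>
    simp [AdaptedChart.omegaFlux, h0]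

theorem DForm.eq_inChart_comp {p : ℕ} (α : DForm (n + 1) X p)
    {e : OpenPartialHomeomorph X (Coord (n + 1))}
    (he : e ∈ IsManifold.maximalAtlas (mdl (n + 1)) ∞ X) {x : X} (hx : x ∈ e.source) :
    α x = (α.inChart e (e x)).compContinuousLinearMap (chartD e x) := by
  rw [DForm.inChart_eq, e.left_inv hx]
  ext v
  change (α x : Coord (n + 1) [⋀^Fin p]→L[ℝ] ℝ) v =
    (α x : Coord (n + 1) [⋀^Fin p]→L[ℝ] ℝ) fun i => ((symmD e (e x)).comp (chartD e x)) (v i)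
  rw [symmD_comp_chartD he hx]
  rfl

/-- The multisymplectic current of two first variations is closed. -/
theorem isPrimitive_omegaForm [IsManifold (mdlTot (n + 1) k) ∞ Y]
    {F : Type*} [TopologicalSpace F] [ChartedSpace (Coord k) F] [IsManifold (mdl k) ∞ F]
    (hρ : IsSmoothFiberBundle (n + 1) k F ρ) (hU : IsOpen U)
    (hb : HasSmoothBoundary 𝒪 U) (h𝓛 : 𝓛.IsSmooth)
    (hf : IsField (m := n + 1) (k := k) U ρ φ) (h : IsFieldFamily (n + 1) k ρ U P Φ)
    (h0 : (0 : ℝ) ∈ P) (hsol : ∀ ε ∈ P, IsSolution 𝓛 U (Φ ε))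
    (hV : ∀ x ∈ closure U, Φ 0 x = φ x ∧ V x = velocity (n + 1) k Φ x)
    (h' : IsFieldFamily (n + 1) k ρ U P' Φ') (h0' : (0 : ℝ) ∈ P')
    (hsol' : ∀ ε ∈ P', IsSolution 𝓛 U (Φ' ε))
    (hW : ∀ x ∈ closure U, Φ' 0 x = φ x ∧ W x = velocity (n + 1) k Φ' x)
    (hK : IsClosed K)
    (hVW : (∀ x ∈ closure U \ K, V x = 0) ∨ (∀ x ∈ closure U \ K, W x = 0)) :
    IsPrimitive 𝒪 U K (omegaForm 𝓛 U φ V W) 0 := by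
  have hD := uniqueDiffOn_dom (k := k) (ρ := ρ) hU hb
  have hα := fun (c : AdaptedChart (n + 1) k ρ) u (hu : u ∈ c.dom U)
    (hs : φ (c.base.symm u) ∈ c.tot.source) =>
      omegaForm_inChart hD hU h𝓛 hf h h0 hV h' h0' hW hu hs
  have hLV := fun (c : AdaptedChart (n + 1) k ρ) u (hu : u ∈ c.dom U)
    (hs : φ (c.base.symm u) ∈ c.tot.source) =>
      h.contDiffWithinAt_fderiv_fderiv hD h𝓛 hf h0 hV hu hs
  have hLW := fun (c : AdaptedChart (n + 1) k ρ) u (hu : u ∈ c.dom U)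
    (hs : φ (c.base.symm u) ∈ c.tot.source) =>
      h'.contDiffWithinAt_fderiv_fderiv hD h𝓛 hf h0' hW hu hs
  have hpV := fun (c : AdaptedChart (n + 1) k ρ) u (hu : u ∈ c.dom U)
    (hs : φ (c.base.symm u) ∈ c.tot.source) =>
      (h.contDiffWithinAt_prolong hD h0 hV hu hs).snd.fst
  have hpW := fun (c : AdaptedChart (n + 1) k ρ) u (hu : u ∈ c.dom U)
    (hs : φ (c.base.symm u) ∈ c.tot.source) =>
      (h'.contDiffWithinAt_prolong hD h0' hW hu hs).snd.fst
  have hflux : ∀ c : AdaptedChart (n + 1) k ρ, ∀ u ∈ c.dom U,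
      φ (c.base.symm u) ∈ c.tot.source → ∀ μ,
      ContDiffWithinAt ℝ ∞ (fun v => fderiv ℝ (fderiv ℝ (c.lagrangian 𝓛)) (c.jet U φ v)
        (c.prolong U φ W v) (vel (ContinuousLinearMap.proj μ) (c.prolong U φ V v).2.1))
        (c.dom U) u ∧
      ContDiffWithinAt ℝ ∞ (fun v => fderiv ℝ (fderiv ℝ (c.lagrangian 𝓛)) (c.jet U φ v)
        (c.prolong U φ V v) (vel (ContinuousLinearMap.proj μ) (c.prolong U φ W v).2.1))
        (c.dom U) u := by
    intro c u hu hs μ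
    simp only [vel_eq]
    exact ⟨(hLW c u hu hs).clm_apply ((ContinuousLinearMap.contDiff _).comp_contDiffWithinAt
      (hpV c u hu hs)), (hLV c u hu hs).clm_apply
        ((ContinuousLinearMap.contDiff _).comp_contDiffWithinAt (hpW c u hu hs))⟩
  refine isPrimitive_of_flux hρ hU hf hα (fun c u hu hs => contDiffWithinAt_pi.2 fun μ =>
    (hflux c u hu hs μ).1.sub (hflux c u hu hs μ).2) (fun c u hu huU hs => ?_)
    (fun e _ => continuousOn_const) (fun x hx hxK => ?_) fun _ _ _ => rfl
  · have huD : u ∈ c.dom U := ⟨hu, subset_closure huU⟩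
    -- The flux is a difference of two terms. In the first, `Λ = D²L(j¹W, ·)` is paired with `V`; in
    -- the second, `Λ = D²L(j¹V, ·)` with `W`. Their divergences are the same second derivative with
    -- its arguments exchanged.
    have h1 := sum_fderivWithin_flux (hD c) huD
      ((hLW c u huD hs).differentiableWithinAt (by simp))
      ((hpV c u huD hs).differentiableWithinAt (by simp))
      (h'.sum_fderivWithin_prolong hD hU h𝓛 h0' hsol' hW hu huU hs)
    have h2 := sum_fderivWithin_flux (hD c) huD
      ((hLV c u huD hs).differentiableWithinAt (by simp))
      ((hpW c u huD hs).differentiableWithinAt (by simp))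
      (h.sum_fderivWithin_prolong hD hU h𝓛 h0 hsol hV hu huU hs)
    have h3 : fderiv ℝ (fderiv ℝ (c.lagrangian 𝓛)) (c.jet U φ u) (c.prolong U φ W u)
        (c.prolong U φ V u) = fderiv ℝ (fderiv ℝ (c.lagrangian 𝓛)) (c.jet U φ u)
          (c.prolong U φ V u) (c.prolong U φ W u) :=
      ((h𝓛.contDiffAt (AdaptedChart.jet_mem hf.2 huD hs)).isSymmSndFDerivAt (by
        simp only [minSmoothness_of_isRCLikeNormedField]; exact ENat.LEInfty.out)) _ _
    have h4 : ∀ μ, fderivWithin ℝ (fun v => c.omegaFlux 𝓛 (c.jet U φ v) (c.prolong U φ V v)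
        (c.prolong U φ W v) μ) (c.dom U) u = _ := fun μ =>
      fderivWithin_fun_sub (hD c u huD) ((hflux c u huD hs μ).1.differentiableWithinAt (by simp))
        ((hflux c u huD hs μ).2.differentiableWithinAt (by simp))
    simp only [h4, sub_apply, Finset.sum_sub_distrib]
    rw [h1, h2]
    refine Eq.symm (sub_eq_zero.2 ?_)
    exact h3
  · obtain ⟨e, he, hxe⟩ := 𝒪.cover x
    obtain ⟨c, rfl, hs⟩ := hρ.exists_adaptedChart (𝒪.smooth e he) (y := φ x)
      (by rw [hf.2 x hx]; exact hxe)
    have hu := c.mem_dom hxe hx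
    have hxx : c.base.symm (c.base x) = x := c.base.left_inv hxe
    have h2 : fluxForm (c.omegaFlux 𝓛 (c.jet U φ (c.base x)) (c.prolong U φ V (c.base x))
        (c.prolong U φ W (c.base x))) = 0 := by
      rw [omegaFlux_eq_zero]
      · exact map_zero _
      · rcases hVW with h1 | h1
        · exact Or.inl (prolong_eq_zero hK h1 hu (by rwa [hxx]))
        · exact Or.inr (prolong_eq_zero hK h1 hu (by rwa [hxx]))
    rw [DForm.eq_inChart_comp (omegaForm 𝓛 U φ V W) c.base_smooth hxe,
      hα c _ hu (by rwa [hxx]), h2]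
    rfl

end Primitives

/-! ### The multisymplectic form formula -/

section FormFormula

variable {n k : ℕ} {X : Type*} [TopologicalSpace X] [ChartedSpace (Coord (n + 1)) X]
  [IsManifold (mdl (n + 1)) ∞ X] [T2Space X] [SigmaCompactSpace X]
  {Y : Type*} [TopologicalSpace Y] [ChartedSpace (Coord (n + 1) × Coord k) Y]
  [IsManifold (mdlTot (n + 1) k) ∞ Y]
  {F : Type*} [TopologicalSpace F] [ChartedSpace (Coord k) F] [IsManifold (mdl k) ∞ F]
  {ρ : Y → X} {U K : Set X} {φ : X → Y} {𝒪 : OrientedAtlas (n + 1) X}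
  {𝓛 : LagrangianDensity (n + 1) k ρ} {V W : FieldVariation (n + 1) k φ}

omit [IsManifold (mdl (n + 1)) ∞ X] [T2Space X] [SigmaCompactSpace X] in
theorem IsFirstVariation.isPrimitive_omegaForm (hρ : IsSmoothFiberBundle (n + 1) k F ρ)
    (hU : IsOpen U) (hb : HasSmoothBoundary 𝒪 U) (h𝓛 : 𝓛.IsSmooth) (hφ : IsSolution 𝓛 U φ)
    (hV : IsFirstVariation 𝓛 U φ V) (hW : IsFirstVariation 𝓛 U φ W) (hK : IsClosed K)
    (hVW : (∀ x ∈ closure U \ K, V x = 0) ∨ (∀ x ∈ closure U \ K, W x = 0)) :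
    IsPrimitive 𝒪 U K (omegaForm 𝓛 U φ V W) 0 := by
  obtain ⟨δ, Φ, hΦ, hV⟩ := hV
  obtain ⟨δ', Φ', hΦ', hW⟩ := hW
  have h0 : (0 : ℝ) ∈ Ioo (-δ) δ := ⟨neg_lt_zero.2 hΦ.1, hΦ.1⟩
  have h0' : (0 : ℝ) ∈ Ioo (-δ') δ' := ⟨neg_lt_zero.2 hΦ'.1, hΦ'.1⟩
  exact FieldTheory.isPrimitive_omegaForm hρ hU hb h𝓛 hφ.1 hΦ.isFieldFamily h0 hΦ.2.2 hV
    hΦ'.isFieldFamily h0' hΦ'.2.2 hW hK hVW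

theorem IsPrimitive.hasBoundaryIntegral_zero {α : DForm (n + 1) X n}
    (h : IsPrimitive 𝒪 U K α 0) (hU : IsOpen U) (hb : HasSmoothBoundary 𝒪 U) (hK : IsCompact K) :
    HasBoundaryIntegral 𝒪 U α 0 := by
  obtain ⟨c, hc, hc'⟩ := h.stokes hU hb hK
  obtain ⟨A⟩ := hc.1
  -- By Stokes' theorem the value is also the integral of the zero form over `U`.
  have h1 : c = 0 := (hc.2 A).2.2.symm.trans (TopPartition.HasSum.zero (A := A)).2.2
  rwa [h1] at hc'

end FormFormula

/-! ### The pullback of the Poincaré–Cartan form -/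

section PullbackTheta

variable {m k : ℕ} {X : Type*} [TopologicalSpace X] [ChartedSpace (Coord m) X]
  {Y : Type*} [TopologicalSpace Y] [ChartedSpace (Coord m × Coord k) Y]
  {ρ : Y → X} {U : Set X} {φ : X → Y} {𝓛 : LagrangianDensity m k ρ}

/-- On the holonomic vectors of `j¹φ` the contact part of `Θ_L` vanishes and `L d^{n+1}x` remains.
Since `lagrangianForm` is defined without coordinates, the chart independence needed for `formAlong`
follows from the same identity. -/
theorem pullbackTheta_inChart (hD : ∀ c : AdaptedChart m k ρ, UniqueDiffOn ℝ (c.dom U))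
    (h : IsField (m := m) (k := k) U ρ φ) {c : AdaptedChart m k ρ} {u : Coord m}
    (hu : u ∈ c.dom U) (hs : φ (c.base.symm u) ∈ c.tot.source) :
    (pullbackTheta 𝓛 U φ).inChart c.base u = (lagrangianForm 𝓛 U φ).inChart c.base u := by
  have hloc : ∀ (c : AdaptedChart m k ρ), ∀ u ∈ c.dom U, φ (c.base.symm u) ∈ c.tot.source →
      (c.poincareCartan 𝓛 (c.jet U φ u)).compContinuousLinearMap (c.dJet U φ u) =
        (lagrangianForm 𝓛 U φ).inChart c.base u := by
    intro c u hu hs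
    rw [alternating_eq_smul_stdVol ((lagrangianForm 𝓛 U φ).inChart c.base u),
      lagrangianForm_inChart 𝓛 c (h.mdifferentiableWithinAt hu.2) h.2 (hD c) hu hs]
    ext v
    have h1 := c.poincareCartan_jet 𝓛 (c.jet U φ u) (fun i => c.dJet U φ u (v i)) fun i => by
      rw [(h.dJet_apply hD hu hs _).2, (h.dJet_apply hD hu hs _).1]
    simp only [(h.dJet_apply hD hu hs _).1] at h1
    exact h1
  refine (formAlong_inChart h.2 (fun c c' u hu hs hs' => ?_) hu hs).trans (hloc c u hu hs)
  obtain ⟨hb, hu'⟩ := AdaptedChart.mem_dom_of_mem h.2 hu hs'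
  rw [hloc c u hu hs, hloc c' _ hu' (by rwa [c'.base.left_inv hb])]
  exact DForm.inChart_change _ c.base_smooth c'.base_smooth hu.1 hb

end PullbackTheta

section PullbackThetaGlobal

variable {n k : ℕ} {X : Type*} [TopologicalSpace X] [ChartedSpace (Coord (n + 1)) X]
  {Y : Type*} [TopologicalSpace Y] [ChartedSpace (Coord (n + 1) × Coord k) Y]
  [IsManifold (mdlTot (n + 1) k) ∞ Y]
  {F : Type*} [TopologicalSpace F] [ChartedSpace (Coord k) F] [IsManifold (mdl k) ∞ F]
  {ρ : Y → X} {U : Set X} {φ : X → Y} {𝒪 : OrientedAtlas (n + 1) X}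
  {𝓛 : LagrangianDensity (n + 1) k ρ}

theorem pullbackTheta_eq (hρ : IsSmoothFiberBundle (n + 1) k F ρ) (hU : IsOpen U)
    (hb : HasSmoothBoundary 𝒪 U) (h : IsField (m := n + 1) (k := k) U ρ φ) {x : X} (hx : x ∈ U) :
    pullbackTheta 𝓛 U φ x = lagrangianForm 𝓛 U φ x := by
  have hxc := subset_closure hx
  obtain ⟨e, he, hxe⟩ := 𝒪.cover x
  obtain ⟨c, rfl, hs⟩ := hρ.exists_adaptedChart (𝒪.smooth e he) (y := φ x)
    (by rw [h.2 x hxc]; exact hxe)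
  have hu := c.mem_dom hxe hxc
  rw [DForm.eq_inChart_comp (pullbackTheta 𝓛 U φ) c.base_smooth hxe,
    pullbackTheta_inChart (uniqueDiffOn_dom hU hb) h hu (by rwa [c.base.left_inv hxe]),
    ← DForm.eq_inChart_comp _ c.base_smooth hxe]

theorem IsSolution.hasTopIntegral_lagrangianForm {m : ℕ} {X : Type*} [TopologicalSpace X]
    [ChartedSpace (Coord m) X] {Y : Type*} [TopologicalSpace Y]
    [ChartedSpace (Coord m × Coord k) Y] {ρ : Y → X} {U : Set X} {φ : X → Y}
    {𝒪 : OrientedAtlas m X} {𝓛 : LagrangianDensity m k ρ} (h : IsSolution 𝓛 U φ)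
    (hdom : InDomain 𝒪 𝓛 U ((frontier U).domRestrict φ)) :
    HasTopIntegral 𝒪 U (lagrangianForm 𝓛 U φ)
      (boundaryLagrangian 𝒪 𝓛 U ((frontier U).domRestrict φ)) := by
  have h1 : boundaryLagrangian 𝒪 𝓛 U ((frontier U).domRestrict φ) = hdom.choose := dif_pos hdom
  rw [h1]
  exact hdom.choose_spec.2 φ h rfl

theorem IsSolution.hasTopIntegral_pullbackTheta (hρ : IsSmoothFiberBundle (n + 1) k F ρ)
    (hU : IsOpen U) (hb : HasSmoothBoundary 𝒪 U) (h : IsSolution 𝓛 U φ)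
    (hdom : InDomain 𝒪 𝓛 U ((frontier U).domRestrict φ)) :
    HasTopIntegral 𝒪 U (pullbackTheta 𝓛 U φ)
      (boundaryLagrangian 𝒪 𝓛 U ((frontier U).domRestrict φ)) := by
  have h1 := h.hasTopIntegral_lagrangianForm hdom
  exact ⟨h1.1, fun A => TopPartition.HasSum.congr hU (h1.2 A) fun x hx =>
    (pullbackTheta_eq hρ hU hb h.1 hx).symm⟩

end PullbackThetaGlobal

/-! ### Derivatives of the action -/

section ActionDerivative

variable {G : Type*} [NormedAddCommGroup G] [NormedSpace ℝ G] {m : ℕ}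

theorem ContDiffOn.fderivWithin_apply_const {E : Type*} [NormedAddCommGroup E] [NormedSpace ℝ E]
    {S : Set E} {f : E → ℝ} (hf : ContDiffOn ℝ ∞ f S) (hS : UniqueDiffOn ℝ S) (v : E) :
    ContDiffOn ℝ ∞ (fun z => fderivWithin ℝ f S z v) S :=
  (hf.fderivWithin hS (by simp)).clm_apply contDiffOn_const

/-- Differentiation of an integral over `R`, with a cutoff, in the direction `v` of the parameters. -/
theorem hasDerivAt_setIntegral_mul {D R K : Set (Coord m)} {P : Set G} (hP : IsOpen P)
    (hD : UniqueDiffOn ℝ D) (hR : MeasurableSet R) (hRD : R ⊆ D) (hK : IsCompact K) (hKD : K ⊆ D)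
    {w : Coord m → ℝ} (hw : ContinuousOn w D) (hw0 : ∀ u ∈ R, u ∉ K → w u = 0)
    {f : G × Coord m → ℝ} (hf : ContDiffOn ℝ ∞ f (P ×ˢ D)) {q : G} (hq : q ∈ P) (v : G) :
    HasDerivAt (fun τ : ℝ => ∫ u in R, w u * f (q + τ • v, u))
      (∫ u in R, w u * fderivWithin ℝ f (P ×ˢ D) (q, u) (v, 0)) 0 := by
  set P' : Set ℝ := {τ | q + τ • v ∈ P} with hP'
  have hP'o : IsOpen P' := hP.preimage (by fun_prop)
  have h0 : (0 : ℝ) ∈ P' := by simpa [hP'] using hq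
  have hmap : MapsTo (fun z : ℝ × Coord m => (q + z.1 • v, z.2)) (P' ×ˢ D) (P ×ˢ D) :=
    fun z hz => mk_mem_prod hz.1 hz.2
  have hmapc : ContinuousOn (fun z : ℝ × Coord m => (q + z.1 • v, z.2)) (P' ×ˢ D) := by fun_prop
  have hwc : ContinuousOn (fun z : ℝ × Coord m => w z.2) (P' ×ˢ D) :=
    hw.comp continuousOn_snd fun z hz => hz.2
  have hf' := ContDiffOn.fderivWithin_apply_const hf (hP.uniqueDiffOn.prod hD)
    ((v, 0) : G × Coord m)
  have h1 := hasDerivAt_setIntegral_of_continuousOn (μ := volume) (t₀ := 0) (P := P') (D := D)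
    (R := R) (K := K) (F := fun τ u => w u * f (q + τ • v, u))
    (F' := fun τ u => w u * fderivWithin ℝ f (P ×ˢ D) (q + τ • v, u) (v, 0))
    (hP'o.mem_nhds h0) hR hK hKD (hwc.mul (hf.continuousOn.comp hmapc hmap))
    (hwc.mul (hf'.continuousOn.comp hmapc hmap))
    (fun t ht u hu => by
      have h2 := hasFDerivAt_slice_left hP (show q + t • v ∈ P from ht) (hRD hu)
        ((hf _ (mk_mem_prod ht (hRD hu))).differentiableWithinAt (by simp))
      have hl : HasDerivAt (fun τ : ℝ => q + τ • v) v t := by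
        simpa using ((hasDerivAt_id t).smul_const v).const_add q
      exact (HasFDerivAt.comp_hasDerivAt t h2 hl).const_mul (w u))
    (fun t _ u hu huK => by rw [hw0 u hu huK, zero_mul])
    (fun t _ u hu huK => by rw [hw0 u hu huK, zero_mul])
  simpa using h1

theorem fderivWithin_apply_comm {D : Set (Coord m)} {P : Set G} (hP : IsOpen P)
    (hD : UniqueDiffOn ℝ D) {f : G × Coord m → ℝ} (hf : ContDiffOn ℝ ∞ f (P ×ˢ D)) {q : G}
    {u : Coord m} (hq : q ∈ P) (hu : u ∈ D) (hui : u ∈ closure (interior D))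
    (v w : G × Coord m) :
    fderivWithin ℝ (fun z => fderivWithin ℝ f (P ×ˢ D) z v) (P ×ˢ D) (q, u) w =
      fderivWithin ℝ (fun z => fderivWithin ℝ f (P ×ˢ D) z w) (P ×ˢ D) (q, u) v := by
  have hS : UniqueDiffOn ℝ (P ×ˢ D) := hP.uniqueDiffOn.prod hD
  have hz : (q, u) ∈ P ×ˢ D := ⟨hq, hu⟩
  have hint : (q, u) ∈ closure (interior (P ×ˢ D)) := by
    rw [interior_prod_eq, closure_prod_eq, hP.interior_eq]
    exact ⟨subset_closure hq, hui⟩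
  have hsymm := (hf (q, u) hz).isSymmSndFDerivWithinAt (n := ∞) (by
    simp only [minSmoothness_of_isRCLikeNormedField]; exact ENat.LEInfty.out) hS hint hz
  have hd := ((hf.fderivWithin (m := ∞) hS (by simp)) (q, u) hz).differentiableWithinAt (by simp)
  have h1 : ∀ a b : G × Coord m, fderivWithin ℝ (fun z => fderivWithin ℝ f (P ×ˢ D) z a) (P ×ˢ D)
      (q, u) b = fderivWithin ℝ (fderivWithin ℝ f (P ×ˢ D)) (P ×ˢ D) (q, u) b a := by
    intro a b
    rw [(hd.hasFDerivWithinAt.clm_apply (hasFDerivWithinAt_const a _ _)).fderivWithin (hS _ hz),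
      ContinuousLinearMap.comp_zero, zero_add]
    rfl
  rw [h1, h1]
  exact hsymm w v

variable {X : Type*} [TopologicalSpace X] [ChartedSpace (Coord m) X] {𝒪 : OrientedAtlas m X}
  {U : Set X}

/-- The finite index set consists of the weights that meet `closure U` and does not depend on the
form. A family of integrals can thus be differentiated term by term. -/
theorem TopPartition.exists_finset (A : TopPartition 𝒪) (hc : IsCompact (closure U)) :
    ∃ I : Finset X, ∀ (η : DForm m X m) (c : ℝ), A.HasSum U η c →
      c = ∑ p ∈ I, ∫ u in A.region U p, A.weight p ((A.chart p).symm u) *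
        η.inChart (A.chart p) u (stdFrame m) := by
  have hfin := A.weight.locallyFinite.finite_nonempty_inter_compact hc
  refine ⟨hfin.toFinset, fun η c hη => ?_⟩
  refine hη.2.2.symm.trans (finsum_eq_sum_of_support_subset _ fun p hp => ?_)
  rw [Function.mem_support] at hp
  by_contra hcon
  refine hp (setIntegral_eq_zero_of_forall_eq_zero fun u hu => ?_)
  rw [TopPartition.piece]
  have : A.weight p ((A.chart p).symm u) = 0 := by
    by_contra hne
    exact hcon (by simpa using ⟨_, hne, subset_closure hu.2⟩)
  rw [this, zero_mul]

variable {k : ℕ}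
  {Y : Type*} [TopologicalSpace Y] [ChartedSpace (Coord m × Coord k) Y] {ρ : Y → X}
  {𝓛 : LagrangianDensity m k ρ} {P : Set G} {Φ : G → X → Y}

theorem TopPartition.hasDerivAt_integral (A : TopPartition 𝒪) (hU : IsOpen U)
    (hc : IsCompact (closure U)) (p : X)
    (hD : UniqueDiffOn ℝ ((A.chart p).target ∩ (A.chart p).symm ⁻¹' closure U)) (hP : IsOpen P)
    {f : G × Coord m → ℝ}
    (hf : ContDiffOn ℝ ∞ f (P ×ˢ ((A.chart p).target ∩ (A.chart p).symm ⁻¹' closure U)))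
    {q : G} (hq : q ∈ P) (v : G) :
    HasDerivAt (fun τ : ℝ => ∫ u in A.region U p, A.weight p ((A.chart p).symm u) *
        f (q + τ • v, u))
      (∫ u in A.region U p, A.weight p ((A.chart p).symm u) *
        fderivWithin ℝ f (P ×ˢ ((A.chart p).target ∩ (A.chart p).symm ⁻¹' closure U)) (q, u)
          (v, 0)) 0 := by
  set e := A.chart p
  have hCsub : tsupport (A.weight p) ∩ closure U ⊆ e.source := fun x hx => A.subordinate p hx.1
  have hK : IsCompact (e '' (tsupport (A.weight p) ∩ closure U)) :=
    (hc.inter_left (isClosed_tsupport _)).image_of_continuousOn (e.continuousOn.mono hCsub)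
  refine hasDerivAt_setIntegral_mul hP hD (A.isOpen_region hU p).measurableSet
    (inter_subset_inter_right _ (preimage_mono subset_closure)) hK ?_ ?_ ?_ hf hq v
  · rintro _ ⟨x, hx, rfl⟩
    exact ⟨e.map_source (hCsub hx), by rw [mem_preimage, e.left_inv (hCsub hx)]; exact hx.2⟩
  · exact (A.weight p).contMDiff.continuous.comp_continuousOn
      (e.continuousOn_symm.mono inter_subset_left)
  · intro u hu huK
    refine image_eq_zero_of_notMem_tsupport fun h => huK ?_
    exact ⟨_, ⟨h, subset_closure hu.2⟩, e.right_inv hu.1⟩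

/-- Only the base chart `e` is fixed. A field may leave any given chart of `Y`, so an adapted chart
over `e` is chosen at each point; there the density is `L` along a smooth family of jets. -/
theorem IsFieldFamily.contDiffOn_lagrangianForm [IsManifold (mdlTot m k) ∞ Y]
    {F : Type*} [TopologicalSpace F] [ChartedSpace (Coord k) F] [IsManifold (mdl k) ∞ F]
    (hρ : IsSmoothFiberBundle m k F ρ) (h𝓛 : 𝓛.IsSmooth)
    (hD : ∀ c : AdaptedChart m k ρ, UniqueDiffOn ℝ (c.dom U)) (h : IsFieldFamily m k ρ U P Φ)
    {e : OpenPartialHomeomorph X (Coord m)} (he : e ∈ IsManifold.maximalAtlas (mdl m) ∞ X) :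
    ContDiffOn ℝ ∞ (fun z : G × Coord m => (lagrangianForm 𝓛 U (Φ z.1)).inChart e z.2 (stdFrame m))
      (P ×ˢ (e.target ∩ e.symm ⁻¹' closure U)) := by
  rintro ⟨q, u⟩ ⟨hq, hu⟩
  obtain ⟨c, rfl, hs⟩ := hρ.exists_adaptedChart he (y := Φ q (e.symm u))
    (by rw [(h.isField q hq).2 _ hu.2]; exact e.map_target hu.1)
  have hL : ∀ z ∈ P ×ˢ c.dom U, Φ z.1 (c.base.symm z.2) ∈ c.tot.source →
      (lagrangianForm 𝓛 U (Φ z.1)).inChart c.base z.2 (stdFrame m) =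
        c.lagrangian 𝓛 (c.jet U (Φ z.1) z.2) := fun z hz hzs =>
    lagrangianForm_inChart 𝓛 c ((h.isField z.1 hz.1).mdifferentiableWithinAt hz.2.2)
      (h.isField z.1 hz.1).2 (hD c) hz.2 hzs
  have h1 := (h𝓛.contDiffAt (AdaptedChart.jet_mem (h.isField q hq).2 hu hs)).comp_contDiffWithinAt
    (q, u) (h.contDiffWithinAt_jet hD hq hu hs)
  refine h1.congr_of_eventuallyEq ?_ (hL (q, u) (mk_mem_prod hq hu) hs)
  filter_upwards [h.eventually_mem_source hq hu hs, self_mem_nhdsWithin] with z hz hzS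
  exact hL z hzS hz

end ActionDerivative

/-! ### The exterior derivatives of the boundary Lagrangian -/

section BoundaryLagrangian

variable {n k : ℕ} {X : Type*} [TopologicalSpace X] [ChartedSpace (Coord (n + 1)) X]
  {Y : Type*} [TopologicalSpace Y] [ChartedSpace (Coord (n + 1) × Coord k) Y]
  {ρ : Y → X} {U : Set X} {𝒪 : OrientedAtlas (n + 1) X}
  {𝓛 : LagrangianDensity (n + 1) k ρ}

/-- The derivative of the Lagrangian densities of a curve of fields. -/
def lagrangianVelocity (𝓛 : LagrangianDensity (n + 1) k ρ) (U : Set X) (Φ : ℝ → X → Y) :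
    DForm (n + 1) X (n + 1) := fun x =>
  (deriv (fun ε => (lagrangianForm 𝓛 U (Φ ε) x : Coord (n + 1) [⋀^Fin (n + 1)]→L[ℝ] ℝ)
    (stdFrame (n + 1))) 0 • stdVol (n + 1) : Coord (n + 1) [⋀^Fin (n + 1)]→L[ℝ] ℝ)

/-- The passage to a chart multiplies a top form by a determinant that does not depend on `ε`. -/
theorem lagrangianVelocity_inChart (Φ : ℝ → X → Y) (e : OpenPartialHomeomorph X (Coord (n + 1)))
    (u : Coord (n + 1)) :
    (lagrangianVelocity 𝓛 U Φ).inChart e u (stdFrame (n + 1)) =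
      deriv (fun ε => (lagrangianForm 𝓛 U (Φ ε)).inChart e u (stdFrame (n + 1))) 0 := by
  have h1 : ∀ η : DForm (n + 1) X (n + 1), η.inChart e u (stdFrame (n + 1)) =
      (symmD e u).det * (η (e.symm u) : Coord (n + 1) [⋀^Fin (n + 1)]→L[ℝ] ℝ)
        (stdFrame (n + 1)) := fun η =>
    alternating_comp_stdFrame (η (e.symm u)) (symmD e u)
  simp only [h1]
  rw [deriv_const_mul_field]
  congr 1
  change deriv _ 0 * stdVol (n + 1) (stdFrame (n + 1)) = _
  rw [stdVol_stdFrame, mul_one]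

section

variable {P : Set ℝ} {Φ : ℝ → X → Y}

theorem IsFieldFamily.lagrangianVelocity_inChart_eq [IsManifold (mdlTot (n + 1) k) ∞ Y]
    {F : Type*} [TopologicalSpace F] [ChartedSpace (Coord k) F] [IsManifold (mdl k) ∞ F]
    (hρ : IsSmoothFiberBundle (n + 1) k F ρ) (h𝓛 : 𝓛.IsSmooth)
    (hD : ∀ c : AdaptedChart (n + 1) k ρ, UniqueDiffOn ℝ (c.dom U))
    (h : IsFieldFamily (n + 1) k ρ U P Φ) (h0 : (0 : ℝ) ∈ P)
    {e : OpenPartialHomeomorph X (Coord (n + 1))}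
    (he : e ∈ IsManifold.maximalAtlas (mdl (n + 1)) ∞ X) {u : Coord (n + 1)}
    (hu : u ∈ e.target ∩ e.symm ⁻¹' closure U) :
    (lagrangianVelocity 𝓛 U Φ).inChart e u (stdFrame (n + 1)) =
      fderivWithin ℝ (fun z : ℝ × Coord (n + 1) =>
        (lagrangianForm 𝓛 U (Φ z.1)).inChart e z.2 (stdFrame (n + 1)))
        (P ×ˢ (e.target ∩ e.symm ⁻¹' closure U)) (0, u) (1, 0) := by
  rw [lagrangianVelocity_inChart]
  have h1 := h.contDiffOn_lagrangianForm hρ h𝓛 hD he (0, u) (mk_mem_prod h0 hu)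
  exact (hasFDerivAt_slice_left h.isOpen h0 hu
    (h1.differentiableWithinAt (by simp))).hasDerivAt.deriv

/-- The first variation formula: the Lagrangian density of a curve of solutions changes by an exact
form. -/
theorem IsFieldFamily.isPrimitive_thetaForm [IsManifold (mdlTot (n + 1) k) ∞ Y]
    {F : Type*} [TopologicalSpace F] [ChartedSpace (Coord k) F] [IsManifold (mdl k) ∞ F]
    (hρ : IsSmoothFiberBundle (n + 1) k F ρ) (hU : IsOpen U) (hb : HasSmoothBoundary 𝒪 U)
    (h𝓛 : 𝓛.IsSmooth) (h : IsFieldFamily (n + 1) k ρ U P Φ) (h0 : (0 : ℝ) ∈ P)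
    (hsol : IsSolution 𝓛 U (Φ 0)) :
    IsPrimitive 𝒪 U (closure U) (thetaForm 𝓛 U (Φ 0) (velocity (n + 1) k Φ))
      (lagrangianVelocity 𝓛 U Φ) := by
  have hD := uniqueDiffOn_dom (k := k) (ρ := ρ) hU hb
  have hf := hsol.1
  have hV : ∀ x ∈ closure U, Φ 0 x = Φ 0 x ∧ velocity (n + 1) k Φ x = velocity (n + 1) k Φ x :=
    fun _ _ => ⟨rfl, rfl⟩
  refine isPrimitive_of_flux hρ hU hf
    (fun c u hu hs => thetaForm_inChart hD hU h𝓛 hf h h0 hV hu hs)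
    (fun c u hu hs => h.contDiffWithinAt_thetaFlux hD h𝓛 hf h0 hV hu hs)
    (fun c u hu huU hs => ?_) (fun e he => ?_) (fun x hx hxK => absurd hx hxK)
    (fun x hx hxK => absurd (subset_closure hx) hxK)
  · have huD : u ∈ c.dom U := ⟨hu, subset_closure huU⟩
    have hp := (h.contDiffWithinAt_prolong hD h0 hV huD hs).snd.fst
    -- By the Euler–Lagrange equations the divergence is `dL(j¹V)`, which is also the derivative of
    -- `L(j¹φ_ε)` because the jets vary by the prolongation.
    have h1 := sum_fderivWithin_flux (hD c) huD
      ((hf.contDiffWithinAt_fderiv_lagrangian hD h𝓛 huD hs).differentiableWithinAt (by simp))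
      (hp.differentiableWithinAt (by simp)) (hsol.sum_fderivWithin hD h𝓛 hu huU hs)
    refine Eq.trans ?_ h1.symm
    rw [lagrangianVelocity_inChart]
    have h2 := ((h𝓛.contDiffAt (AdaptedChart.jet_mem hf.2 huD hs)).differentiableAt
      (by simp)).hasFDerivAt.comp_hasDerivAt (0 : ℝ)
        (h.hasDerivAt_jet_prolong hD hU h0 hV huD hs)
    refine (h2.congr_of_eventuallyEq ?_).deriv
    have h3 := (tendsto_line (D := c.dom U) h.isOpen h0 huD (1 : ℝ)).eventually
      ((h.eventually_mem_source h0 huD hs).and self_mem_nhdsWithin)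
    filter_upwards [h3] with ε hε
    rw [zero_add, smul_eq_mul, mul_one] at hε
    exact lagrangianForm_inChart 𝓛 c ((h.isField ε hε.2.1).mdifferentiableWithinAt huD.2)
      (h.isField ε hε.2.1).2 (hD c) huD hε.1
  · have h1 := ContDiffOn.fderivWithin_apply_const (h.contDiffOn_lagrangianForm hρ h𝓛 hD he.1)
      (h.isOpen.uniqueDiffOn.prod (uniqueDiffOn_preimage_closure hU hb he.1))
      ((1, 0) : ℝ × Coord (n + 1))
    refine (h1.continuousOn.comp (f := fun u => ((0 : ℝ), u)) (by fun_prop)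
      fun u hu => mk_mem_prod h0 hu).congr fun u hu => ?_
    exact h.lagrangianVelocity_inChart_eq hρ h𝓛 hD h0 he.1 hu

end

section

variable {G : Type*} [NormedAddCommGroup G] [NormedSpace ℝ G] {P : Set G} {Φ : G → X → Y}
  {B : G → ℝ}

theorem IsFieldFamily.hasDerivAt_action [IsManifold (mdlTot (n + 1) k) ∞ Y]
    {F : Type*} [TopologicalSpace F] [ChartedSpace (Coord k) F] [IsManifold (mdl k) ∞ F]
    (hρ : IsSmoothFiberBundle (n + 1) k F ρ) (hU : IsOpen U) (hb : HasSmoothBoundary 𝒪 U)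
    (hc : IsCompact (closure U)) (h𝓛 : 𝓛.IsSmooth) (h : IsFieldFamily (n + 1) k ρ U P Φ)
    (hB : ∀ q ∈ P, HasTopIntegral 𝒪 U (lagrangianForm 𝓛 U (Φ q)) (B q)) (A : TopPartition 𝒪)
    {I : Finset X} (hI : ∀ (η : DForm (n + 1) X (n + 1)) (c : ℝ), A.HasSum U η c →
      c = ∑ p ∈ I, ∫ u in A.region U p, A.weight p ((A.chart p).symm u) *
        η.inChart (A.chart p) u (stdFrame (n + 1))) {q : G} (hq : q ∈ P) (v : G) :
    HasDerivAt (fun τ : ℝ => B (q + τ • v))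
      (∑ p ∈ I, ∫ u in A.region U p, A.weight p ((A.chart p).symm u) *
        fderivWithin ℝ (fun z : G × Coord (n + 1) =>
          (lagrangianForm 𝓛 U (Φ z.1)).inChart (A.chart p) z.2 (stdFrame (n + 1)))
          (P ×ˢ ((A.chart p).target ∩ (A.chart p).symm ⁻¹' closure U)) (q, u) (v, 0)) 0 := by
  have hD := uniqueDiffOn_dom (k := k) (ρ := ρ) hU hb
  have h1 := HasDerivAt.fun_sum (u := I) fun p _ => A.hasDerivAt_integral hU hc p
    (uniqueDiffOn_preimage_closure hU hb (A.positive p).1) h.isOpen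
    (h.contDiffOn_lagrangianForm hρ h𝓛 hD (A.positive p).1) hq v
  refine h1.congr_of_eventuallyEq ?_
  have hc0 : ContinuousAt (fun τ : ℝ => q + τ • v) 0 := by fun_prop
  filter_upwards [hc0.preimage_mem_nhds (h.isOpen.mem_nhds (by simpa using hq))] with τ hτ
  exact hI _ _ ((hB _ hτ).2 A)

end

variable [IsManifold (mdl (n + 1)) ∞ X] [T2Space X] [SigmaCompactSpace X]
  [IsManifold (mdlTot (n + 1) k) ∞ Y]
  {F : Type*} [TopologicalSpace F] [ChartedSpace (Coord k) F] [IsManifold (mdl k) ∞ F]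

/-- The first exterior derivative of the boundary Lagrangian. -/
theorem IsSolutionCurve.hasDerivAt_boundaryLagrangian {δ : ℝ} {Φ : ℝ → X → Y}
    (hρ : IsSmoothFiberBundle (n + 1) k F ρ) (hU : IsOpen U) (hb : HasSmoothBoundary 𝒪 U)
    (hc : IsCompact (closure U)) (h𝓛 : 𝓛.IsSmooth) (h : IsSolutionCurve 𝓛 U δ Φ)
    (hdom : ∀ ε ∈ Ioo (-δ) δ, InDomain 𝒪 𝓛 U ((frontier U).domRestrict (Φ ε))) :
    ∃ c : ℝ,
      HasDerivAt (fun ε => boundaryLagrangian 𝒪 𝓛 U ((frontier U).domRestrict (Φ ε))) c 0 ∧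
      HasBoundaryIntegral 𝒪 U (thetaForm 𝓛 U (Φ 0) (velocity (n + 1) k Φ)) c := by
  have hD := uniqueDiffOn_dom (k := k) (ρ := ρ) hU hb
  have h0 : (0 : ℝ) ∈ Ioo (-δ) δ := ⟨neg_lt_zero.2 h.1, h.1⟩
  have hfam := h.isFieldFamily
  -- Stokes' theorem provides one number that is both the boundary integral and the integral over
  -- `U` of the velocity of the density. It remains to recognise the latter as the derivative of the
  -- action.
  obtain ⟨c, hc1, hc2⟩ := (hfam.isPrimitive_thetaForm hρ hU hb h𝓛 h0 (h.2.2 0 h0)).stokes hU hb hc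
  refine ⟨c, ?_, hc2⟩
  obtain ⟨A⟩ := hc1.1
  obtain ⟨I, hI⟩ := A.exists_finset hc
  have h1 := hfam.hasDerivAt_action hρ hU hb hc h𝓛
    (fun q hq => (h.2.2 q hq).hasTopIntegral_lagrangianForm (hdom q hq)) A hI h0 1
  simp only [zero_add, smul_eq_mul, mul_one] at h1
  rw [hI _ _ (hc1.2 A)]
  refine h1.congr_deriv (Finset.sum_congr rfl fun p _ => ?_)
  refine setIntegral_congr_fun (A.isOpen_region hU p).measurableSet fun u hu => ?_
  rw [hfam.lagrangianVelocity_inChart_eq hρ h𝓛 hD h0 (A.positive p).1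
    ⟨hu.1, subset_closure hu.2⟩]

omit [IsManifold (mdl (n + 1)) ∞ X] [T2Space X] [SigmaCompactSpace X]
  [IsManifold (mdlTot (n + 1) k) ∞ Y] in
theorem IsSolutionSurface.curve_fst {δ : ℝ} {Ψ : ℝ → ℝ → X → Y}
    (h : IsSolutionSurface 𝓛 U δ Ψ) : IsSolutionCurve 𝓛 U δ fun s => Ψ s 0 := by
  have h0 : (0 : ℝ) ∈ Ioo (-δ) δ := ⟨neg_lt_zero.2 h.1, h.1⟩
  refine ⟨h.1, ?_, fun s hs => h.2.2 s hs 0 h0⟩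
  have h1 : ContMDiffOn (𝓘(ℝ, ℝ).prod (mdl (n + 1)))
      ((𝓘(ℝ, ℝ).prod 𝓘(ℝ, ℝ)).prod (mdl (n + 1))) ∞
      (fun q : ℝ × X => ((q.1, (0 : ℝ)), q.2)) (Ioo (-δ) δ ×ˢ closure U) :=
    ((contMDiff_fst.prodMk contMDiff_const).prodMk contMDiff_snd).contMDiffOn
  exact h.2.1.comp h1 fun q hq => ⟨⟨hq.1, h0⟩, hq.2⟩

omit [IsManifold (mdl (n + 1)) ∞ X] [T2Space X] [SigmaCompactSpace X]
  [IsManifold (mdlTot (n + 1) k) ∞ Y] in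
theorem IsSolutionSurface.curve_snd {δ : ℝ} {Ψ : ℝ → ℝ → X → Y}
    (h : IsSolutionSurface 𝓛 U δ Ψ) : IsSolutionCurve 𝓛 U δ fun t => Ψ 0 t := by
  have h0 : (0 : ℝ) ∈ Ioo (-δ) δ := ⟨neg_lt_zero.2 h.1, h.1⟩
  refine ⟨h.1, ?_, fun t ht => h.2.2 0 h0 t ht⟩
  have h1 : ContMDiffOn (𝓘(ℝ, ℝ).prod (mdl (n + 1)))
      ((𝓘(ℝ, ℝ).prod 𝓘(ℝ, ℝ)).prod (mdl (n + 1))) ∞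
      (fun q : ℝ × X => (((0 : ℝ), q.1), q.2)) (Ioo (-δ) δ ×ˢ closure U) :=
    ((contMDiff_const.prodMk contMDiff_fst).prodMk contMDiff_snd).contMDiffOn
  exact h.2.1.comp h1 fun q hq => ⟨⟨h0, hq.1⟩, hq.2⟩

/-- The second exterior derivative of the boundary Lagrangian. -/
theorem IsSolutionSurface.hasDerivAt_deriv_boundaryLagrangian {δ : ℝ} {Ψ : ℝ → ℝ → X → Y}
    (hρ : IsSmoothFiberBundle (n + 1) k F ρ) (hU : IsOpen U) (hb : HasSmoothBoundary 𝒪 U)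
    (hc : IsCompact (closure U)) (h𝓛 : 𝓛.IsSmooth) (h : IsSolutionSurface 𝓛 U δ Ψ)
    (hdom : ∀ s ∈ Ioo (-δ) δ, ∀ t ∈ Ioo (-δ) δ,
      InDomain 𝒪 𝓛 U ((frontier U).domRestrict (Ψ s t))) :
    ∃ a b : ℝ,
      HasDerivAt (fun s => deriv (fun t =>
        boundaryLagrangian 𝒪 𝓛 U ((frontier U).domRestrict (Ψ s t))) 0) a 0 ∧
      HasDerivAt (fun t => deriv (fun s =>
        boundaryLagrangian 𝒪 𝓛 U ((frontier U).domRestrict (Ψ s t))) 0) b 0 ∧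
      HasBoundaryIntegral 𝒪 U
        (omegaForm 𝓛 U (Ψ 0 0) (velocity (n + 1) k (fun s => Ψ s 0))
          (velocity (n + 1) k (fun t => Ψ 0 t))) (a - b) := by
  have hD := uniqueDiffOn_dom (k := k) (ρ := ρ) hU hb
  have h0 : (0 : ℝ) ∈ Ioo (-δ) δ := ⟨neg_lt_zero.2 h.1, h.1⟩
  have hfam := h.isFieldFamily
  obtain ⟨A⟩ := nonempty_topPartition 𝒪
  obtain ⟨I, hI⟩ := A.exists_finset hc
  set P : Set (ℝ × ℝ) := Ioo (-δ) δ ×ˢ Ioo (-δ) δ with hP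
  have h00 : ((0, 0) : ℝ × ℝ) ∈ P := ⟨h0, h0⟩
  set f : X → (ℝ × ℝ) × Coord (n + 1) → ℝ := fun p z =>
    (lagrangianForm 𝓛 U (Ψ z.1.1 z.1.2)).inChart (A.chart p) z.2 (stdFrame (n + 1)) with hf
  set D : X → Set (Coord (n + 1)) := fun p =>
    (A.chart p).target ∩ (A.chart p).symm ⁻¹' closure U with hDdef
  have hDp : ∀ p, UniqueDiffOn ℝ (D p) := fun p =>
    uniqueDiffOn_preimage_closure hU hb (A.positive p).1
  have hfs : ∀ p, ContDiffOn ℝ ∞ (f p) (P ×ˢ D p) := fun p =>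
    hfam.contDiffOn_lagrangianForm hρ h𝓛 hD (A.positive p).1
  have hfs' : ∀ p v, ContDiffOn ℝ ∞ (fun z => fderivWithin ℝ (f p) (P ×ˢ D p) z v) (P ×ˢ D p) :=
    fun p v => ContDiffOn.fderivWithin_apply_const (hfs p)
      (hfam.isOpen.uniqueDiffOn.prod (hDp p)) v
  have h1 := fun (q : ℝ × ℝ) (hq : q ∈ P) (v : ℝ × ℝ) =>
    hfam.hasDerivAt_action (B := fun q : ℝ × ℝ =>
      boundaryLagrangian 𝒪 𝓛 U ((frontier U).domRestrict (Ψ q.1 q.2))) hρ hU hb hc h𝓛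
      (fun q hq => (h.2.2 q.1 hq.1 q.2 hq.2).hasTopIntegral_lagrangianForm
        (hdom q.1 hq.1 q.2 hq.2)) A hI hq v
  have h2 := fun (v w : ℝ × ℝ) => HasDerivAt.fun_sum (u := I) fun p _ =>
    A.hasDerivAt_integral hU hc p (hDp p) hfam.isOpen (hfs' p (v, 0)) h00 w
  -- The form formula applies to the two velocities, with `closure U` as the compact set, so the
  -- right side of the formula is zero.
  have hbd : HasBoundaryIntegral 𝒪 U
      (omegaForm 𝓛 U (Ψ 0 0) (velocity (n + 1) k (fun s => Ψ s 0))
        (velocity (n + 1) k (fun t => Ψ 0 t))) 0 :=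
    (IsFirstVariation.isPrimitive_omegaForm hρ hU hb h𝓛 (h.2.2 0 h0 0 h0)
      ⟨δ, fun s => Ψ s 0, h.curve_fst, fun _ _ => ⟨rfl, rfl⟩⟩
      ⟨δ, fun t => Ψ 0 t, h.curve_snd, fun _ _ => ⟨rfl, rfl⟩⟩ isClosed_closure
      (Or.inl fun x hx => absurd hx.1 hx.2)).hasBoundaryIntegral_zero hU hb hc
  refine ⟨_, _, (h2 (0, 1) (1, 0)).congr_of_eventuallyEq ?_,
    (h2 (1, 0) (0, 1)).congr_of_eventuallyEq ?_, ?_⟩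
  · filter_upwards [isOpen_Ioo.mem_nhds h0] with s hs
    have h3 := (h1 (s, 0) ⟨hs, h0⟩ (0, 1)).deriv
    simpa using h3
  · filter_upwards [isOpen_Ioo.mem_nhds h0] with t ht
    have h3 := (h1 (0, t) ⟨h0, ht⟩ (1, 0)).deriv
    simpa using h3
  -- The two iterated derivatives agree chart by chart, since the density is jointly smooth in `(s,
  -- t)`; hence `a - b` is zero as well.
  · convert hbd using 1
    rw [sub_eq_zero]
    refine Finset.sum_congr rfl fun p _ => ?_
    refine setIntegral_congr_fun (A.isOpen_region hU p).measurableSet fun u hu => ?_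
    have huD : u ∈ D p := ⟨hu.1, subset_closure hu.2⟩
    have h3 := fderivWithin_apply_comm hfam.isOpen (hDp p) (hfs p) h00 huD
      (subset_closure_interior_preimage hU _ huD) ((0, 1), 0) ((1, 0), 0)
    exact congrArg (A.weight p ((A.chart p).symm u) * ·) h3

end BoundaryLagrangian

end FieldTheory

end

/-! ### The main theorem -/

open FieldTheory in
theorem mainTheorem2 {n k : ℕ}
    {X : Type*} [TopologicalSpace X] [ChartedSpace (Coord (n + 1)) X]
    [IsManifold (mdl (n + 1)) ∞ X] [T2Space X] [SigmaCompactSpace X]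
    {Y : Type*} [TopologicalSpace Y] [ChartedSpace (Coord (n + 1) × Coord k) Y]
    [IsManifold (mdlTot (n + 1) k) ∞ Y] [T2Space Y]
    {F : Type*} [TopologicalSpace F] [ChartedSpace (Coord k) F] [IsManifold (mdl k) ∞ F]
    (𝒪 : OrientedAtlas (n + 1) X)
    (ρ : Y → X) (hρ : IsSmoothFiberBundle (n + 1) k F ρ)
    (𝓛 : LagrangianDensity (n + 1) k ρ) (h𝓛 : 𝓛.IsSmooth)
    (U : Set X) (hU : IsOpen U) (h_bdry : HasSmoothBoundary 𝒪 U) :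
    -- the boundary Lagrangian and its derivatives, for `U` with compact closure
    (IsCompact (closure U) →
      -- the boundary Lagrangian is the integral of the Poincaré–Cartan form
      (∀ φ : X → Y, IsSolution 𝓛 U φ → InDomain 𝒪 𝓛 U ((frontier U).domRestrict φ) →
        HasTopIntegral 𝒪 U (pullbackTheta 𝓛 U φ)
          (boundaryLagrangian 𝒪 𝓛 U ((frontier U).domRestrict φ))) ∧
      -- its first exterior derivative
      (∀ (δ : ℝ) (Φ : ℝ → X → Y), IsSolutionCurve 𝓛 U δ Φ →
        (∀ ε ∈ Ioo (-δ) δ, InDomain 𝒪 𝓛 U ((frontier U).domRestrict (Φ ε))) →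
        ∃ c : ℝ,
          HasDerivAt (fun ε => boundaryLagrangian 𝒪 𝓛 U ((frontier U).domRestrict (Φ ε))) c 0 ∧
          HasBoundaryIntegral 𝒪 U (thetaForm 𝓛 U (Φ 0) (velocity (n + 1) k Φ)) c) ∧
      -- its second exterior derivative
      (∀ (δ : ℝ) (Ψ : ℝ → ℝ → X → Y), IsSolutionSurface 𝓛 U δ Ψ →
        (∀ s ∈ Ioo (-δ) δ, ∀ t ∈ Ioo (-δ) δ,
          InDomain 𝒪 𝓛 U ((frontier U).domRestrict (Ψ s t))) →
        ∃ a b : ℝ,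
          HasDerivAt (fun s => deriv (fun t =>
            boundaryLagrangian 𝒪 𝓛 U ((frontier U).domRestrict (Ψ s t))) 0) a 0 ∧
          HasDerivAt (fun t => deriv (fun s =>
            boundaryLagrangian 𝒪 𝓛 U ((frontier U).domRestrict (Ψ s t))) 0) b 0 ∧
          HasBoundaryIntegral 𝒪 U
            (omegaForm 𝓛 U (Ψ 0 0) (velocity (n + 1) k (fun s => Ψ s 0))
              (velocity (n + 1) k (fun t => Ψ 0 t))) (a - b))) ∧
    -- for every solution and first variations, one of them with compact support in `closure U`
    (∀ φ : X → Y, IsSolution 𝓛 U φ → ∀ V W : FieldVariation (n + 1) k φ,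
      IsFirstVariation 𝓛 U φ V → IsFirstVariation 𝓛 U φ W →
      ∀ K : Set X, IsCompact K →
      ((∀ x ∈ closure U \ K, V x = 0) ∨ (∀ x ∈ closure U \ K, W x = 0)) →
      -- the multisymplectic form formula
      HasBoundaryIntegral 𝒪 U (omegaForm 𝓛 U φ V W) 0 ∧
      -- equality of the Crnković–Witten forms of two hypersurfaces with `∂U = Sp - Sm`,
      -- each oriented by the normals that point out of its past side `Pp`, resp. `Pm`
      (∀ Sp Sm Pp Pm : Set X, IsClosed Sp → IsClosed Sm → Disjoint Sp Sm →
        frontier U = Sp ∪ Sm →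
        (∀ x ∈ Sp, ∀ᶠ q in 𝓝 x, (q ∈ U ↔ q ∈ Pp)) →
        (∀ x ∈ Sm, ∀ᶠ q in 𝓝 x, (q ∈ closure U ↔ q ∉ Pm)) →
        ∃ c : ℝ,
          HasHypersurfaceIntegral 𝒪 Sm Pm (omegaForm 𝓛 U φ V W) c ∧
          HasHypersurfaceIntegral 𝒪 Sp Pp (omegaForm 𝓛 U φ V W) c)) := by
  refine ⟨fun hc => ⟨fun φ hφ hdom => hφ.hasTopIntegral_pullbackTheta hρ hU h_bdry hdom,
    fun δ Φ h hdom => h.hasDerivAt_boundaryLagrangian hρ hU h_bdry hc h𝓛 hdom,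
    fun δ Ψ h hdom => h.hasDerivAt_deriv_boundaryLagrangian hρ hU h_bdry hc h𝓛 hdom⟩,
    fun φ hφ V W hV hW K hK hVW => ?_⟩
  have hp := hV.isPrimitive_omegaForm hρ hU h_bdry h𝓛 hφ hW hK.isClosed hVW
  have hint := hp.hasBoundaryIntegral_zero hU h_bdry hK
  exact ⟨hint, fun Sp Sm Pp Pm hSp hSm hdis hfr hPp hPm =>
    hasHypersurfaceIntegral_eq_of_boundary h_bdry hK
      (fun e he => (hp.continuousOn_form e he 0).mono
        (inter_subset_inter_right _ (preimage_mono frontier_subset_closure)))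
      (fun x hx hxK => hp.form_eq_zero x (frontier_subset_closure hx) hxK)
      hint hSp hSm hdis hfr hPp hPm⟩
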